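/- Conventions. In forcing notions stronger conditions are larger; every forcing notion has a weakest element $\emptyset$, equivalent to no other condition (added if necessary). Let $\mathbf H:\omega\to\omega$ satisfy $\mathbf H(i)\ge 2^{2^{i+1}}$ for all $i$, and identify $\mathbf H(i)$ with $\{0,\dots,\mathbf H(i)-1\}$. Let $K$ be the set of creatures $t$ for $\mathbf H$ given by $\mathbf{dis}[t]=(k_t,E_t)$, where $E_t\subseteq \mathbf H(k_t)$ and $0<|E_t|<\mathbf H(k_t)$, $$\mathbf{val}[t]=\Big\{(u,v)\in\prod_{i<k_t}\mathbf H(i)\times\prod_{i\le k_t}\mathbf H(i):\ u\vartriangleleft v,\ v(k_t)\notin E_t\Big\},$$ $\mathbf{nor}[t]=1$ if $|E_t|\ge\frac14\mathbf H(k_t)$ and $\mathbf{nor}[t]=\mathbf H(k_t)-|E_t|$ otherwise. The composition operation $\Sigma$ gives non-empty results for singletons only, and $\Sigma(t)=\{s\in K: k_s=k_t,\ E_t\subseteq E_s\}$. For $\mathcal F\subseteq\omega^\omega$, a condition of $\mathbb Q^*_{\mathcal F}(K,\Sigma)$ is a sequence $p=(w,t_0,t_1,\dots)$ with $w\in\prod_{i<n}\mathbf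 H(i)$ for some $n$, $t_i\in K$, $k_{t_i}=n+i$, such that for some $f\in\mathcal F$ we have $\mathbf{nor}[t_i]\ge f(k_{t_i})$ for all but finitely many $i$; $p\le q$ iff $q$ arises from $p$ by finitely many applications of the operations of extending $w$ to some $w^*\in\mathrm{pos}(w,t_0,\dots,t_{m-1})$ and deleting $t_0,\dots,t_{m-1}$, and of replacing all $t_i$ by members of $\Sigma(t_i)$ (the intermediate results need not satisfy the norm condition). Put $$\mathcal F_0=\{n\mapsto\max(2,\mathbf H(n)-2^{kn}):k<\omega\},\quad \mathcal F_1=\{n\mapsto\max(2,\mathbf H(n)-2^{k}):k<\omega\},\quad \mathcal F_2=\{n\mapsto\max(2,\mathbf H(n)-k2^{n}):k<\omega\}.$$ A forcing notion $\mathbb P$ is topologically sweet if there is a topology on $\mathbb P$ with a countable base in which $\emptyset$ is isolated and such that whenever $p_n\to p$, $q\ge p$ and $W$ is a neighbourhood of $q$, there is $r\in W$, $r\ge q$, with $p_n\le r$ for infinitely many $n$. Let $\mathbb C=(2^{<\omega},\vartriangleleft)$ be the Cohen forcing and $\dot W$ its canonical generic real. A Souslin ccc forcing notion $\mathbb Q$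 (ccc; its conditions are coded by reals so that the set of conditions, the order and the incompatibility relation are $\Sigma^1_1$) is very explicitly sour over Cohen if there are standard $\mathbb Q$-names $\dot\tau_0,\dot\tau_1$ for elements of $2^\omega$ (given by countable maximal antichains deciding initial segments) such that (A) for $\ell<2$ there is an isomorphism of $\mathrm{RO}(\mathbb C)$ onto the complete subalgebra of $\mathrm{RO}(\mathbb Q)$ generated by the values $[\![\eta\vartriangleleft\dot\tau_\ell]\!]$, $\eta\in 2^{<\omega}$, which sends $[\![\eta\vartriangleleft\dot W]\!]$ to $[\![\eta\vartriangleleft\dot\tau_\ell]\!]$ for every $\eta$; and (B) there are Borel functions $g_0,g_1:2^\omega\times\omega\to\mathbb Q$ such that $\{g_\ell(x,n):n<\omega\}$ is predense in $\mathbb Q$ for all $x\in 2^\omega$, $\ell<2$, and whenever $x_0\ne x_1$ in $2^\omega$ agree below $m$ and $k_0,k_1<m$, there are $n<\omega$ and disjoint $A_0,A_1\subseteq 2^n$ such that for $\ell<2$ every $q\in\mathbb Q$ with $q\ge g_\ell(x_0,k_\ell)$ and $q\ge g_\ell(x_1,k_\ell)$ forces $\dot\tau_\ell{\restriction}n\in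 A_\ell$. Theorem. (1) $\mathbb Q^*_{\mathcal F_0}(K,\Sigma)$ is topologically sweet. (2) $\mathbb Q^*_{\mathcal F_1}(K,\Sigma)$ is very explicitly sour over Cohen, and so is $\mathbb Q^*_{\mathcal F_2}(K,\Sigma)$. (Here a condition $(w,t_0,t_1,\dots)$ is coded by $w$ and the sequence $\langle\mathbf{dis}[t_i]:i<\omega\rangle$.) -/

import Mathlib

open Set Filter Topology MeasureTheory

/-! ## Finite sequences, forcing notions

In a forcing notion the stronger condition is the larger one. -/

/-- `⋃ₙ ∏_{i<n} H(i)`, where the natural number `H i` stands for the set `{0, …, H i - 1}`. -/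
def FinSeq (H : ℕ → ℕ) : Type :=
  {η : List ℕ // ∀ (i : ℕ) (hi : i < η.length), η[i] < H i}

namespace FinSeq

/-- The length `lh(η)`. -/
def lh {H : ℕ → ℕ} (η : FinSeq H) : ℕ := η.1.length

/-- The restriction `η ↾ n`. -/
def restr {H : ℕ → ℕ} (η : FinSeq H) (n : ℕ) : FinSeq H :=
  ⟨η.1.take n, fun i hi => by
    have h1 : i < η.1.length := by
      have := List.length_take (i := n) (l := η.1)
      omega
    rw [List.getElem_take]
    exact η.2 i h1⟩

/-- `η ≤ ν` means that `η` is an initial segment of `ν`. -/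
instance {H : ℕ → ℕ} : Preorder (FinSeq H) where
  le η ν := η.1 <+: ν.1
  le_refl η := List.prefix_refl η.1
  le_trans _ _ _ h₁ h₂ := List.IsPrefix.trans h₁ h₂

instance {H : ℕ → ℕ} : OrderBot (FinSeq H) where
  bot := ⟨[], fun i hi => absurd hi (Nat.not_lt_zero i)⟩
  bot_le η := List.nil_prefix (l := η.1)

end FinSeq

/-- Two conditions are compatible if some condition is stronger than both. -/
def Compat {P : Type} [Preorder P] (p q : P) : Prop := ∃ r : P, p ≤ r ∧ q ≤ r

/-- Every condition is compatible with a member of `A`. -/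
def Predense {P : Type} [Preorder P] (A : Set P) : Prop := ∀ p : P, ∃ a ∈ A, Compat p a

/-- The countable chain condition: every antichain is countable. -/
def CCC (P : Type) [Preorder P] : Prop :=
  ∀ A : Set P, (∀ p ∈ A, ∀ q ∈ A, p ≠ q → ¬ Compat p q) → A.Countable

/-- A forcing notion whose conditions are coded by reals (points of the Baire space) is Souslin ccc
if the set of conditions, the order and the incompatibility relation are analytic and the ccc
holds. -/
structure SouslinCCC {P : Type} [Preorder P] (code : P → ℕ → ℕ) : Prop where
  injective : Function.Injective code
  analytic_conditions : AnalyticSet (range code)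
  analytic_le : AnalyticSet {x : (ℕ → ℕ) × (ℕ → ℕ) | ∃ p q : P, p ≤ q ∧ x = (code p, code q)}
  analytic_incompat :
    AnalyticSet {x : (ℕ → ℕ) × (ℕ → ℕ) | ∃ p q : P, ¬ Compat p q ∧ x = (code p, code q)}
  ccc : CCC P

/-! ## The algebra of regular open sets -/

/-- The interior of the closure of `U` for the topology whose open sets are the upward closed
sets of conditions. -/
def regularize {P : Type} [Preorder P] (U : Set P) : Set P :=
  {p | ∀ r, p ≤ r → ∃ s, r ≤ s ∧ s ∈ U}

theorem regularize_idem {P : Type} [Preorder P] (U : Set P) :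
    regularize (regularize U) = regularize U := by
  ext p
  constructor
  · intro h r hr
    obtain ⟨s, hs, hsU⟩ := h r hr
    obtain ⟨t, ht, htU⟩ := hsU s le_rfl
    exact ⟨t, hs.trans ht, htU⟩
  · intro h r hr
    exact ⟨r, le_rfl, fun s hs => h s (hr.trans hs)⟩

/-- `RO(P)`: the complete Boolean algebra of regular open sets, ordered by inclusion. -/
def RO (P : Type) [Preorder P] : Type := {U : Set P // regularize U = U}

instance {P : Type} [Preorder P] : PartialOrder (RO P) :=
  inferInstanceAs (PartialOrder {U : Set P // regularize U = U})

/-- The element of `RO(P)` determined by a set of conditions. -/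
def RO.of {P : Type} [Preorder P] (U : Set P) : RO P := ⟨regularize U, regularize_idem U⟩

/-- Boolean complement in `RO(P)`. -/
def RO.compl {P : Type} [Preorder P] (a : RO P) : RO P := RO.of {p | ∀ r, p ≤ r → r ∉ a.1}

/-- Supremum of a set of elements of `RO(P)`. -/
def RO.sup {P : Type} [Preorder P] (S : Set (RO P)) : RO P := RO.of {p | ∃ a ∈ S, p ∈ a.1}

/-- Membership in the complete subalgebra of `RO(P)` generated by `B`. -/
inductive RO.Generated {P : Type} [Preorder P] (B : Set (RO P)) : RO P → Prop
  | basic (b : RO P) : b ∈ B → RO.Generated B b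
  | compl (b : RO P) : RO.Generated B b → RO.Generated B (RO.compl b)
  | sup (S : Set (RO P)) : (∀ b ∈ S, RO.Generated B b) → RO.Generated B (RO.sup S)

/-! ## Names for reals -/

/-- A standard `Q`-name for an element of `∏ᵢ H(i)`. The condition `q η k` (for `k < N η`) forces
that `η` is an initial segment of the named real. -/
structure StandardName (H : ℕ → ℕ) (Q : Type) [Preorder Q] where
  N : FinSeq H → ℕ∞
  q : FinSeq H → ℕ → Q
  antichain : ∀ (η ν : FinSeq H) (k m : ℕ), η.lh = ν.lh → (k : ℕ∞) < N η → (m : ℕ∞) < N ν →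
    (η, k) ≠ (ν, m) → ¬ Compat (q η k) (q ν m)
  maximal : ∀ (n : ℕ) (p : Q), ∃ (η : FinSeq H) (k : ℕ),
    η.lh = n ∧ (k : ℕ∞) < N η ∧ Compat p (q η k)
  refine_below : ∀ (ν η : FinSeq H), ν < η → ∀ k : ℕ, (k : ℕ∞) < N η →
    ∃ m : ℕ, (m : ℕ∞) < N ν ∧ q ν m ≤ q η k

/-- The Boolean value of "the real named by `τ` has an initial segment in `A`". -/
def StandardName.value {H : ℕ → ℕ} {Q : Type} [Preorder Q] (τ : StandardName H Q)
    (A : Set (FinSeq H)) : RO Q :=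
  RO.of {s | ∃ η ∈ A, ∃ k : ℕ, (k : ℕ∞) < τ.N η ∧ τ.q η k ≤ s}

/-- `p ⊩ τ ↾ n ∈ A`, for a set `A` of sequences of length `n`. -/
def StandardName.Forces {H : ℕ → ℕ} {Q : Type} [Preorder Q] (τ : StandardName H Q)
    (p : Q) (A : Set (FinSeq H)) : Prop :=
  p ∈ (τ.value A).1

/-- The system `W = ⟨p_η⟩` is a name for a new real of `∏ᵢ H(i)` which generates the generic
filter (`p_η` forces that `η` is an initial segment of the real). -/
structure IsGenericRealName (H : ℕ → ℕ) {P : Type} [Preorder P] [OrderBot P]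
    (W : FinSeq H → P) : Prop where
  bot : W ⊥ = ⊥
  mono : ∀ η ν : FinSeq H, η ≤ ν → W η ≤ W ν
  succ_incompat : ∀ η ν ν' : FinSeq H, η ≤ ν → η ≤ ν' → ν.lh = η.lh + 1 → ν'.lh = η.lh + 1 →
    ν ≠ ν' → ¬ Compat (W ν) (W ν')
  succ_maximal : ∀ (η : FinSeq H) (r : P), W η ≤ r →
    ∃ ν : FinSeq H, η ≤ ν ∧ ν.lh = η.lh + 1 ∧ Compat r (W ν)
  splits : ∀ p : P, ∃ η ν : FinSeq H, η.lh = ν.lh ∧ η ≠ ν ∧ Compat p (W η) ∧ Compat p (W ν)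
  separates : ∀ p q : P, ¬ Compat p q → ∃ η : FinSeq H, Compat p (W η) ∧ ¬ Compat q (W η)

/-- There is an isomorphism of `RO(P)` onto the complete subalgebra `RO(Q)_τ` of `RO(Q)`
generated by the Boolean values of `η ◁ τ`, and it maps the name `W` onto `τ`. -/
def MapsOnto {H : ℕ → ℕ} {P Q : Type} [Preorder P] [Preorder Q]
    (W : FinSeq H → P) (τ : StandardName H Q) : Prop :=
  ∃ f : RO P ≃o {b : RO Q // RO.Generated (range fun η : FinSeq H => τ.value {η}) b},
    ∀ η : FinSeq H, (f (RO.of {p | W η ≤ p})).1 = τ.value {η}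

/-! ## Sweetness and sourness -/

/-- `P` carries a model of topological sweetness. -/
def TopologicallySweet (P : Type) [Preorder P] [OrderBot P] : Prop :=
  ∃ _τ : TopologicalSpace P,
    SecondCountableTopology P ∧
    IsOpen ({⊥} : Set P) ∧
    ∀ (p : ℕ → P) (p' q : P) (W : Set P), Tendsto p atTop (𝓝 p') → p' ≤ q → W ∈ 𝓝 q →
      ∃ r ∈ W, q ≤ r ∧ {n : ℕ | p n ≤ r}.Infinite

/-- `(Q₀, τ₀)` is very explicitly sour to `(Q₁, τ₁)`, the names being names for elements of
`∏ᵢ H(i)`. -/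
def VeryExplicitlySourTo {H : ℕ → ℕ} {Q₀ Q₁ : Type} [Preorder Q₀] [Preorder Q₁]
    (code₀ : Q₀ → ℕ → ℕ) (τ₀ : StandardName H Q₀)
    (code₁ : Q₁ → ℕ → ℕ) (τ₁ : StandardName H Q₁) : Prop :=
  ∃ (g₀ : (∀ i, Fin (H i)) × ℕ → Q₀) (g₁ : (∀ i, Fin (H i)) × ℕ → Q₁),
    Measurable (fun z => code₀ (g₀ z)) ∧ Measurable (fun z => code₁ (g₁ z)) ∧
    (∀ x, Predense (range fun n : ℕ => g₀ (x, n))) ∧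
    (∀ x, Predense (range fun n : ℕ => g₁ (x, n))) ∧
    ∀ (x₀ x₁ : ∀ i, Fin (H i)) (m k₀ k₁ : ℕ), x₀ ≠ x₁ → (∀ i < m, x₀ i = x₁ i) →
      k₀ < m → k₁ < m →
      ∃ (n : ℕ) (A₀ A₁ : Set (FinSeq H)),
        (∀ η ∈ A₀, η.lh = n) ∧ (∀ η ∈ A₁, η.lh = n) ∧ Disjoint A₀ A₁ ∧
        (∀ q : Q₀, g₀ (x₀, k₀) ≤ q → g₀ (x₁, k₀) ≤ q → τ₀.Forces q A₀) ∧
        (∀ q : Q₁, g₁ (x₀, k₁) ≤ q → g₁ (x₁, k₁) ≤ q → τ₁.Forces q A₁)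

/-- The forcing notion `Q` is very explicitly sour (to itself) over `(P, W)`; this includes that
`P` and `Q` are Souslin ccc, that `W` is as required and that it corresponds to both names. -/
def VeryExplicitlySourOver (H : ℕ → ℕ) {P Q : Type} [Preorder P] [OrderBot P] [Preorder Q]
    (codeP : P → ℕ → ℕ) (W : FinSeq H → P) (codeQ : Q → ℕ → ℕ) : Prop :=
  (∀ n, 2 ≤ H n) ∧ SouslinCCC codeP ∧ IsGenericRealName H W ∧ SouslinCCC codeQ ∧
  ∃ τ₀ τ₁ : StandardName H Q, MapsOnto W τ₀ ∧ MapsOnto W τ₁ ∧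
    VeryExplicitlySourTo codeQ τ₀ codeQ τ₁

/-- The Cohen forcing `(2^{<ω}, ◁)`. -/
abbrev Cohen : Type := FinSeq fun _ => 2

/-- A code of a Cohen condition in the Baire space. -/
def cohenCode (η : Cohen) : ℕ → ℕ := fun _ => Encodable.encode η.1

/-- `Q` is very explicitly sour over the Cohen forcing with its canonical generic real, whose
name is `⟨η : η ∈ 2^{<ω}⟩`. -/
def VeryExplicitlySourOverCohen {Q : Type} [Preorder Q] (codeQ : Q → ℕ → ℕ) : Prop :=
  VeryExplicitlySourOver (P := Cohen) (fun _ => 2) cohenCode (fun η => η) codeQ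

/-! ## Creatures and the forcing notions `Q*_F(K, Σ)` -/

/-- A creature for `H`, with `dis` taken from the type `D`; `dn` and `up` are the two integers
`m_dn < m_up`, which `val` determines. -/
structure Creature (H : ℕ → ℕ) (D : Type) where
  nor : ℝ
  nor_nonneg : 0 ≤ nor
  dis : D
  dn : ℕ
  up : ℕ
  dn_lt_up : dn < up
  val : Set (FinSeq H × FinSeq H)
  val_nonempty : val.Nonempty
  val_subset : ∀ u v : FinSeq H, (u, v) ∈ val → u.lh = dn ∧ v.lh = up ∧ u < v

/-- The domain of `val[t]`. -/
def Creature.dom {H : ℕ → ℕ} {D : Type} (t : Creature H D) : Set (FinSeq H) :=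
  {u | ∃ v, (u, v) ∈ t.val}

/-- `pos(w, t₀, …, tₙ)`. -/
def pos {H : ℕ → ℕ} {D : Type} (w : FinSeq H) (t : ℕ → Creature H D) (n : ℕ) : Set (FinSeq H) :=
  {v | v.lh = (t n).up ∧ w < v ∧ ∀ i ≤ n, (v.restr (t i).dn, v.restr (t i).up) ∈ (t i).val}

/-- The conditions `(w, t₀, t₁, …)` of `Q*_∅(K, Σ)`. -/
structure PreCondition {H : ℕ → ℕ} {D : Type} (K : Set (Creature H D)) where
  w : FinSeq H
  t : ℕ → Creature H D
  t_mem : ∀ i, t i ∈ K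
  up_eq_dn : ∀ i, (t i).up = (t (i + 1)).dn
  w_mem : w ∈ (t 0).dom
  pos_subset : ∀ i, pos w t i ⊆ (t (i + 1)).dom

/-- `q` is a result of deciding the value for `p`. -/
def DecidesValue {H : ℕ → ℕ} {D : Type} {K : Set (Creature H D)} (p q : PreCondition K) : Prop :=
  ∃ n : ℕ, q.w ∈ pos p.w p.t n ∧ ∀ i, q.t i = p.t (n + 1 + i)

/-- `q` is a result of applying the composition operation `S` to `p`. Only the values of `S` at
finite sets of creatures are used. -/
def AppliesComposition {H : ℕ → ℕ} {D : Type} {K : Set (Creature H D)}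
    (S : Set (Creature H D) → Set (Creature H D)) (p q : PreCondition K) : Prop :=
  q.w = p.w ∧ ∃ n : ℕ → ℕ, n 0 = 0 ∧ StrictMono n ∧
    ∀ i, q.t i ∈ S (p.t '' Set.Ico (n i) (n (i + 1)))

/-- The conditions of `Q*_F(K, Σ)`: those conditions of `Q*_∅(K, Σ)` for which, for some `f ∈ F`,
`nor[tᵢ] ≥ f(m_dn(tᵢ))` for all but finitely many `i`. -/
def Condition {H : ℕ → ℕ} {D : Type} (K : Set (Creature H D))
    (_S : Set (Creature H D) → Set (Creature H D)) (F : Set (ℕ → ℕ)) : Type :=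
  {p : PreCondition K // ∃ f ∈ F, ∀ᶠ i in atTop, (f (p.t i).dn : ℝ) ≤ (p.t i).nor}

/-- `p ≤ q` if `q` is obtained from `p` by finitely many operations; the intermediate results need
not satisfy the norm condition. -/
instance {H : ℕ → ℕ} {D : Type} (K : Set (Creature H D))
    (S : Set (Creature H D) → Set (Creature H D)) (F : Set (ℕ → ℕ)) :
    Preorder (Condition K S F) where
  le p q := Relation.ReflTransGen (fun a b : PreCondition K =>
    DecidesValue a b ∨ AppliesComposition S a b) p.1 q.1
  le_refl _ := Relation.ReflTransGen.refl
  le_trans _ _ _ h₁ h₂ := Relation.ReflTransGen.trans h₁ h₂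

/-- The forcing notion `Q*_F(K, Σ)`. As every forcing notion is understood to have a weakest
element that is equivalent to no other condition, such an element `⊥` is added. -/
abbrev QStar {H : ℕ → ℕ} {D : Type} (K : Set (Creature H D))
    (S : Set (Creature H D) → Set (Creature H D)) (F : Set (ℕ → ℕ)) : Type :=
  WithBot (Condition K S F)

/-- The sequence `(w, dis[t₀], dis[t₁], …)` as a point of the Baire space. It codes the condition
when the creatures `t ∈ K` are determined by `dis[t]`; it is then an identification of
the conditions with points of `(⋃ₙ ∏_{i<n} H(i)) × K^ω`, for the product of discrete topologies. -/
def QStar.code {H : ℕ → ℕ} {D : Type} [Encodable D] {K : Set (Creature H D)}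
    {S : Set (Creature H D) → Set (Creature H D)} {F : Set (ℕ → ℕ)} :
    QStar K S F → ℕ → ℕ
  | none => fun _ => 0
  | some p => fun n => Nat.casesOn n (Encodable.encode p.1.w.1 + 1)
      fun i => Encodable.encode (p.1.t i).dis

/-! ## The creating pair of the eventually different type

As all `H(k)` are finite here, `N_k = |H(k)| = H k`. -/

/-- The creatures `t` with `dis[t] = (k, E)`, where `E ⊆ H(k)` and `0 < |E| < N_k`, such that
`val[t]` consists of all pairs `(u, u⌢⟨a⟩)` with `lh(u) = k` and `a ∉ E`, and `nor[t] = 1`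
if `|E| ≥ N_k / 4`, and `nor[t] = N_k - |E|` otherwise. -/
def edK (H : ℕ → ℕ) : Set (Creature H (ℕ × Finset ℕ)) :=
  {t | t.dis.2 ⊆ Finset.range (H t.dis.1) ∧
    0 < t.dis.2.card ∧ t.dis.2.card < H t.dis.1 ∧
    t.val = {x : FinSeq H × FinSeq H |
      x.1.lh = t.dis.1 ∧ ∃ a : ℕ, a ∉ t.dis.2 ∧ x.2.1 = x.1.1 ++ [a]} ∧
    t.nor = if H t.dis.1 ≤ 4 * t.dis.2.card then (1 : ℝ) else (H t.dis.1 : ℝ) - t.dis.2.card}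

/-- The composition operation: it is non-empty at singletons of members of `K` only, and `s ∈ Σ(t)`
means that `k_s = k_t` and `E_t ⊆ E_s`. -/
def edSigma (H : ℕ → ℕ) (A : Set (Creature H (ℕ × Finset ℕ))) :
    Set (Creature H (ℕ × Finset ℕ)) :=
  {s | s ∈ edK H ∧ ∃ t ∈ edK H, A = {t} ∧ s.dis.1 = t.dis.1 ∧ t.dis.2 ⊆ s.dis.2}

/-- `F₀ = {max(2, H(n) - 2^{kn}) : k < ω}`. -/
def famF0 (H : ℕ → ℕ) : Set (ℕ → ℕ) := range fun k n : ℕ => max 2 (H n - 2 ^ (k * n))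

/-- `F₁ = {max(2, H(n) - 2^k) : k < ω}`. -/
def famF1 (H : ℕ → ℕ) : Set (ℕ → ℕ) := range fun k n : ℕ => max 2 (H n - 2 ^ k)

/-- `F₂ = {max(2, H(n) - k 2^n) : k < ω}`. -/
def famF2 (H : ℕ → ℕ) : Set (ℕ → ℕ) := range fun k n : ℕ => max 2 (H n - k * 2 ^ n)

/-! A condition is a stem `w` together with a slalom: a nonempty proper subset E(i) of H(i), the
forbidden values, for each i ≥ lh(w). A stronger condition lengthens the stem avoiding the slalom
and enlarges the slalom (`Condition.le_iff`). As the functions in F have the form max(2, H - B k),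
the norm condition only says that, for some k, eventually |E(i)| ≤ B k i, with B k i equal to
2^(ki), 2^k or k2^i (`slalomBound_range`). These bounds are far below H(i), so two conditions with
equal stems, bounds and long enough initial parts of slaloms are compatible, which gives the ccc.

Sweetness. For F₀ only the exponential growth rate of |E(i)| matters, and it is insensitive to a
factor i + 2. A basic open set fixes the stem and a finite part of the slalom and demands a growth
rate strictly below a rational α. If p_n → p' ≤ q, a subsequence s_j agrees with p' below N + j, so
at coordinate i only the s_j with N + j ≤ i differ from p'. Adding these to the slalom of q unites
at most i + 2 small sets, and the result bounds all s_j (`exists_sweet_amalgam`).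

Sourness. For F₁ and F₂ slaloms have size at most C·M(i) with one fixed M (1 or 2^i), which leaves
no room for amalgamating infinitely many conditions. Coordinate i is devoted to a level b of 2^{<ω},
and the values below 2^b·M(i) are cut into 2^b blocks of length M(i), one for each node; a value
hits the node of its block. The condition g(x,k) has the k-th stem and forbids at every coordinate
the block of the initial segment of x. The remaining values are used to emit bits, and the n-th bit
may be 1 only if, of any two neighbours of level n + 1, one has been killed: all its extensions at
some level have been hit. If x₀ and x₁ first differ at n, a common extension of g(x₀,k) and g(x₁,k)
never hits either branch from k on, so neither of two neighbours of level n + 1 is killed and the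
n-th bit is 0 (`not_active_of_branchCondition_le`). For the complementary reading it is 1, and this
separates the two names.

The emitted real is nevertheless Cohen. A slalom of size C·M(i) can permanently block at most C
nodes of each level; an ultrafilter limit of these sets of nodes is a tree of width at most C, which
stops branching at some level (`exists_forall_avoided`). From there on one of any two neighbours can
be killed inside the condition, so both bits are available (`exists_readBits_eq`). This freedom
makes U ↦ ⟦the real meets U⟧ an isomorphism of RO(ℂ) onto the generated subalgebra
(`StandardName.Projects.mapsOnto`). -/

/-! ## Finite sequences -/

namespace FinSeq

theorem le_def {H : ℕ → ℕ} {η ν : FinSeq H} : η ≤ ν ↔ η.1 <+: ν.1 := Iff.rfl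

theorem lh_mono {H : ℕ → ℕ} {η ν : FinSeq H} (h : η ≤ ν) : η.lh ≤ ν.lh :=
  List.IsPrefix.length_le h

theorem eq_of_le_of_lh_le {H : ℕ → ℕ} {η ν : FinSeq H} (h : η ≤ ν) (hl : ν.lh ≤ η.lh) : η = ν :=
  Subtype.ext (List.IsPrefix.eq_of_length_le h hl)

theorem lt_iff {H : ℕ → ℕ} {η ν : FinSeq H} : η < ν ↔ η ≤ ν ∧ η.lh < ν.lh := by
  rw [lt_iff_le_not_ge]
  refine and_congr_right fun h => ⟨fun h' => ?_, fun h' h'' => ?_⟩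
  · by_contra hl
    exact h' (eq_of_le_of_lh_le h (not_lt.1 hl)).ge
  · exact absurd (lh_mono h'') (by omega)

theorem le_total_of_le {H : ℕ → ℕ} {η ν ζ : FinSeq H} (h : η ≤ ζ) (h' : ν ≤ ζ)
    (hl : η.lh ≤ ν.lh) : η ≤ ν :=
  List.prefix_of_prefix_length_le h h' hl

theorem getElem?_of_le {H : ℕ → ℕ} {η ν : FinSeq H} (h : η ≤ ν) {i : ℕ} (hi : i < η.lh) :
    ν.1[i]? = η.1[i]? := by
  obtain ⟨t, ht⟩ := h
  rw [← ht, List.getElem?_append_left hi]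

/-- The sequence `η⌢⟨a⟩`. -/
def snoc {H : ℕ → ℕ} (η : FinSeq H) (a : ℕ) (h : a < H η.lh) : FinSeq H :=
  ⟨η.1 ++ [a], fun i hi => by
    by_cases hi' : i < η.1.length
    · rw [List.getElem_append_left hi']
      exact η.2 i hi'
    · have : i = η.1.length := by
        simp only [List.length_append, List.length_singleton] at hi
        omega
      subst this
      simpa [lh] using h⟩

@[simp] theorem snoc_val {H : ℕ → ℕ} (η : FinSeq H) (a : ℕ) (h : a < H η.lh) :
    (η.snoc a h).1 = η.1 ++ [a] := rfl

@[simp] theorem lh_snoc {H : ℕ → ℕ} (η : FinSeq H) (a : ℕ) (h : a < H η.lh) :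
    (η.snoc a h).lh = η.lh + 1 := by simp [lh]

theorem le_snoc {H : ℕ → ℕ} (η : FinSeq H) (a : ℕ) (h : a < H η.lh) : η ≤ η.snoc a h :=
  List.prefix_append _ _

theorem lh_restr {H : ℕ → ℕ} (η : FinSeq H) (n : ℕ) : (η.restr n).lh = min n η.lh :=
  List.length_take

theorem restr_le {H : ℕ → ℕ} (η : FinSeq H) (n : ℕ) : η.restr n ≤ η := List.take_prefix _ _

/-- The constant sequence of zeros. -/
def zeros {H : ℕ → ℕ} (hH : ∀ i, 0 < H i) (n : ℕ) : FinSeq H :=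
  ⟨List.replicate n 0, fun i hi => by simpa using hH i⟩

@[simp] theorem lh_zeros {H : ℕ → ℕ} (hH : ∀ i, 0 < H i) (n : ℕ) :
    (zeros hH n).lh = n := List.length_replicate

instance {H : ℕ → ℕ} : Countable (FinSeq H) :=
  inferInstanceAs (Countable {_η : List ℕ // _})

/-- From position `n` on, the sequence avoids the sets `E i`. -/
def Avoids {H : ℕ → ℕ} (E : ℕ → Finset ℕ) (n : ℕ) (η : FinSeq H) : Prop :=
  ∀ i a : ℕ, n ≤ i → η.1[i]? = some a → a ∉ E i

theorem avoids_of_lh_le {H : ℕ → ℕ} {E : ℕ → Finset ℕ} {n : ℕ} {η : FinSeq H} (h : η.lh ≤ n) :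
    η.Avoids E n := by
  intro i a hi ha
  have := (List.getElem?_eq_some_iff.1 ha).1
  simp only [lh] at h
  omega

theorem Avoids.snoc {H : ℕ → ℕ} {E : ℕ → Finset ℕ} {n : ℕ} {η : FinSeq H} (h : η.Avoids E n)
    {a : ℕ} (ha : a < H η.lh) (hE : a ∉ E η.lh) : (η.snoc a ha).Avoids E n := by
  intro i c hi hc
  rw [snoc_val, List.getElem?_append] at hc
  split_ifs at hc with h1
  · exact h i c hi hc
  · obtain ⟨h2, h3⟩ := List.getElem?_eq_some_iff.1 hc
    simp only [List.length_singleton] at h2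
    have : i = η.lh := by simp only [lh]; omega
    subst this
    simp only [lh] at h3 hE ⊢
    simp at h3
    rwa [← h3]

theorem Avoids.mono {H : ℕ → ℕ} {E : ℕ → Finset ℕ} {n m : ℕ} {η : FinSeq H} (h : η.Avoids E n)
    (hnm : n ≤ m) : η.Avoids E m := fun i a hi => h i a (hnm.trans hi)

theorem Avoids.trans {H : ℕ → ℕ} {E : ℕ → Finset ℕ} {n : ℕ} {η ν : FinSeq H}
    (h : η.Avoids E n) (hle : η ≤ ν) (h' : ν.Avoids E η.lh) : ν.Avoids E n := by
  intro i a hi ha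
  by_cases hil : i < η.lh
  · rw [getElem?_of_le hle hil] at ha
    exact h i a hi ha
  · exact h' i a (not_lt.1 hil) ha

theorem Avoids.of_le {H : ℕ → ℕ} {E : ℕ → Finset ℕ} {n : ℕ} {η ν : FinSeq H}
    (h : ν.Avoids E n) (hle : η ≤ ν) : η.Avoids E n := by
  intro i a hi ha
  refine h i a hi ?_
  rw [getElem?_of_le hle (List.getElem?_eq_some_iff.1 ha).1, ha]

theorem Avoids.anti {H : ℕ → ℕ} {E F : ℕ → Finset ℕ} {n : ℕ} {η : FinSeq H}
    (h : η.Avoids F n) (hEF : ∀ i, n ≤ i → E i ⊆ F i) : η.Avoids E n :=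
  fun i a hi ha hE => h i a hi ha (hEF i hi hE)

end FinSeq

/-! ## The creatures of the eventually different type -/

section creatures

variable {H : ℕ → ℕ}

theorem edK_dn {t : Creature H (ℕ × Finset ℕ)} (ht : t ∈ edK H) : t.dn = t.dis.1 := by
  obtain ⟨⟨u, v⟩, huv⟩ := t.val_nonempty
  have h1 := t.val_subset u v huv
  rw [ht.2.2.2.1] at huv
  rw [← h1.1]
  exact huv.1

theorem edK_up {t : Creature H (ℕ × Finset ℕ)} (ht : t ∈ edK H) : t.up = t.dis.1 + 1 := by
  obtain ⟨⟨u, v⟩, huv⟩ := t.val_nonempty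
  have h1 := t.val_subset u v huv
  rw [ht.2.2.2.1] at huv
  obtain ⟨h2, a, -, h3⟩ := huv
  rw [← h1.2.1, ← h2]
  simp only [FinSeq.lh] at h3 ⊢
  rw [h3]
  simp

/-- A nonempty `val` pins down `dn` and `up`, so nothing beyond `dis` is left free; coding
conditions by the sequence of `dis` rests on this. -/
theorem edK_ext {s t : Creature H (ℕ × Finset ℕ)} (hs : s ∈ edK H) (ht : t ∈ edK H)
    (h : s.dis = t.dis) : s = t := by
  have h1 : s.dn = t.dn := by rw [edK_dn hs, edK_dn ht, h]
  have h2 : s.up = t.up := by rw [edK_up hs, edK_up ht, h]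
  have h3 : s.val = t.val := by rw [hs.2.2.2.1, ht.2.2.2.1, h]
  have h4 : s.nor = t.nor := by rw [hs.2.2.2.2, ht.2.2.2.2, h]
  cases s
  cases t
  simp_all

/-- `E` is a nonempty proper subset of `H k`. -/
def Proper (H : ℕ → ℕ) (k : ℕ) (E : Finset ℕ) : Prop :=
  E ⊆ Finset.range (H k) ∧ 0 < E.card ∧ E.card < H k

theorem Proper.exists_notMem {k : ℕ} {E : Finset ℕ} (h : Proper H k E) : ∃ a < H k, a ∉ E := by
  by_contra! hc
  have : Finset.range (H k) ⊆ E := fun a ha => hc a (Finset.mem_range.1 ha)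
  have := Finset.card_le_card this
  rw [Finset.card_range] at this
  exact absurd h.2.2 (by omega)

open scoped Classical in
/-- The creature with `dis = (k, E)`. -/
noncomputable def edCreature (hH : ∀ i, 0 < H i) (k : ℕ) (E : Finset ℕ) (h : Proper H k E) :
    Creature H (ℕ × Finset ℕ) where
  nor := if H k ≤ 4 * E.card then (1 : ℝ) else (H k : ℝ) - E.card
  nor_nonneg := by
    split_ifs
    · exact zero_le_one
    · exact sub_nonneg.2 (by exact_mod_cast h.2.2.le)
  dis := (k, E)
  dn := k
  up := k + 1
  dn_lt_up := Nat.lt_succ_self k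
  val := {x : FinSeq H × FinSeq H | x.1.lh = k ∧ ∃ a : ℕ, a ∉ E ∧ x.2.1 = x.1.1 ++ [a]}
  val_nonempty := by
    obtain ⟨a, ha, haE⟩ := h.exists_notMem
    exact ⟨(FinSeq.zeros hH k, (FinSeq.zeros hH k).snoc a (by simpa using ha)), by simp, a, haE, rfl⟩
  val_subset := by
    rintro u v ⟨h1, a, -, h2⟩
    have h3 : v.lh = k + 1 := by
      simp only [FinSeq.lh] at h1 h2 ⊢
      rw [h2]
      simp [h1]
    exact ⟨h1, h3, FinSeq.lt_iff.2 ⟨⟨[a], h2.symm⟩, by simp only at h1; omega⟩⟩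

theorem edCreature_mem (hH : ∀ i, 0 < H i) (k : ℕ) (E : Finset ℕ) (h : Proper H k E) :
    edCreature hH k E h ∈ edK H :=
  ⟨h.1, h.2.1, h.2.2, rfl, rfl⟩

theorem proper_of_mem {t : Creature H (ℕ × Finset ℕ)} (ht : t ∈ edK H) :
    Proper H t.dis.1 t.dis.2 := ⟨ht.1, ht.2.1, ht.2.2.1⟩

theorem mem_dom_iff {t : Creature H (ℕ × Finset ℕ)} (ht : t ∈ edK H) {u : FinSeq H} :
    u ∈ t.dom ↔ u.lh = t.dis.1 := by
  refine ⟨?_, fun h => ?_⟩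
  · rintro ⟨v, hv⟩
    rw [ht.2.2.2.1] at hv
    exact hv.1
  · obtain ⟨a, ha, haE⟩ := (proper_of_mem ht).exists_notMem
    refine ⟨u.snoc a (by rwa [h]), ?_⟩
    rw [ht.2.2.2.1]
    exact ⟨h, a, haE, rfl⟩

end creatures

/-! ## Conditions as stems with slaloms -/

section conditions

variable {H : ℕ → ℕ}

/-- The set `E_t` for the creature `t` of the condition at level `i`. -/
def PreCondition.slalom (p : PreCondition (edK H)) (i : ℕ) : Finset ℕ :=
  (p.t (i - p.w.lh)).dis.2

theorem PreCondition.dis_fst (p : PreCondition (edK H)) (i : ℕ) :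
    (p.t i).dis.1 = p.w.lh + i := by
  induction i with
  | zero => exact ((mem_dom_iff (p.t_mem 0)).1 p.w_mem).symm
  | succ i ih =>
    have := p.up_eq_dn i
    rw [edK_up (p.t_mem i), edK_dn (p.t_mem (i + 1)), ih] at this
    omega

theorem PreCondition.dis_eq (p : PreCondition (edK H)) (i : ℕ) :
    (p.t i).dis = (p.w.lh + i, p.slalom (p.w.lh + i)) := by
  refine Prod.ext (p.dis_fst i) ?_
  simp [PreCondition.slalom]

theorem PreCondition.proper (p : PreCondition (edK H)) {i : ℕ} (hi : p.w.lh ≤ i) :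
    Proper H i (p.slalom i) := by
  have := proper_of_mem (p.t_mem (i - p.w.lh))
  rwa [p.dis_fst, Nat.add_sub_cancel' hi] at this

/-- The condition with stem `w` and slalom `E`. -/
noncomputable def PreCondition.mk' (hH : ∀ i, 0 < H i) (w : FinSeq H) (E : ℕ → Finset ℕ)
    (h : ∀ i, w.lh ≤ i → Proper H i (E i)) : PreCondition (edK H) where
  w := w
  t i := edCreature hH (w.lh + i) (E (w.lh + i)) (h _ (Nat.le_add_right _ _))
  t_mem _ := edCreature_mem ..
  up_eq_dn _ := rfl
  w_mem := (mem_dom_iff (edCreature_mem ..)).2 rfl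
  pos_subset _ _ hv := (mem_dom_iff (edCreature_mem ..)).2 hv.1

theorem PreCondition.mk'_slalom (hH : ∀ i, 0 < H i) (w : FinSeq H) (E : ℕ → Finset ℕ)
    (h : ∀ i, w.lh ≤ i → Proper H i (E i)) {i : ℕ} (hi : w.lh ≤ i) :
    (PreCondition.mk' hH w E h).slalom i = E i := by
  change E (w.lh + (i - w.lh)) = E i
  rw [Nat.add_sub_cancel' hi]

theorem PreCondition.ext' {p q : PreCondition (edK H)} (hw : p.w = q.w)
    (h : ∀ i, p.w.lh ≤ i → p.slalom i = q.slalom i) : p = q := by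
  have ht : p.t = q.t := by
    funext i
    refine edK_ext (p.t_mem i) (q.t_mem i) ?_
    rw [p.dis_eq, q.dis_eq, h _ (Nat.le_add_right _ _), hw]
  cases p
  cases q
  simp only at hw ht
  subst hw ht
  rfl

theorem PreCondition.mem_pos_iff (p : PreCondition (edK H)) {n : ℕ} {v : FinSeq H} :
    v ∈ pos p.w p.t n ↔ p.w ≤ v ∧ v.lh = p.w.lh + n + 1 ∧ v.Avoids p.slalom p.w.lh := by
  constructor
  · rintro ⟨h1, h2, h3⟩
    rw [edK_up (p.t_mem n), p.dis_fst] at h1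
    refine ⟨h2.le, h1, fun i a hi ha => ?_⟩
    have hil := (List.getElem?_eq_some_iff.1 ha).1
    have := h3 (i - p.w.lh) (by simp only [FinSeq.lh] at h1 ⊢; omega)
    rw [(p.t_mem _).2.2.2.1, edK_up (p.t_mem _), edK_dn (p.t_mem _), p.dis_fst,
      Nat.add_sub_cancel' hi] at this
    obtain ⟨-, b, hb, hb'⟩ := this
    simp only [FinSeq.restr] at hb'
    rw [List.take_add_one, ha] at hb'
    have := List.append_cancel_left hb'
    simp only [Option.toList_some, List.cons.injEq, and_true] at this
    subst this
    exact hb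
  · rintro ⟨h1, h2, h3⟩
    refine ⟨?_, FinSeq.lt_iff.2 ⟨h1, by omega⟩, fun i hi => ?_⟩
    · rw [edK_up (p.t_mem n), p.dis_fst, h2]
    · rw [(p.t_mem _).2.2.2.1, edK_up (p.t_mem _), edK_dn (p.t_mem _), p.dis_fst]
      have hil : p.w.lh + i < v.1.length := by
        simp only [FinSeq.lh] at h2 ⊢
        omega
      refine ⟨?_, v.1[p.w.lh + i], ?_, ?_⟩
      · rw [FinSeq.lh_restr, h2]
        omega
      · have := h3 (p.w.lh + i) _ (Nat.le_add_right _ _) (List.getElem?_eq_getElem hil)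
        simpa [PreCondition.slalom] using this
      · simp only [FinSeq.restr]
        rw [List.take_add_one, List.getElem?_eq_getElem hil]
        rfl

/-- The order of conditions in terms of stems and slaloms. -/
def PreCondition.Below (p q : PreCondition (edK H)) : Prop :=
  p.w ≤ q.w ∧ q.w.Avoids p.slalom p.w.lh ∧ ∀ i, q.w.lh ≤ i → p.slalom i ⊆ q.slalom i

theorem PreCondition.Below.trans {p q r : PreCondition (edK H)} (h : p.Below q)
    (h' : q.Below r) : p.Below r :=
  ⟨h.1.trans h'.1, h.2.1.trans h'.1 (h'.2.1.anti fun i hi => h.2.2 i hi),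
    fun i hi => (h.2.2 i ((FinSeq.lh_mono h'.1).trans hi)).trans (h'.2.2 i hi)⟩

theorem PreCondition.Below.refl (p : PreCondition (edK H)) : p.Below p :=
  ⟨le_rfl, FinSeq.avoids_of_lh_le le_rfl, fun _ _ => subset_rfl⟩

theorem DecidesValue.below {p q : PreCondition (edK H)} (h : DecidesValue p q) : p.Below q := by
  obtain ⟨n, h1, h2⟩ := h
  obtain ⟨h3, h4, h5⟩ := p.mem_pos_iff.1 h1
  refine ⟨h3, h5, fun i hi => ?_⟩
  simp only [PreCondition.slalom]
  rw [h2, show n + 1 + (i - q.w.lh) = i - p.w.lh by omega]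

/-- Creatures at different coordinates are distinct and Σ is empty off singletons, so each block of
the composition is a single creature and the cutting points are forced to be n(i) = i. -/
theorem AppliesComposition.below {p q : PreCondition (edK H)}
    (h : AppliesComposition (edSigma H) p q) : p.Below q := by
  obtain ⟨h1, n, hn0, hn, h2⟩ := h
  have hinj : ∀ i j, p.t i = p.t j → i = j := by
    intro i j hij
    have := congrArg (fun t => t.dis.1) hij
    simp only [p.dis_fst] at this
    omega
  have hstep : ∀ i, n (i + 1) = n i + 1 := by
    intro i
    obtain ⟨-, t, -, ht, -⟩ := h2 i
    have hlt := hn (Nat.lt_succ_self i)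
    by_contra hne
    have m1 : p.t (n i) ∈ p.t '' Set.Ico (n i) (n (i + 1)) := ⟨n i, ⟨le_rfl, hlt⟩, rfl⟩
    have m2 : p.t (n i + 1) ∈ p.t '' Set.Ico (n i) (n (i + 1)) :=
      ⟨n i + 1, ⟨Nat.le_succ _, by simp only [Nat.succ_eq_add_one] at hlt; omega⟩, rfl⟩
    rw [ht] at m1 m2
    have := hinj _ _ (m1.trans m2.symm)
    omega
  have hid : ∀ i, n i = i := by
    intro i
    induction i with
    | zero => exact hn0
    | succ i ih => rw [hstep, ih]
  refine ⟨h1.ge, FinSeq.avoids_of_lh_le (by rw [h1]), fun i hi => ?_⟩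
  obtain ⟨-, t, -, ht, -, hsub⟩ := h2 (i - q.w.lh)
  have m1 : p.t (i - q.w.lh) ∈ p.t '' Set.Ico (n (i - q.w.lh)) (n (i - q.w.lh + 1)) :=
    ⟨_, ⟨(hid _).le, by rw [hid]; omega⟩, rfl⟩
  rw [ht] at m1
  rw [← mem_singleton_iff.1 m1] at hsub
  simp only [PreCondition.slalom]
  rwa [h1] at hsub ⊢

/-- At most two operations suffice: move to the stem of `q` while keeping the slalom of `p`, then
enlarge the slalom. Deciding the value always lengthens the stem, so it is left out when the stems
agree. -/
theorem PreCondition.Below.reflTransGen (hH : ∀ i, 0 < H i) {p q : PreCondition (edK H)}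
    (h : p.Below q) : Relation.ReflTransGen (fun a b : PreCondition (edK H) =>
      DecidesValue a b ∨ AppliesComposition (edSigma H) a b) p q := by
  have key : ∀ p : PreCondition (edK H), p.w = q.w → p.Below q →
      AppliesComposition (edSigma H) p q := by
    intro p hw h
    refine ⟨hw.symm, id, rfl, strictMono_id, fun i => ?_⟩
    have : p.t '' Set.Ico (id i) (id (i + 1)) = {p.t i} := by
      have : Set.Ico i (i + 1) = {i} := by ext; simp; omega
      simp [this]
    rw [this]
    refine ⟨q.t_mem i, p.t i, p.t_mem i, rfl, ?_, ?_⟩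
    · rw [q.dis_fst, p.dis_fst, hw]
    · rw [q.dis_eq, p.dis_eq, hw]
      exact h.2.2 _ (Nat.le_add_right _ _)
  rcases (FinSeq.lh_mono h.1).eq_or_lt with he | hlt
  · have hw : p.w = q.w := Subtype.ext (List.IsPrefix.eq_of_length h.1 he)
    exact Relation.ReflTransGen.single (Or.inr (key p hw h))
  · let r : PreCondition (edK H) := PreCondition.mk' hH q.w p.slalom
      fun i hi => p.proper (hlt.le.trans hi)
    have hr : ∀ i, q.w.lh ≤ i → r.slalom i = p.slalom i := fun i hi =>
      PreCondition.mk'_slalom _ _ _ _ hi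
    refine Relation.ReflTransGen.head (b := r) (Or.inl ?_)
      (Relation.ReflTransGen.single (Or.inr (key r rfl ?_)))
    -- `pos w t n` uses the n + 1 creatures t₀, …, tₙ, whence the `- 1`.
    · refine ⟨q.w.lh - p.w.lh - 1, p.mem_pos_iff.2 ⟨h.1, ?_, h.2.1⟩, fun i => ?_⟩
      · change q.w.lh = _
        omega
      · refine edK_ext (r.t_mem _) (p.t_mem _) ?_
        have e : p.w.lh + (q.w.lh - p.w.lh - 1 + 1 + i) = q.w.lh + i := by omega
        rw [r.dis_eq, p.dis_eq, e]
        change (q.w.lh + i, r.slalom (q.w.lh + i)) = _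
        rw [hr _ (Nat.le_add_right _ _)]
    · refine ⟨le_rfl, FinSeq.avoids_of_lh_le le_rfl, fun i hi => ?_⟩
      rw [hr i hi]
      exact h.2.2 i hi

theorem Condition.le_iff (hH : ∀ i, 0 < H i) {F : Set (ℕ → ℕ)}
    {p q : Condition (edK H) (edSigma H) F} : p ≤ q ↔ p.1.Below q.1 := by
  refine ⟨fun h => ?_, fun h => h.reflTransGen hH⟩
  have h' : Relation.ReflTransGen (fun a b : PreCondition (edK H) =>
      DecidesValue a b ∨ AppliesComposition (edSigma H) a b) p.1 q.1 := h
  clear h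
  generalize q.1 = q' at h'
  induction h' with
  | refl => exact PreCondition.Below.refl _
  | tail _ hbc ih => exact ih.trans (hbc.elim DecidesValue.below AppliesComposition.below)

end conditions

/-! ## The norm condition as a bound on the slaloms -/

section conditions

variable {H : ℕ → ℕ} {F : Set (ℕ → ℕ)} {B : ℕ → ℕ → ℕ}

/-- The norm condition given by `F` says that for some `k` the `i`-th set of the slalom eventually
has at most `B k i` elements. -/
structure SlalomBound (H : ℕ → ℕ) (F : Set (ℕ → ℕ)) (B : ℕ → ℕ → ℕ) : Prop where
  pos : ∀ i, 0 < H i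
  norm_iff : ∀ p : PreCondition (edK H),
    (∃ f ∈ F, ∀ᶠ i in atTop, (f (p.t i).dn : ℝ) ≤ (p.t i).nor) ↔
      ∃ k, ∀ᶠ i in atTop, (p.slalom i).card ≤ B k i
  small : ∀ k, ∀ᶠ i in atTop, 4 * B k i < H i
  add : ∀ k l, ∃ m, ∀ᶠ i in atTop, B k i + B l i ≤ B m i

theorem eventually_add_left_iff {P : ℕ → Prop} (n : ℕ) :
    (∀ᶠ i in atTop, P (n + i)) ↔ ∀ᶠ i in atTop, P i := by
  have : (∀ᶠ i in map (fun i => i + n) atTop, P i) ↔ ∀ᶠ i in atTop, P i := by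
    rw [map_add_atTop_eq_nat]
  rw [← this, eventually_map]
  simp only [add_comm]

/-- The maximum with 2 excludes creatures of norm 1; these have 4|E(i)| ≥ H(i), so by `small` they
violate the bound as well. Otherwise the norm is H(i) - |E(i)|, which exceeds 2 because E(i) is
nonempty and 4|E(i)| < H(i), and only the comparison of |E(i)| with `B k i` remains. -/
theorem slalomBound_range (pos : ∀ i, 0 < H i) (small : ∀ k, ∀ᶠ i in atTop, 4 * B k i < H i)
    (add : ∀ k l, ∃ m, ∀ᶠ i in atTop, B k i + B l i ≤ B m i) :
    SlalomBound H (range fun k n : ℕ => max 2 (H n - B k n)) B := by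
  refine ⟨pos, fun p => ?_, small, add⟩
  simp only [exists_range_iff]
  refine exists_congr fun k => ?_
  rw [← eventually_add_left_iff (P := fun i => (p.slalom i).card ≤ B k i) p.w.lh]
  refine eventually_congr ?_
  filter_upwards [(eventually_add_left_iff p.w.lh).2 (small k)] with i hi
  have ht := p.t_mem i
  have hp := p.proper (Nat.le_add_right p.w.lh i)
  rw [edK_dn ht, ht.2.2.2.2, p.dis_eq]
  simp only
  generalize p.w.lh + i = n at *
  have h1 := hp.2.1
  have h2 := hp.2.2
  generalize (p.slalom n).card = e at *
  split_ifs with h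
  · refine iff_of_false ?_ (by omega)
    rw [not_le]
    have : 2 ≤ max 2 (H n - B k n) := le_max_left _ _
    exact_mod_cast this
  · rw [← Nat.cast_sub h2.le, Nat.cast_le]
    omega

/-- The condition with stem `w` and slalom `E`. -/
noncomputable def Condition.mk' (hb : SlalomBound H F B) (w : FinSeq H) (E : ℕ → Finset ℕ)
    (h : ∀ i, w.lh ≤ i → Proper H i (E i)) (hE : ∃ k, ∀ᶠ i in atTop, (E i).card ≤ B k i) :
    Condition (edK H) (edSigma H) F :=
  ⟨PreCondition.mk' hb.pos w E h, (hb.norm_iff _).2 (by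
    obtain ⟨k, hk⟩ := hE
    refine ⟨k, ?_⟩
    filter_upwards [hk, eventually_ge_atTop w.lh] with i hi hi'
    rwa [PreCondition.mk'_slalom _ _ _ _ hi'])⟩

theorem Condition.mk'_slalom (hb : SlalomBound H F B) (w : FinSeq H) (E : ℕ → Finset ℕ)
    (h : ∀ i, w.lh ≤ i → Proper H i (E i)) (hE : ∃ k, ∀ᶠ i in atTop, (E i).card ≤ B k i)
    {i : ℕ} (hi : w.lh ≤ i) : (Condition.mk' hb w E h hE).1.slalom i = E i :=
  PreCondition.mk'_slalom hb.pos w E h hi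

theorem Condition.exists_bound (hb : SlalomBound H F B) (p : Condition (edK H) (edSigma H) F) :
    ∃ k, ∀ᶠ i in atTop, (p.1.slalom i).card ≤ B k i := (hb.norm_iff p.1).1 p.2

theorem exists_lt_notMem {n : ℕ} {E : Finset ℕ} (h : E.card < n) : ∃ a < n, a ∉ E := by
  obtain ⟨a, ha, haE⟩ := Finset.exists_mem_notMem_of_card_lt_card
    (s := E) (t := Finset.range n) (by rwa [Finset.card_range])
  exact ⟨a, Finset.mem_range.1 ha, haE⟩

theorem FinSeq.exists_le_avoids {E : ℕ → Finset ℕ} (v : FinSeq H)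
    (h : ∀ i, v.lh ≤ i → ∃ a < H i, a ∉ E i) (n : ℕ) :
    ∃ w : FinSeq H, v ≤ w ∧ n ≤ w.lh ∧ w.Avoids E v.lh := by
  induction n with
  | zero => exact ⟨v, le_rfl, Nat.zero_le _, avoids_of_lh_le le_rfl⟩
  | succ n ih =>
    obtain ⟨w, h1, h2, h3⟩ := ih
    obtain ⟨a, ha, haE⟩ := h w.lh (lh_mono h1)
    exact ⟨w.snoc a ha, h1.trans (le_snoc _ _ _), by simpa using h2, h3.snoc ha haE⟩

/-! ### Common extensions and the countable chain condition -/

theorem PreCondition.exists_notMem (p : PreCondition (edK H)) {i : ℕ} (hi : p.w.lh ≤ i) :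
    ∃ a < H i, a ∉ p.slalom i := (p.proper hi).exists_notMem

/-- The stem of `q` is a stem for a common extension of `p` and `q`. -/
def PreCondition.Joins (p q : PreCondition (edK H)) : Prop :=
  p.w ≤ q.w ∧ q.w.Avoids p.slalom p.w.lh ∧
    ∀ i, q.w.lh ≤ i → ∃ a < H i, a ∉ p.slalom i ∧ a ∉ q.slalom i

theorem PreCondition.Joins.exists_union (hb : SlalomBound H F B)
    {p q : Condition (edK H) (edSigma H) F} (h : p.1.Joins q.1) :
    ∃ r, p ≤ r ∧ q ≤ r ∧ r.1.w = q.1.w ∧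
      ∀ i, q.1.w.lh ≤ i → r.1.slalom i = p.1.slalom i ∪ q.1.slalom i := by
  have hp : ∀ i, q.1.w.lh ≤ i → Proper H i (p.1.slalom i ∪ q.1.slalom i) := by
    intro i hi
    have h1 := p.1.proper ((FinSeq.lh_mono h.1).trans hi)
    have h2 := q.1.proper hi
    have h3 : p.1.slalom i ∪ q.1.slalom i ⊆ Finset.range (H i) := Finset.union_subset h1.1 h2.1
    refine ⟨h3, h1.2.1.trans_le (Finset.card_le_card Finset.subset_union_left), ?_⟩
    obtain ⟨a, ha, ha1, ha2⟩ := h.2.2 i hi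
    have := Finset.card_lt_card (s := p.1.slalom i ∪ q.1.slalom i) (t := Finset.range (H i))
      ⟨h3, fun hc => by
        have := hc (Finset.mem_range.2 ha)
        simp [ha1, ha2] at this⟩
    rwa [Finset.card_range] at this
  obtain ⟨k, hk⟩ := p.exists_bound hb
  obtain ⟨l, hl⟩ := q.exists_bound hb
  obtain ⟨m, hm⟩ := hb.add k l
  let r := Condition.mk' hb q.1.w (fun i => p.1.slalom i ∪ q.1.slalom i) hp ⟨m, by
    filter_upwards [hk, hl, hm] with i h1 h2 h3
    exact (Finset.card_union_le _ _).trans (by omega)⟩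
  have hr : ∀ i, q.1.w.lh ≤ i → r.1.slalom i = p.1.slalom i ∪ q.1.slalom i :=
    fun i hi => Condition.mk'_slalom _ _ _ _ _ hi
  refine ⟨r, (Condition.le_iff hb.pos).2 ⟨h.1, h.2.1, fun i hi => ?_⟩,
    (Condition.le_iff hb.pos).2 ⟨le_rfl, FinSeq.avoids_of_lh_le le_rfl, fun i hi => ?_⟩, rfl, hr⟩
  · rw [hr i hi]
    exact Finset.subset_union_left
  · rw [hr i hi]
    exact Finset.subset_union_right

/-- The common extension supplies the value avoiding both slaloms: the entry of its stem where there
is one, and beyond the stem any value outside its own slalom. -/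
theorem PreCondition.joins_of_below {p q r : PreCondition (edK H)} (h1 : p.Below r)
    (h2 : q.Below r) (hl : p.w.lh ≤ q.w.lh) : p.Joins q := by
  refine ⟨FinSeq.le_total_of_le h1.1 h2.1 hl, h1.2.1.of_le h2.1, fun i hi => ?_⟩
  by_cases hir : i < r.w.lh
  · refine ⟨r.w.1[i], r.w.2 i hir, ?_, ?_⟩
    · exact h1.2.1 i _ (hl.trans hi) (List.getElem?_eq_getElem hir)
    · exact h2.2.1 i _ hi (List.getElem?_eq_getElem hir)
  · obtain ⟨a, ha, haE⟩ := r.exists_notMem (not_lt.1 hir)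
    exact ⟨a, ha, fun hc => haE (h1.2.2 i (not_lt.1 hir) hc),
      fun hc => haE (h2.2.2 i (not_lt.1 hir) hc)⟩

theorem Compat.symm {P : Type} [Preorder P] {p q : P} (h : Compat p q) : Compat q p := by
  obtain ⟨r, h1, h2⟩ := h
  exact ⟨r, h2, h1⟩

theorem Condition.compat_iff (hb : SlalomBound H F B) {p q : Condition (edK H) (edSigma H) F} :
    Compat p q ↔ p.1.Joins q.1 ∨ q.1.Joins p.1 := by
  constructor
  · rintro ⟨r, h1, h2⟩
    rw [Condition.le_iff hb.pos] at h1 h2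
    rcases le_total p.1.w.lh q.1.w.lh with h | h
    · exact Or.inl (PreCondition.joins_of_below h1 h2 h)
    · exact Or.inr (PreCondition.joins_of_below h2 h1 h)
  · rintro (h | h)
    · obtain ⟨r, h1, h2, -⟩ := h.exists_union hb
      exact ⟨r, h1, h2⟩
    · obtain ⟨r, h1, h2, -⟩ := h.exists_union hb
      exact ⟨r, h2, h1⟩

/-- A condition can be strengthened to have any stem avoiding its slalom. -/
theorem Condition.exists_extend (hb : SlalomBound H F B) (p : Condition (edK H) (edSigma H) F)
    {v : FinSeq H} (hv : p.1.w ≤ v) (hv' : v.Avoids p.1.slalom p.1.w.lh) :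
    ∃ q, p ≤ q ∧ q.1.w = v ∧ ∀ i, v.lh ≤ i → q.1.slalom i = p.1.slalom i := by
  let q := Condition.mk' hb v p.1.slalom
    (fun i hi => p.1.proper ((FinSeq.lh_mono hv).trans hi)) (p.exists_bound hb)
  have hq : ∀ i, v.lh ≤ i → q.1.slalom i = p.1.slalom i :=
    fun i hi => Condition.mk'_slalom _ _ _ _ _ hi
  exact ⟨q, (Condition.le_iff hb.pos).2 ⟨hv, hv', fun i hi => (hq i hi).ge⟩, rfl, hq⟩

theorem QStar.compat_bot (p : QStar (edK H) (edSigma H) F) : Compat p ⊥ := ⟨p, le_rfl, bot_le⟩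

theorem QStar.compat_coe {p q : Condition (edK H) (edSigma H) F} :
    Compat (p : QStar (edK H) (edSigma H) F) q ↔ Compat p q := by
  constructor
  · rintro ⟨r, h1, h2⟩
    induction r using WithBot.recBotCoe with
    | bot => exact absurd h1 (WithBot.not_coe_le_bot p)
    | coe r => exact ⟨r, WithBot.coe_le_coe.1 h1, WithBot.coe_le_coe.1 h2⟩
  · rintro ⟨r, h1, h2⟩
    exact ⟨r, WithBot.coe_le_coe.2 h1, WithBot.coe_le_coe.2 h2⟩

/-- The finite information about a condition that suffices for compatibility. -/
def PreCondition.Info (B : ℕ → ℕ → ℕ) (p : PreCondition (edK H))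
    (d : FinSeq H × ℕ × ℕ × List (Finset ℕ)) : Prop :=
  d.1 = p.w ∧ d.2.2.2 = (List.range d.2.2.1).map p.slalom ∧
    ∀ i, d.2.2.1 ≤ i → (p.slalom i).card ≤ B d.2.1 i ∧ 4 * B d.2.1 i < H i

theorem Condition.exists_info (hb : SlalomBound H F B) (p : Condition (edK H) (edSigma H) F) :
    ∃ d, p.1.Info B d := by
  obtain ⟨k, hk⟩ := p.exists_bound hb
  obtain ⟨N, hN⟩ := eventually_atTop.1 (hk.and (hb.small k))
  exact ⟨(p.1.w, k, N, (List.range N).map p.1.slalom), rfl, rfl, hN⟩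

/-- Below the recorded length the slaloms coincide; from there on both sets have fewer than H(i)/4
elements, so their union is not everything. -/
theorem PreCondition.Info.joins {p q : PreCondition (edK H)}
    {d : FinSeq H × ℕ × ℕ × List (Finset ℕ)} (hp : p.Info B d) (hq : q.Info B d) : p.Joins q := by
  have hw : p.w = q.w := hp.1.symm.trans hq.1
  refine ⟨hw.le, FinSeq.avoids_of_lh_le (by rw [hw]), fun i hi => ?_⟩
  by_cases h : i < d.2.2.1
  · have he := hp.2.1.symm.trans hq.2.1
    have : p.slalom i = q.slalom i := (List.map_inj_left.1 he) i (List.mem_range.2 h)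
    rw [this]
    simpa using q.exists_notMem hi
  · have h1 := hp.2.2 i (not_lt.1 h)
    have h2 := hq.2.2 i (not_lt.1 h)
    obtain ⟨a, ha, haE⟩ := exists_lt_notMem (n := H i) (E := p.slalom i ∪ q.slalom i)
      ((Finset.card_union_le _ _).trans_lt (by omega))
    exact ⟨a, ha, by simpa using haE⟩

/-- There are countably many possible data, and conditions sharing a datum are compatible; thus the
forcing is even σ-linked. -/
theorem QStar.ccc (hb : SlalomBound H F B) : CCC (QStar (edK H) (edSigma H) F) := by
  intro A hA
  choose d hd using fun p : Condition (edK H) (edSigma H) F => p.exists_info hb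
  let f : QStar (edK H) (edSigma H) F → WithBot (FinSeq H × ℕ × ℕ × List (Finset ℕ)) :=
    WithBot.map d
  have : Countable (WithBot (FinSeq H × ℕ × ℕ × List (Finset ℕ))) :=
    inferInstanceAs (Countable (Option _))
  refine countable_of_injective_of_countable_image (f := f) ?_ (Set.to_countable _)
  intro p hp q hq hpq
  by_contra hne
  refine hA p hp q hq hne ?_
  induction p using WithBot.recBotCoe with
  | bot => exact (QStar.compat_bot q).symm
  | coe p =>
    induction q using WithBot.recBotCoe with
    | bot => exact QStar.compat_bot _
    | coe q =>
      have : d p = d q := by simpa [f] using hpq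
      refine QStar.compat_coe.2 ((Condition.compat_iff hb).2 (Or.inl ((hd p).joins ?_)))
      rw [this]
      exact hd q

end conditions

/-! ## Analyticity -/

section analytic

variable {H : ℕ → ℕ} {F : Set (ℕ → ℕ)} {B : ℕ → ℕ → ℕ}

/-- The finite set coded by a natural number. -/
def decodeSet (n : ℕ) : Finset ℕ :=
  ((Encodable.decode n : Option (ℕ × Finset ℕ)).getD (0, ∅)).2

@[simp] theorem decodeSet_encode (d : ℕ × Finset ℕ) : decodeSet (Encodable.encode d) = d.2 := by
  simp [decodeSet]

/-- The slalom of the condition with stem `w` coded by `y`. -/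
def codeSlalom (w : FinSeq H) (y : ℕ → ℕ) (i : ℕ) : Finset ℕ := decodeSet (y (i - w.lh + 1))

/-- `y` codes a condition with stem `w`. -/
def IsCode (B : ℕ → ℕ → ℕ) (w : FinSeq H) (y : ℕ → ℕ) : Prop :=
  y 0 = Encodable.encode w.1 + 1 ∧
    (∀ i, Proper H (w.lh + i) (decodeSet (y (i + 1))) ∧
      y (i + 1) = Encodable.encode (w.lh + i, decodeSet (y (i + 1)))) ∧
    ∃ k N, ∀ i, N ≤ i → (codeSlalom w y i).card ≤ B k i

theorem QStar.code_coe_succ (p : Condition (edK H) (edSigma H) F) (i : ℕ) :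
    QStar.code (p : QStar (edK H) (edSigma H) F) (i + 1) =
      Encodable.encode (p.1.w.lh + i, p.1.slalom (p.1.w.lh + i)) := by
  rw [← p.1.dis_eq]
  rfl

theorem QStar.code_coe_zero (p : Condition (edK H) (edSigma H) F) :
    QStar.code (p : QStar (edK H) (edSigma H) F) 0 = Encodable.encode p.1.w.1 + 1 := rfl

theorem codeSlalom_code (p : Condition (edK H) (edSigma H) F) {i : ℕ} (hi : p.1.w.lh ≤ i) :
    codeSlalom p.1.w (QStar.code (p : QStar (edK H) (edSigma H) F)) i = p.1.slalom i := by
  rw [codeSlalom, QStar.code_coe_succ, decodeSet_encode, Nat.add_sub_cancel' hi]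

theorem isCode_iff (hb : SlalomBound H F B) {w : FinSeq H} {y : ℕ → ℕ} :
    IsCode B w y ↔ ∃ p : Condition (edK H) (edSigma H) F, p.1.w = w ∧
      QStar.code (p : QStar (edK H) (edSigma H) F) = y := by
  constructor
  · rintro ⟨h1, h2, k, N, h3⟩
    have hp : ∀ i, w.lh ≤ i → Proper H i (codeSlalom w y i) := by
      intro i hi
      have := (h2 (i - w.lh)).1
      rwa [Nat.add_sub_cancel' hi] at this
    refine ⟨Condition.mk' hb w (codeSlalom w y) hp ⟨k, eventually_atTop.2 ⟨N, h3⟩⟩, rfl, ?_⟩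
    · funext n
      cases n with
      | zero => exact h1.symm
      | succ n =>
        have := Condition.mk'_slalom hb w (codeSlalom w y) hp ⟨k, eventually_atTop.2 ⟨N, h3⟩⟩
          (Nat.le_add_right w.lh n)
        rw [codeSlalom, Nat.add_sub_cancel_left] at this
        rw [QStar.code_coe_succ, (h2 n).2]
        exact congrArg (fun e => Encodable.encode (w.lh + n, e)) this
  · rintro ⟨p, rfl, rfl⟩
    obtain ⟨k, hk⟩ := p.exists_bound hb
    obtain ⟨N, hN⟩ := eventually_atTop.1 (hk.and (eventually_ge_atTop p.1.w.lh))
    refine ⟨rfl, fun i => ?_, k, N, fun i hi => ?_⟩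
    · simp only [QStar.code_coe_succ, decodeSet_encode, and_true]
      exact p.1.proper (Nat.le_add_right _ _)
    · rw [codeSlalom_code p (hN i hi).2]
      exact (hN i hi).1

theorem QStar.code_injective :
    Function.Injective (QStar.code : QStar (edK H) (edSigma H) F → ℕ → ℕ) := by
  intro p q h
  induction p using WithBot.recBotCoe with
  | bot =>
    induction q using WithBot.recBotCoe with
    | bot => rfl
    | coe q => exact absurd (congrFun h 0) (Nat.succ_ne_zero _).symm
  | coe p =>
    induction q using WithBot.recBotCoe with
    | bot => exact absurd (congrFun h 0) (Nat.succ_ne_zero _)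
    | coe q =>
      have h0 := congrFun h 0
      rw [code_coe_zero, code_coe_zero, Nat.add_right_cancel_iff,
        Encodable.encode_inj] at h0
      have hw : p.1.w = q.1.w := Subtype.ext h0
      congr 1
      refine Subtype.ext (PreCondition.ext' hw fun i hi => ?_)
      rw [← codeSlalom_code p hi, ← codeSlalom_code q (hw ▸ hi), h, hw]

theorem QStar.mem_range_code_iff (hb : SlalomBound H F B) {y : ℕ → ℕ} :
    y ∈ range (QStar.code : QStar (edK H) (edSigma H) F → ℕ → ℕ) ↔
      (∀ n, y n = 0) ∨ ∃ w : FinSeq H, IsCode B w y := by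
  constructor
  · rintro ⟨p, rfl⟩
    induction p using WithBot.recBotCoe with
    | bot => exact Or.inl fun _ => rfl
    | coe p => exact Or.inr ⟨p.1.w, (isCode_iff hb).2 ⟨p, rfl, rfl⟩⟩
  · rintro (h | ⟨w, hw⟩)
    · exact ⟨⊥, funext fun n => (h n).symm⟩
    · obtain ⟨p, -, hp⟩ := (isCode_iff hb).1 hw
      exact ⟨p, hp⟩

/-- `PreCondition.Joins` for codes. -/
def CodeJoins (w v : FinSeq H) (y z : ℕ → ℕ) : Prop :=
  w ≤ v ∧ v.Avoids (codeSlalom w y) w.lh ∧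
    ∀ i, v.lh ≤ i → ∃ a < H i, a ∉ codeSlalom w y i ∧ a ∉ codeSlalom v z i

theorem codeJoins_iff (p q : Condition (edK H) (edSigma H) F) :
    CodeJoins p.1.w q.1.w (QStar.code (p : QStar (edK H) (edSigma H) F))
      (QStar.code (q : QStar (edK H) (edSigma H) F)) ↔ p.1.Joins q.1 := by
  refine and_congr_right fun h => and_congr ?_ ?_
  · refine forall₂_congr fun i a => forall_congr' fun hi => ?_
    rw [codeSlalom_code p hi]
  · refine forall_congr' fun i => forall_congr' fun hi => ?_
    rw [codeSlalom_code p ((FinSeq.lh_mono h).trans hi), codeSlalom_code q hi]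

/-! ### Borel measurability of the relations on codes -/

theorem measurable_rel {X : Type*} [MeasurableSpace X] {f g : X → ℕ} (hf : Measurable f)
    (hg : Measurable g) (R : ℕ → ℕ → Prop) : Measurable fun x => R (f x) (g x) :=
  (measurable_of_countable fun z : ℕ × ℕ => R z.1 z.2).comp (hf.prodMk hg)

theorem measurable_pred {X : Type*} [MeasurableSpace X] {f : X → ℕ} (hf : Measurable f)
    (R : ℕ → Prop) : Measurable fun x => R (f x) :=
  (measurable_of_countable fun z : ℕ => R z).comp hf

theorem measurable_isCode {X : Type*} [MeasurableSpace X] {f : X → ℕ → ℕ} (hf : Measurable f)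
    (w : FinSeq H) : Measurable fun x => IsCode B w (f x) := by
  have hf' : ∀ n, Measurable fun x => f x n := fun n => (measurable_pi_apply n).comp hf
  refine (measurable_pred (hf' 0) fun n => n = _).and (.and (.forall fun i => ?_)
    (.exists fun k => .exists fun N => .forall fun i => .imp measurable_const ?_))
  · exact measurable_pred (hf' (i + 1)) fun n => Proper H (w.lh + i) (decodeSet n) ∧
      n = Encodable.encode (w.lh + i, decodeSet n)
  · exact measurable_pred (hf' (i - w.lh + 1)) fun n => (decodeSet n).card ≤ B k i

theorem measurable_avoids {X : Type*} [MeasurableSpace X] {f : X → ℕ → ℕ} (hf : Measurable f)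
    (w v : FinSeq H) (n : ℕ) : Measurable fun x => v.Avoids (codeSlalom w (f x)) n := by
  have hf' : ∀ n, Measurable fun x => f x n := fun n => (measurable_pi_apply n).comp hf
  refine .forall fun i => .forall fun a => .imp measurable_const (.imp measurable_const ?_)
  exact measurable_pred (hf' (i - w.lh + 1)) fun n => a ∉ decodeSet n

theorem measurable_codeJoins {X : Type*} [MeasurableSpace X] {f g : X → ℕ → ℕ}
    (hf : Measurable f) (hg : Measurable g) (w v : FinSeq H) :
    Measurable fun x => CodeJoins w v (f x) (g x) := by
  have hf' : ∀ n, Measurable fun x => f x n := fun n => (measurable_pi_apply n).comp hf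
  have hg' : ∀ n, Measurable fun x => g x n := fun n => (measurable_pi_apply n).comp hg
  refine measurable_const.and ((measurable_avoids hf w v _).and
    (.forall fun i => .imp measurable_const ?_))
  exact measurable_rel (hf' (i - w.lh + 1)) (hg' (i - v.lh + 1))
    fun m n => ∃ a < H i, a ∉ decodeSet m ∧ a ∉ decodeSet n

theorem measurable_isZero {X : Type*} [MeasurableSpace X] {f : X → ℕ → ℕ} (hf : Measurable f) :
    Measurable fun x => ∀ n, f x n = 0 :=
  .forall fun n => measurable_pred ((measurable_pi_apply n).comp hf) fun m => m = 0

/-- Being a code is a property of the real itself, with quantifiers over stems and natural numbers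
only, so the set is Borel. The order and incompatibility are treated in the same way. -/
theorem QStar.measurableSet_range_code (hb : SlalomBound H F B) :
    MeasurableSet (range (QStar.code : QStar (edK H) (edSigma H) F → ℕ → ℕ)) := by
  have : range (QStar.code : QStar (edK H) (edSigma H) F → ℕ → ℕ) =
      {y | (∀ n, y n = 0) ∨ ∃ w : FinSeq H, IsCode B w y} :=
    Set.ext fun y => mem_range_code_iff hb
  rw [this]
  exact measurableSet_setOfPred.2 ((measurable_isZero measurable_id).or
    (.exists fun w => measurable_isCode measurable_id w))

theorem QStar.measurableSet_le (hb : SlalomBound H F B) :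
    MeasurableSet {x : (ℕ → ℕ) × (ℕ → ℕ) | ∃ p q : QStar (edK H) (edSigma H) F,
      p ≤ q ∧ x = (QStar.code p, QStar.code q)} := by
  have : {x : (ℕ → ℕ) × (ℕ → ℕ) | ∃ p q : QStar (edK H) (edSigma H) F,
      p ≤ q ∧ x = (QStar.code p, QStar.code q)} =
      {x | ((∀ n, x.1 n = 0) ∧ x.2 ∈ range (QStar.code : QStar (edK H) (edSigma H) F → ℕ → ℕ)) ∨
        ∃ w v : FinSeq H, IsCode B w x.1 ∧ IsCode B v x.2 ∧ w ≤ v ∧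
          v.Avoids (codeSlalom w x.1) w.lh ∧
          ∀ i, v.lh ≤ i → codeSlalom w x.1 i ⊆ codeSlalom v x.2 i} := by
    ext ⟨y, z⟩
    simp only [mem_ofPred_eq, Prod.mk.injEq]
    constructor
    · rintro ⟨p, q, hpq, rfl, rfl⟩
      induction p using WithBot.recBotCoe with
      | bot => exact Or.inl ⟨fun _ => rfl, mem_range_self q⟩
      | coe p =>
        induction q using WithBot.recBotCoe with
        | bot => exact absurd hpq (WithBot.not_coe_le_bot p)
        | coe q =>
          obtain ⟨h1, h2, h3⟩ := (Condition.le_iff hb.pos).1 (WithBot.coe_le_coe.1 hpq)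
          refine Or.inr ⟨p.1.w, q.1.w, (isCode_iff hb).2 ⟨p, rfl, rfl⟩,
            (isCode_iff hb).2 ⟨q, rfl, rfl⟩, h1, fun i a hi => ?_, fun i hi => ?_⟩
          · rw [codeSlalom_code p hi]
            exact h2 i a hi
          · rw [codeSlalom_code p ((FinSeq.lh_mono h1).trans hi), codeSlalom_code q hi]
            exact h3 i hi
    · rintro (⟨h1, q, rfl⟩ | ⟨w, v, hw, hv, h1, h2, h3⟩)
      · exact ⟨⊥, q, bot_le, funext h1, rfl⟩
      · obtain ⟨p, rfl, rfl⟩ := (isCode_iff hb).1 hw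
        obtain ⟨q, rfl, rfl⟩ := (isCode_iff hb).1 hv
        refine ⟨p, q, WithBot.coe_le_coe.2 ((Condition.le_iff hb.pos).2
          ⟨h1, fun i a hi => ?_, fun i hi => ?_⟩), rfl, rfl⟩
        · rw [← codeSlalom_code p hi]
          exact h2 i a hi
        · rw [← codeSlalom_code p ((FinSeq.lh_mono h1).trans hi), ← codeSlalom_code q hi]
          exact h3 i hi
  rw [this]
  have m1 : ∀ n, Measurable fun x : (ℕ → ℕ) × (ℕ → ℕ) => x.1 n :=
    fun n => (measurable_pi_apply n).comp measurable_fst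
  have m2 : ∀ n, Measurable fun x : (ℕ → ℕ) × (ℕ → ℕ) => x.2 n :=
    fun n => (measurable_pi_apply n).comp measurable_snd
  refine measurableSet_setOfPred.2 (((measurable_isZero measurable_fst).and
    (measurableSet_setOfPred.1 (measurable_snd (measurableSet_range_code hb)))).or
    (.exists fun w => .exists fun v => (measurable_isCode measurable_fst w).and
      ((measurable_isCode measurable_snd v).and (measurable_const.and
        ((measurable_avoids measurable_fst w v _).and
          (.forall fun i => .imp measurable_const ?_))))))
  exact measurable_rel (m1 (i - w.lh + 1)) (m2 (i - v.lh + 1))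
    fun m n => decodeSet m ⊆ decodeSet n

theorem QStar.measurableSet_incompat (hb : SlalomBound H F B) :
    MeasurableSet {x : (ℕ → ℕ) × (ℕ → ℕ) | ∃ p q : QStar (edK H) (edSigma H) F,
      ¬ Compat p q ∧ x = (QStar.code p, QStar.code q)} := by
  have : {x : (ℕ → ℕ) × (ℕ → ℕ) | ∃ p q : QStar (edK H) (edSigma H) F,
      ¬ Compat p q ∧ x = (QStar.code p, QStar.code q)} =
      {x | ∃ w v : FinSeq H, IsCode B w x.1 ∧ IsCode B v x.2 ∧
        ¬ (CodeJoins w v x.1 x.2 ∨ CodeJoins v w x.2 x.1)} := by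
    ext ⟨y, z⟩
    simp only [mem_ofPred_eq, Prod.mk.injEq]
    constructor
    · rintro ⟨p, q, hpq, rfl, rfl⟩
      induction p using WithBot.recBotCoe with
      | bot => exact absurd (QStar.compat_bot q).symm hpq
      | coe p =>
        induction q using WithBot.recBotCoe with
        | bot => exact absurd (QStar.compat_bot _) hpq
        | coe q =>
          rw [QStar.compat_coe, Condition.compat_iff hb] at hpq
          refine ⟨p.1.w, q.1.w, (isCode_iff hb).2 ⟨p, rfl, rfl⟩,
            (isCode_iff hb).2 ⟨q, rfl, rfl⟩, ?_⟩
          rwa [codeJoins_iff, codeJoins_iff]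
    · rintro ⟨w, v, hw, hv, h⟩
      obtain ⟨p, rfl, rfl⟩ := (isCode_iff hb).1 hw
      obtain ⟨q, rfl, rfl⟩ := (isCode_iff hb).1 hv
      refine ⟨p, q, ?_, rfl, rfl⟩
      rwa [QStar.compat_coe, Condition.compat_iff hb, ← codeJoins_iff, ← codeJoins_iff]
  rw [this]
  exact measurableSet_setOfPred.2 (.exists fun w => .exists fun v =>
    (measurable_isCode measurable_fst w).and ((measurable_isCode measurable_snd v).and
      ((measurable_codeJoins measurable_fst measurable_snd w v).or
        (measurable_codeJoins measurable_snd measurable_fst v w)).not))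

theorem QStar.souslinCCC (hb : SlalomBound H F B) :
    SouslinCCC (QStar.code : QStar (edK H) (edSigma H) F → ℕ → ℕ) where
  injective := code_injective
  analytic_conditions := (measurableSet_range_code hb).analyticSet
  analytic_le := (measurableSet_le hb).analyticSet
  analytic_incompat := (measurableSet_incompat hb).analyticSet
  ccc := ccc hb

end analytic

/-! ## Topological sweetness of the forcing notion for `famF0` -/

section growth

/-- In the exponent this says 4·2^(ki) < 2^(2^(i+1)) ≤ H(i), the source of smallness for all three
families. -/
theorem eventually_mul_add_two_lt_two_pow (k : ℕ) : ∀ᶠ i : ℕ in atTop, k * i + 2 < 2 ^ (i + 1) := by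
  have h := tendsto_pow_const_div_const_pow_of_one_lt 1 (one_lt_two : (1 : ℝ) < 2)
  have h' : (0 : ℝ) < 1 / (k + 1) := by positivity
  filter_upwards [h.eventually_lt_const h', eventually_ge_atTop 1] with i hi hi1
  rw [div_lt_div_iff₀ (by positivity) (by positivity)] at hi
  have : i * (k + 1) < 2 ^ i := by
    have h2 : ((i * (k + 1) : ℕ) : ℝ) < ((2 ^ i : ℕ) : ℝ) := by push_cast; linarith
    exact_mod_cast h2
  rw [pow_succ]
  nlinarith

/-- An arbitrarily small increase of the growth rate pays for the union of i + 2 sets. -/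
theorem eventually_mul_rpow_le {γ δ : ℝ} (h : γ < δ) :
    ∀ᶠ i : ℕ in atTop, ((i : ℝ) + 2) * (2 : ℝ) ^ (γ * i) ≤ (2 : ℝ) ^ (δ * i) := by
  have hc : 1 < (2 : ℝ) ^ (δ - γ) := Real.one_lt_rpow one_lt_two (by linarith)
  have h1 := tendsto_pow_const_div_const_pow_of_one_lt 1 hc
  have h2 := tendsto_pow_atTop_atTop_of_one_lt hc
  -- With c = 2^(δ-γ), half of c^i exceeds i and the other half is at least 2.
  filter_upwards [h1.eventually_lt_const (by norm_num : (0 : ℝ) < 1 / 2),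
    h2.eventually_ge_atTop 4] with i hi1 hi2
  rw [div_lt_div_iff₀ (by positivity) (by positivity)] at hi1
  have e : (2 : ℝ) ^ (δ * i) = ((2 : ℝ) ^ (δ - γ)) ^ i * (2 : ℝ) ^ (γ * i) := by
    rw [← Real.rpow_natCast, ← Real.rpow_mul zero_le_two, ← Real.rpow_add zero_lt_two]
    ring_nf
  rw [e]
  refine mul_le_mul_of_nonneg_right ?_ (by positivity)
  simp only [pow_one] at hi1
  linarith

end growth

/-! ### The topology of stems, initial parts and growth rates -/

section sweet

variable {H : ℕ → ℕ}

theorem slalomBound_famF0 (hH : ∀ i, 2 ^ 2 ^ (i + 1) ≤ H i) :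
    SlalomBound H (famF0 H) fun k i => 2 ^ (k * i) := by
  refine slalomBound_range (fun i => (Nat.two_pow_pos _).trans_le (hH i)) (fun k => ?_)
    fun k l => ⟨max k l + 1, ?_⟩
  · filter_upwards [eventually_mul_add_two_lt_two_pow k] with i hi
    refine lt_of_lt_of_le ?_ (hH i)
    calc 4 * 2 ^ (k * i) = 2 ^ (k * i + 2) := by ring
      _ < _ := Nat.pow_lt_pow_right (by norm_num) hi
  · filter_upwards [eventually_ge_atTop 1] with i hi
    have h1 : 2 ^ (k * i) ≤ 2 ^ (max k l * i) :=
      Nat.pow_le_pow_right (by norm_num) (Nat.mul_le_mul_right _ (le_max_left _ _))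
    have h2 : 2 ^ (l * i) ≤ 2 ^ (max k l * i) :=
      Nat.pow_le_pow_right (by norm_num) (Nat.mul_le_mul_right _ (le_max_right _ _))
    have h3 : 2 ^ (max k l * i + 1) ≤ 2 ^ ((max k l + 1) * i) :=
      Nat.pow_le_pow_right (by norm_num) (by rw [add_mul]; omega)
    rw [pow_succ] at h3
    omega

/-- The sizes of the sets of the slalom have exponential growth rate below `α`. -/
def PreCondition.Slow (p : PreCondition (edK H)) (α : ℝ) : Prop :=
  ∃ β < α, ∀ᶠ i : ℕ in atTop, ((p.slalom i).card : ℝ) ≤ (2 : ℝ) ^ (β * i)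

/-- The basic open sets: the stem and the slalom below `N` are fixed, the growth rate is below `α`
and from `N` on the corresponding bound holds. -/
def sweetNhd (d : FinSeq H × ℕ × List (Finset ℕ) × ℚ) :
    Set (Condition (edK H) (edSigma H) (famF0 H)) :=
  {p | p.1.w = d.1 ∧ (∀ i, d.1.lh ≤ i → i < d.2.1 → p.1.slalom i = d.2.2.1.getD i ∅) ∧
    p.1.Slow d.2.2.2 ∧ ∀ i, d.1.lh ≤ i → d.2.1 ≤ i →
      ((p.1.slalom i).card : ℝ) ≤ (2 : ℝ) ^ ((d.2.2.2 : ℝ) * i)}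

/-- The parameters of the basic open set around `p` with given `N` and `α`. -/
def sweetData (p : PreCondition (edK H)) (N : ℕ) (α : ℚ) : FinSeq H × ℕ × List (Finset ℕ) × ℚ :=
  (p.w, N, (List.range N).map p.slalom, α)

theorem mem_sweetNhd_sweetData {p q : Condition (edK H) (edSigma H) (famF0 H)} {N : ℕ} {α : ℚ} :
    q ∈ sweetNhd (sweetData p.1 N α) ↔ q.1.w = p.1.w ∧
      (∀ i, p.1.w.lh ≤ i → i < N → q.1.slalom i = p.1.slalom i) ∧ q.1.Slow α ∧
      ∀ i, p.1.w.lh ≤ i → N ≤ i → ((q.1.slalom i).card : ℝ) ≤ (2 : ℝ) ^ ((α : ℝ) * i) := by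
  refine and_congr_right fun _ => and_congr_left fun _ => forall_congr' fun i =>
    forall_congr' fun _ => forall_congr' fun hi => ?_
  simp only [sweetData] at hi ⊢
  rw [List.getD_eq_getElem _ _ (by simpa using hi)]
  simp

theorem PreCondition.Slow.mono {p : PreCondition (edK H)} {α β : ℝ} (h : p.Slow α) (hαβ : α ≤ β) :
    p.Slow β := by
  obtain ⟨γ, h1, h2⟩ := h
  exact ⟨γ, h1.trans_le hαβ, h2⟩

theorem rpow_mul_nat_mono {α β : ℝ} (h : α ≤ β) (i : ℕ) :
    (2 : ℝ) ^ (α * i) ≤ (2 : ℝ) ^ (β * i) :=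
  Real.rpow_le_rpow_of_exponent_le one_le_two (mul_le_mul_of_nonneg_right h (Nat.cast_nonneg _))

/-- The basic open sets of the topology witnessing sweetness. -/
def sweetBasis (H : ℕ → ℕ) : Set (Set (QStar (edK H) (edSigma H) (famF0 H))) :=
  insert {⊥} (range fun d : FinSeq H × ℕ × List (Finset ℕ) × ℚ => WithBot.some '' sweetNhd d)

/-- The topology witnessing sweetness. -/
abbrev sweetTopology (H : ℕ → ℕ) : TopologicalSpace (QStar (edK H) (edSigma H) (famF0 H)) :=
  TopologicalSpace.generateFrom (sweetBasis H)

/-- Recentre at `p`, with the larger cut-off and the smaller rate. Between an old cut-off and the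
new one the members of the new set agree with `p`, which obeys the old bound there. -/
theorem exists_sweetNhd_subset_inter (d₁ d₂ : FinSeq H × ℕ × List (Finset ℕ) × ℚ)
    {p : Condition (edK H) (edSigma H) (famF0 H)} (h₁ : p ∈ sweetNhd d₁) (h₂ : p ∈ sweetNhd d₂) :
    ∃ d, p ∈ sweetNhd d ∧ sweetNhd d ⊆ sweetNhd d₁ ∩ sweetNhd d₂ := by
  have key : ∀ d : FinSeq H × ℕ × List (Finset ℕ) × ℚ, p ∈ sweetNhd d → ∀ N α, d.2.1 ≤ N →
      α ≤ d.2.2.2 → sweetNhd (sweetData p.1 N α) ⊆ sweetNhd d := by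
    intro d hd N α hN hα q hq
    obtain ⟨p1, p2, -, p4⟩ := hd
    obtain ⟨q1, q2, q3, q4⟩ := mem_sweetNhd_sweetData.1 hq
    have hα' : (α : ℝ) ≤ d.2.2.2 := by exact_mod_cast hα
    rw [p1] at q2 q4
    refine ⟨q1.trans p1, fun i hi hi' => ?_, q3.mono hα', fun i hi hi' => ?_⟩
    · rw [q2 i hi (hi'.trans_le hN), p2 i hi hi']
    · by_cases h : i < N
      · rw [q2 i hi h]
        exact p4 i hi hi'
      · exact (q4 i hi (not_lt.1 h)).trans (rpow_mul_nat_mono hα' i)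
  refine ⟨sweetData p.1 (max d₁.2.1 d₂.2.1) (min d₁.2.2.2 d₂.2.2.2), ?_, fun q hq =>
    ⟨key d₁ h₁ _ _ (le_max_left _ _) (min_le_left _ _) hq,
      key d₂ h₂ _ _ (le_max_right _ _) (min_le_right _ _) hq⟩⟩
  refine mem_sweetNhd_sweetData.2 ⟨rfl, fun _ _ _ => rfl, ?_, fun i hi hi' => ?_⟩
  · rcases min_choice d₁.2.2.2 d₂.2.2.2 with h | h <;> rw [h]
    exacts [h₁.2.2.1, h₂.2.2.1]
  · rcases min_choice d₁.2.2.2 d₂.2.2.2 with h | h <;> rw [h]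
    · exact h₁.2.2.2 i (h₁.1 ▸ hi) ((le_max_left _ _).trans hi')
    · exact h₂.2.2.2 i (h₂.1 ▸ hi) ((le_max_right _ _).trans hi')

/-- The growth rate of a condition is finite. -/
theorem Condition.exists_slow (hb : SlalomBound H (famF0 H) fun k i => 2 ^ (k * i))
    (p : Condition (edK H) (edSigma H) (famF0 H)) : ∃ k : ℕ, p.1.Slow k := by
  obtain ⟨k, hk⟩ := p.exists_bound hb
  refine ⟨k + 1, k, by push_cast; linarith, ?_⟩
  filter_upwards [hk] with i hi
  rw [← Nat.cast_mul, Real.rpow_natCast]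
  exact_mod_cast hi

theorem PreCondition.Slow.eventually_le {p : PreCondition (edK H)} {α : ℝ} (h : p.Slow α) :
    ∀ᶠ i : ℕ in atTop, ((p.slalom i).card : ℝ) ≤ (2 : ℝ) ^ (α * i) := by
  obtain ⟨β, h1, h2⟩ := h
  filter_upwards [h2] with i hi
  exact hi.trans (rpow_mul_nat_mono h1.le i)

theorem isTopologicalBasis_sweetBasis (hb : SlalomBound H (famF0 H) fun k i => 2 ^ (k * i)) :
    @TopologicalSpace.IsTopologicalBasis _ (sweetTopology H) (sweetBasis H) := by
  let _ := sweetTopology H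
  refine ⟨?_, ?_, rfl⟩
  · rintro U (rfl | ⟨d₁, rfl⟩) V (rfl | ⟨d₂, rfl⟩) x ⟨hx₁, hx₂⟩
    · exact ⟨{⊥}, Or.inl rfl, hx₁, fun y hy => ⟨hy, hy⟩⟩
    · obtain ⟨p, -, rfl⟩ := hx₂
      exact absurd hx₁ (WithBot.coe_ne_bot)
    · obtain ⟨p, -, rfl⟩ := hx₁
      exact absurd hx₂ (WithBot.coe_ne_bot)
    · obtain ⟨p, hp, rfl⟩ := hx₁
      obtain ⟨p', hp', hpp⟩ := hx₂
      obtain rfl := WithBot.coe_injective hpp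
      obtain ⟨d, hd, hd'⟩ := exists_sweetNhd_subset_inter d₁ d₂ hp hp'
      refine ⟨_, Or.inr ⟨d, rfl⟩, ⟨p', hd, rfl⟩, ?_⟩
      rintro _ ⟨q, hq, rfl⟩
      exact ⟨⟨q, (hd' hq).1, rfl⟩, ⟨q, (hd' hq).2, rfl⟩⟩
  · refine eq_univ_of_forall fun x => ?_
    induction x using WithBot.recBotCoe with
    | bot => exact ⟨{⊥}, Or.inl rfl, rfl⟩
    | coe p =>
      obtain ⟨k, hk⟩ := p.exists_slow hb
      obtain ⟨N, hN⟩ := eventually_atTop.1 hk.eventually_le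
      exact ⟨_, Or.inr ⟨sweetData p.1 N k, rfl⟩, p, mem_sweetNhd_sweetData.2
        ⟨rfl, fun _ _ _ => rfl, by rwa [Rat.cast_natCast], fun i _ hi => by
          rw [Rat.cast_natCast]; exact hN i hi⟩, rfl⟩

/-- The amalgamation of a condition with infinitely many conditions that agree with a weaker one on
longer and longer initial segments. -/
theorem exists_sweet_amalgam (hb : SlalomBound H (famF0 H) fun k i => 2 ^ (k * i))
    {q p' : Condition (edK H) (edSigma H) (famF0 H)} (hq : p' ≤ q)
    (p : ℕ → Condition (edK H) (edSigma H) (famF0 H)) {γ α : ℝ} (hγα : γ < α) {N : ℕ}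
    (hN : q.1.w.lh ≤ N) (hqγ : ∀ i, N ≤ i → ((q.1.slalom i).card : ℝ) ≤ (2 : ℝ) ^ (γ * i))
    (hgrow : ∀ i : ℕ, N ≤ i → ((i : ℝ) + 2) * (2 : ℝ) ^ (γ * i) ≤ (2 : ℝ) ^ (α * i))
    (hsmall : ∀ i : ℕ, N ≤ i → (2 : ℝ) ^ (α * i) < H i)
    (hw : ∀ j, (p j).1.w = p'.1.w)
    (hagree : ∀ j i, p'.1.w.lh ≤ i → i < N + j → (p j).1.slalom i = p'.1.slalom i)
    (hpγ : ∀ j i, N ≤ i → (((p j).1.slalom i).card : ℝ) ≤ (2 : ℝ) ^ (γ * i)) :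
    ∃ r, q ≤ r ∧ (∀ j, p j ≤ r) ∧ r.1.w = q.1.w ∧
      (∀ i, q.1.w.lh ≤ i → i < N → r.1.slalom i = q.1.slalom i) ∧ r.1.Slow α ∧
      ∀ i, N ≤ i → ((r.1.slalom i).card : ℝ) ≤ (2 : ℝ) ^ (α * i) := by
  -- The index j is used at i only when N + j ≤ i; for the other j the condition `p j` agrees at i
  -- with `p'`, whose slalom past the stem of `q` is contained in that of `q`.
  let E : ℕ → Finset ℕ := fun i =>
    q.1.slalom i ∪ (Finset.range (i + 1 - N)).biUnion fun j => (p j).1.slalom i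
  have hlt : ∀ i, i < N → E i = q.1.slalom i := by
    intro i hi
    simp only [E]
    rw [show i + 1 - N = 0 by omega]
    simp
  have hcard : ∀ i, N ≤ i → ((E i).card : ℝ) ≤ ((i : ℝ) + 2) * (2 : ℝ) ^ (γ * i) := by
    intro i hi
    have h1 : (((Finset.range (i + 1 - N)).biUnion fun j => (p j).1.slalom i).card : ℝ) ≤
        (i + 1) * (2 : ℝ) ^ (γ * i) := by
      calc _ ≤ ((∑ j ∈ Finset.range (i + 1 - N), ((p j).1.slalom i).card : ℕ) : ℝ) := by
            exact_mod_cast Finset.card_biUnion_le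
        _ ≤ ∑ j ∈ Finset.range (i + 1 - N), (2 : ℝ) ^ (γ * i) := by
            push_cast
            exact Finset.sum_le_sum fun j _ => hpγ j i hi
        _ ≤ _ := by
            rw [Finset.sum_const, Finset.card_range, nsmul_eq_mul]
            refine mul_le_mul_of_nonneg_right ?_ (by positivity)
            have : i + 1 - N ≤ i + 1 := Nat.sub_le _ _
            exact_mod_cast this
    have h2 : ((E i).card : ℝ) ≤ ((q.1.slalom i).card : ℝ) +
        (((Finset.range (i + 1 - N)).biUnion fun j => (p j).1.slalom i).card : ℝ) := by
      exact_mod_cast Finset.card_union_le _ _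
    have h3 := hqγ i hi
    linarith
  have hcard' : ∀ i, N ≤ i → ((E i).card : ℝ) ≤ (2 : ℝ) ^ (α * i) :=
    fun i hi => (hcard i hi).trans (hgrow i hi)
  have hE : ∀ i, q.1.w.lh ≤ i → Proper H i (E i) := by
    intro i hi
    have hqp := q.1.proper hi
    rcases lt_or_ge i N with h | h
    · rw [hlt i h]
      exact hqp
    · refine ⟨?_, hqp.2.1.trans_le (Finset.card_le_card Finset.subset_union_left), ?_⟩
      · refine Finset.union_subset hqp.1 (Finset.biUnion_subset.2 fun j _ => ?_)
        refine ((p j).1.proper ?_).1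
        rw [hw j]
        exact (FinSeq.lh_mono ((Condition.le_iff hb.pos).1 hq).1).trans hi
      · exact_mod_cast (hcard' i h).trans_lt (hsmall i h)
  obtain ⟨k, hk⟩ := exists_nat_ge α
  let r := Condition.mk' hb q.1.w E hE ⟨k, by
    filter_upwards [eventually_ge_atTop N] with i hi
    have h1 := (hcard' i hi).trans (rpow_mul_nat_mono hk i)
    rw [← Nat.cast_mul, Real.rpow_natCast] at h1
    exact_mod_cast h1⟩
  have hr : ∀ i, q.1.w.lh ≤ i → r.1.slalom i = E i :=
    fun i hi => Condition.mk'_slalom hb q.1.w E hE _ hi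
  obtain ⟨hq1, hq2, hq3⟩ := (Condition.le_iff hb.pos).1 hq
  refine ⟨r, (Condition.le_iff hb.pos).2 ⟨le_rfl, FinSeq.avoids_of_lh_le le_rfl, fun i hi => ?_⟩,
    fun j => (Condition.le_iff hb.pos).2 ⟨?_, ?_, fun i hi => ?_⟩, rfl, fun i hi hi' => ?_, ?_,
    fun i hi => ?_⟩
  · rw [hr i hi]
    exact Finset.subset_union_left
  · rw [hw j]
    exact hq1
  · rw [hw j]
    intro i a hi ha
    have hil := (List.getElem?_eq_some_iff.1 ha).1
    rw [hagree j i hi ((lt_of_lt_of_le hil hN).trans_le (Nat.le_add_right _ _))]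
    exact hq2 i a hi ha
  · change q.1.w.lh ≤ i at hi
    rw [hr i hi]
    rcases lt_or_ge i (N + j) with h | h
    · rw [hagree j i ((FinSeq.lh_mono hq1).trans hi) h]
      exact (hq3 i hi).trans Finset.subset_union_left
    · refine Finset.Subset.trans ?_ Finset.subset_union_right
      exact Finset.subset_biUnion_of_mem (fun j => (p j).1.slalom i)
        (Finset.mem_range.2 (by omega : j < i + 1 - N))
  · rw [hr i hi, hlt i hi']
  -- The slack between γ and α keeps the rate strictly below α.
  · obtain ⟨δ, h1, h2⟩ := exists_between hγα
    refine ⟨δ, h2, ?_⟩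
    filter_upwards [eventually_mul_rpow_le h1, eventually_ge_atTop N] with i hi hi'
    rw [hr i (hN.trans hi')]
    exact (hcard i hi').trans hi
  · rw [hr i (hN.trans hi)]
    exact hcard' i hi

theorem topologicallySweet_famF0 (hH : ∀ i, 2 ^ 2 ^ (i + 1) ≤ H i) :
    TopologicallySweet (QStar (edK H) (edSigma H) (famF0 H)) := by
  have hb := slalomBound_famF0 hH
  have hbasis := isTopologicalBasis_sweetBasis hb
  let _ := sweetTopology H
  have hcount : (sweetBasis H).Countable := (countable_range _).insert _
  refine ⟨sweetTopology H, hbasis.secondCountableTopology hcount,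
    hbasis.isOpen (Or.inl rfl), fun p p' q W hp hpq hW => ?_⟩
  obtain ⟨U, hU, hqU, hUW⟩ := hbasis.mem_nhds_iff.1 hW
  induction p' using WithBot.recBotCoe with
  | bot =>
    refine ⟨q, mem_of_mem_nhds hW, le_rfl, ?_⟩
    have h1 : ∀ᶠ n in atTop, p n ∈ ({⊥} : Set (QStar (edK H) (edSigma H) (famF0 H))) :=
      hp ((hbasis.isOpen (Or.inl rfl)).mem_nhds rfl)
    refine Nat.frequently_atTop_iff_infinite.1 (h1.mono fun n hn => ?_).frequently
    rw [mem_singleton_iff.1 hn]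
    exact bot_le
  | coe p' =>
  induction q using WithBot.recBotCoe with
  | bot => exact absurd hpq (WithBot.not_coe_le_bot p')
  | coe q =>
  have hpq' := WithBot.coe_le_coe.1 hpq
  rcases hU with rfl | ⟨d, rfl⟩
  · exact absurd hqU WithBot.coe_ne_bot
  obtain ⟨q', ⟨d1, d2, ⟨β, hβα, hβ⟩, d4⟩, hqq⟩ := hqU
  obtain rfl := WithBot.coe_injective hqq
  -- γ lies above the rate β of `q'`, so that the sets of rate γ around `p'` are neighbourhoods, and
  -- below α, so that the factor i + 2 is absorbed.
  obtain ⟨γ, hβγ, hγα⟩ := exists_rat_btwn hβα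
  obtain ⟨k, hk⟩ := exists_nat_ge ((d.2.2.2 : ℚ) : ℝ)
  obtain ⟨hle1, hle2, hle3⟩ := (Condition.le_iff hb.pos).1 hpq'
  have hsmall : ∀ᶠ i : ℕ in atTop, (2 : ℝ) ^ ((d.2.2.2 : ℝ) * i) < H i := by
    filter_upwards [hb.small k] with i hi
    refine (rpow_mul_nat_mono hk i).trans_lt ?_
    rw [← Nat.cast_mul, Real.rpow_natCast]
    have : 2 ^ (k * i) < H i := by omega
    exact_mod_cast this
  obtain ⟨N, hN⟩ := eventually_atTop.1 (hβ.and ((eventually_mul_rpow_le hγα).and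
    (hsmall.and ((eventually_ge_atTop q'.1.w.lh).and (eventually_ge_atTop d.2.1)))))
  have hq'γ : ∀ i, N ≤ i → ((q'.1.slalom i).card : ℝ) ≤ (2 : ℝ) ^ ((γ : ℝ) * i) :=
    fun i hi => ((hN i hi).1).trans (rpow_mul_nat_mono hβγ.le i)
  have hqw := (hN N le_rfl).2.2.2.1
  -- Being weaker than `q'`, the limit `p'` inherits its growth rate.
  have hp'β : ∀ i, N ≤ i → (p'.1.slalom i).card ≤ (q'.1.slalom i).card :=
    fun i hi => Finset.card_le_card (hle3 i (hqw.trans hi))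
  have hopen : ∀ j, WithBot.some '' sweetNhd (sweetData p'.1 (N + j) γ) ∈
      𝓝 (p' : QStar (edK H) (edSigma H) (famF0 H)) := by
    intro j
    refine (hbasis.isOpen (Or.inr ⟨_, rfl⟩)).mem_nhds ⟨p', mem_sweetNhd_sweetData.2
      ⟨rfl, fun _ _ _ => rfl, ⟨β, hβγ, ?_⟩, fun i hi hi' => ?_⟩, rfl⟩
    · filter_upwards [hβ, eventually_ge_atTop N] with i hi hi'
      exact le_trans (by exact_mod_cast hp'β i hi') hi
    · have : N ≤ i := by omega
      exact le_trans (by exact_mod_cast hp'β i this) (hq'γ i this)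
  obtain ⟨φ, hφ, hφ'⟩ := extraction_forall_of_eventually fun j => hp (hopen j)
  choose s hs hs' using hφ'
  have hs2 := fun j => mem_sweetNhd_sweetData.1 (hs j)
  have hbd : ∀ j i, N ≤ i → (((s j).1.slalom i).card : ℝ) ≤ (2 : ℝ) ^ ((γ : ℝ) * i) := by
    intro j i hi
    have hi0 : p'.1.w.lh ≤ i := (FinSeq.lh_mono hle1).trans (hqw.trans hi)
    rcases lt_or_ge i (N + j) with h | h
    · rw [(hs2 j).2.1 i hi0 h]
      exact le_trans (by exact_mod_cast hp'β i hi) (hq'γ i hi)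
    · exact (hs2 j).2.2.2 i hi0 h
  obtain ⟨r, r1, r2, r3, r4, r5, r6⟩ := exists_sweet_amalgam hb hpq' s hγα hqw hq'γ
    (fun i hi => (hN i hi).2.1) (fun i hi => (hN i hi).2.2.1) (fun j => (hs2 j).1)
    (fun j => (hs2 j).2.1) hbd
  refine ⟨r, hUW ⟨r, ⟨r3.trans d1, fun i hi hi' => ?_, r5, fun i hi hi' => ?_⟩, rfl⟩,
    WithBot.coe_le_coe.2 r1, ?_⟩
  · rw [r4 i (d1 ▸ hi) (hi'.trans_le (hN N le_rfl).2.2.2.2)]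
    exact d2 i hi hi'
  · rcases lt_or_ge i N with h | h
    · rw [r4 i (d1 ▸ hi) h]
      exact d4 i hi hi'
    · exact r6 i h
  · refine (infinite_range_of_injective hφ.injective).mono ?_
    rintro _ ⟨j, rfl⟩
    change p (φ j) ≤ r
    rw [← hs' j]
    exact WithBot.coe_le_coe.2 (r2 j)

end sweet

/-! ## Complete subalgebras generated by names for Cohen reals -/

section names

variable {H : ℕ → ℕ} {Q : Type} [Preorder Q]

theorem RO.ext_mem {P : Type} [Preorder P] {a b : RO P} (h : ∀ p, p ∈ a.1 ↔ p ∈ b.1) : a = b :=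
  Subtype.ext (Set.ext h)

theorem RO.le_def {P : Type} [Preorder P] {a b : RO P} : a ≤ b ↔ a.1 ⊆ b.1 := Iff.rfl

theorem RO.mem_iff {P : Type} [Preorder P] (a : RO P) {p : P} :
    p ∈ a.1 ↔ ∀ r, p ≤ r → ∃ s, r ≤ s ∧ s ∈ a.1 := by
  conv_lhs => rw [← a.2]
  rfl

theorem RO.mem_of_le {P : Type} [Preorder P] (a : RO P) {p q : P} (h : p ∈ a.1) (hpq : p ≤ q) :
    q ∈ a.1 :=
  a.mem_iff.2 fun r hr => a.mem_iff.1 h r (hpq.trans hr)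

theorem subset_regularize {P : Type} [Preorder P] {U : Set P}
    (hU : ∀ p ∈ U, ∀ q, p ≤ q → q ∈ U) : U ⊆ regularize U :=
  fun p hp r hr => ⟨r, le_rfl, hU p hp r hr⟩

namespace StandardName

variable (τ : StandardName H Q)

theorem mem_value_of_le {A : Set (FinSeq H)} {η : FinSeq H} (hη : η ∈ A) {k : ℕ}
    (hk : (k : ℕ∞) < τ.N η) {p : Q} (hp : τ.q η k ≤ p) : p ∈ (τ.value A).1 :=
  fun r hr => ⟨r, le_rfl, η, hη, k, hk, hp.trans hr⟩

theorem value_mono {A B : Set (FinSeq H)} (h : A ⊆ B) : (τ.value A).1 ⊆ (τ.value B).1 := by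
  intro p hp r hr
  obtain ⟨s, hs, η, hη, hk⟩ := hp r hr
  exact ⟨s, hs, η, h hη, hk⟩

theorem mem_value_iff_singleton {A : Set (FinSeq H)} {p : Q} :
    p ∈ (τ.value A).1 ↔ ∀ r, p ≤ r → ∃ s, r ≤ s ∧ ∃ η ∈ A, s ∈ (τ.value {η}).1 := by
  constructor
  · intro h r hr
    obtain ⟨s, hs, η, hη, k, hk, hks⟩ := h r hr
    exact ⟨s, hs, η, hη, τ.mem_value_of_le (mem_singleton η) hk hks⟩
  · intro h
    refine (τ.value A).mem_iff.2 fun r hr => ?_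
    obtain ⟨s, hs, η, hη, h'⟩ := h r hr
    exact ⟨s, hs, τ.value_mono (singleton_subset_iff.2 hη) h'⟩

theorem exists_le_of_prefix {ν η : FinSeq H} (h : ν ≤ η) {k : ℕ} (hk : (k : ℕ∞) < τ.N η) :
    ∃ m : ℕ, (m : ℕ∞) < τ.N ν ∧ τ.q ν m ≤ τ.q η k := by
  by_cases hl : ν.lh < η.lh
  · exact τ.refine_below ν η (FinSeq.lt_iff.2 ⟨h, hl⟩) k hk
  · obtain rfl := FinSeq.eq_of_le_of_lh_le h (not_lt.1 hl)
    exact ⟨k, hk, le_rfl⟩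

theorem value_anti {ν η : FinSeq H} (h : ν ≤ η) : (τ.value {η}).1 ⊆ (τ.value {ν}).1 := by
  intro p hp r hr
  obtain ⟨s, hs, η', hη', k, hk, hks⟩ := hp r hr
  obtain rfl := mem_singleton_iff.1 hη'
  obtain ⟨m, hm, hms⟩ := τ.exists_le_of_prefix h hk
  exact ⟨s, hs, ν, rfl, m, hm, hms.trans hks⟩

/-- Otherwise some condition would lie above two different members of the antichain for length
`ν.lh`. -/
theorem le_of_mem_value {ν η : FinSeq H} {p : Q} (h : p ∈ (τ.value {ν}).1)
    (h' : p ∈ (τ.value {η}).1) (hl : ν.lh ≤ η.lh) : ν ≤ η := by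
  obtain ⟨s, hs, η', hη', k, hk, hks⟩ := h p le_rfl
  obtain rfl := mem_singleton_iff.1 hη'
  obtain ⟨t, ht, ν', hν', m, hm, hmt⟩ := h' s hs
  obtain rfl := mem_singleton_iff.1 hν'
  obtain ⟨l, hl', hlm⟩ := τ.exists_le_of_prefix (FinSeq.restr_le ν' η'.lh) hm
  by_contra hne
  refine τ.antichain η' (ν'.restr η'.lh) k l (by rw [FinSeq.lh_restr, min_eq_left hl]) hk hl' ?_
    ⟨t, hks.trans ht, hlm.trans hmt⟩
  intro he
  refine hne ?_
  have he' : η' = ν'.restr η'.lh := (Prod.ext_iff.1 he).1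
  rw [he']
  exact FinSeq.restr_le _ _

theorem forces_of_restr_mem {n : ℕ} {A : Set (FinSeq H)} {p : Q}
    (h : ∀ r, p ≤ r → ∃ s, r ≤ s ∧ ∃ η : FinSeq H, n ≤ η.lh ∧ η.restr n ∈ A ∧ s ∈ (τ.value {η}).1) :
    τ.Forces p A := by
  refine τ.mem_value_iff_singleton.2 fun r hr => ?_
  obtain ⟨s, hs, η, -, hη, h'⟩ := h r hr
  exact ⟨s, hs, _, hη, τ.value_anti (FinSeq.restr_le η n) h'⟩

/-- Below every condition, some initial segment of the named real can be freely extended. -/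
def Projects : Prop :=
  ∀ p : Q, ∃ η : FinSeq H, ∀ ν, η ≤ ν → ∃ q, p ≤ q ∧ q ∈ (τ.value {ν}).1

/-! ### Boolean values of open sets of Cohen conditions -/

variable {τ}

/-- A free node can be prolonged beyond the length of η; since `p` already decides η, the prolonged
node must extend it. -/
theorem Projects.exists_above (hτ : τ.Projects) (hH : ∀ i, 0 < H i) {p : Q} {η : FinSeq H}
    (hp : p ∈ (τ.value {η}).1) :
    ∃ ν, η ≤ ν ∧ ∀ ν', ν ≤ ν' → ∃ q, p ≤ q ∧ q ∈ (τ.value {ν'}).1 := by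
  obtain ⟨ζ, hζ⟩ := hτ p
  obtain ⟨ν, h1, h2, -⟩ := FinSeq.exists_le_avoids (E := fun _ => ∅) ζ
    (fun i _ => ⟨0, hH i, Finset.notMem_empty 0⟩) η.lh
  obtain ⟨q, hq, hqν⟩ := hζ ν h1
  exact ⟨ν, τ.le_of_mem_value ((τ.value {η}).mem_of_le hp hq) hqν h2,
    fun ν' h => hζ ν' (h1.trans h)⟩

/-- Regularizing adds only nodes above which `A` is dense, and above a free node of a condition that
density can be realized by strengthening the condition. -/
theorem Projects.value_regularize (hτ : τ.Projects) (hH : ∀ i, 0 < H i) {A : Set (FinSeq H)}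
    (hA : ∀ η ∈ A, ∀ ν, η ≤ ν → ν ∈ A) : τ.value (regularize A) = τ.value A := by
  refine RO.ext_mem fun p => ⟨fun hp => ?_, fun hp => τ.value_mono (subset_regularize hA) hp⟩
  refine τ.mem_value_iff_singleton.2 fun r hr => ?_
  obtain ⟨s, hs, η, hη, hsη⟩ := τ.mem_value_iff_singleton.1 hp r hr
  obtain ⟨ν, hν, hν'⟩ := hτ.exists_above hH hsη
  obtain ⟨ν', h1, h2⟩ := hη ν hν
  obtain ⟨q, hq, hq'⟩ := hν' ν' h1
  exact ⟨q, hs.trans hq, ν', h2, hq'⟩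

theorem value_cone (η : FinSeq H) : τ.value {ν | η ≤ ν} = τ.value {η} := by
  refine RO.ext_mem fun p => ⟨fun hp => ?_,
    fun hp => τ.value_mono (singleton_subset_iff.2 le_rfl) hp⟩
  refine (τ.value {η}).mem_iff.2 fun r hr => ?_
  obtain ⟨s, hs, ν, hν, hsν⟩ := τ.mem_value_iff_singleton.1 hp r hr
  exact ⟨s, hs, τ.value_anti hν hsν⟩

theorem value_generated (A : Set (FinSeq H)) :
    RO.Generated (range fun η : FinSeq H => τ.value {η}) (τ.value A) := by
  have : τ.value A = RO.sup ((fun η => τ.value {η}) '' A) := by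
    refine RO.ext_mem fun p => τ.mem_value_iff_singleton.trans (forall_congr' fun r =>
      forall_congr' fun _ => exists_congr fun s => and_congr_right fun _ => ?_)
    simp
  rw [this]
  refine RO.Generated.sup _ ?_
  rintro _ ⟨η, -, rfl⟩
  exact RO.Generated.basic _ ⟨η, rfl⟩

/-- Two nodes decided by one condition are comparable. Hence if a condition deciding an extension η'
of η also decides a node of V, then V has a member above η'. -/
theorem Projects.value_subset_iff (hne : ∀ η, (τ.value {η}).1.Nonempty) (U V : RO (FinSeq H)) :
    (τ.value U.1).1 ⊆ (τ.value V.1).1 ↔ U.1 ⊆ V.1 := by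
  refine ⟨fun h η hη => V.mem_iff.2 fun η' hη' => ?_, fun h => τ.value_mono h⟩
  obtain ⟨q, hq⟩ := hne η'
  have h1 : q ∈ (τ.value U.1).1 :=
    τ.value_mono (singleton_subset_iff.2 (U.mem_of_le hη hη')) hq
  obtain ⟨s, hs, ν, hν, hsν⟩ := τ.mem_value_iff_singleton.1 (h h1) q le_rfl
  have hsη := (τ.value {η'}).mem_of_le hq hs
  rcases le_total η'.lh ν.lh with hl | hl
  · exact ⟨ν, τ.le_of_mem_value hsη hsν hl, hν⟩
  · exact ⟨η', le_rfl, V.mem_of_le hν (τ.le_of_mem_value hsν hsη hl)⟩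

/-- The essential use of freedom: if no extension of `s` decides a node of U, then no node above a
free node of `s` belongs to U, so that free node lies in the complement. -/
theorem Projects.value_compl (hτ : τ.Projects) (hH : ∀ i, 0 < H i) (U : RO (FinSeq H)) :
    τ.value (RO.compl U).1 = RO.compl (τ.value U.1) := by
  have h1 : τ.value (RO.compl U).1 = τ.value {η | ∀ ν, η ≤ ν → ν ∉ U.1} :=
    hτ.value_regularize hH fun η hη ν hν ζ hζ => hη ζ (hν.trans hζ)
  rw [h1]
  refine RO.ext_mem fun p => ⟨fun hp r hr => ?_, fun hp => ?_⟩
  · obtain ⟨s, hs, η, hη, hsη⟩ := τ.mem_value_iff_singleton.1 hp r hr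
    refine ⟨s, hs, fun t ht htU => ?_⟩
    obtain ⟨t', ht', ν, hν, htν⟩ := τ.mem_value_iff_singleton.1 htU t le_rfl
    have htη := (τ.value {η}).mem_of_le hsη (ht.trans ht')
    rcases le_total η.lh ν.lh with hl | hl
    · exact hη ν (τ.le_of_mem_value htη htν hl) hν
    · exact hη η le_rfl (U.mem_of_le hν (τ.le_of_mem_value htν htη hl))
  · refine τ.mem_value_iff_singleton.2 fun r hr => ?_
    obtain ⟨s, hs, hs'⟩ := hp r hr
    obtain ⟨η, hη⟩ := hτ s
    obtain ⟨t, ht, htη⟩ := hη η le_rfl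
    refine ⟨t, hs.trans ht, η, fun ν hν hνU => ?_, htη⟩
    obtain ⟨t', ht', htν⟩ := hη ν hν
    exact hs' t' ht' (τ.value_mono (singleton_subset_iff.2 hνU) htν)

/-- The values of regular open sets contain the generators and are closed under complements and
suprema, so they exhaust the generated subalgebra. -/
theorem Projects.exists_value_eq (hτ : τ.Projects) (hH : ∀ i, 0 < H i) {b : RO Q}
    (hb : RO.Generated (range fun η : FinSeq H => τ.value {η}) b) :
    ∃ U : RO (FinSeq H), τ.value U.1 = b := by
  induction hb with
  | basic b hb =>
    obtain ⟨η, rfl⟩ := hb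
    exact ⟨RO.of {ν | η ≤ ν}, (hτ.value_regularize hH fun ν hν ζ hζ =>
      le_trans (a := η) hν hζ).trans (value_cone η)⟩
  | compl b _ ih =>
    obtain ⟨U, rfl⟩ := ih
    exact ⟨RO.compl U, hτ.value_compl hH U⟩
  | sup S _ ih =>
    refine ⟨RO.sup {U | τ.value U.1 ∈ S}, ?_⟩
    have h1 : τ.value (RO.sup {U : RO (FinSeq H) | τ.value U.1 ∈ S}).1 =
        τ.value {η | ∃ U ∈ {U : RO (FinSeq H) | τ.value U.1 ∈ S}, η ∈ U.1} :=
      hτ.value_regularize hH fun η ⟨U, hU, hη⟩ ν hν => ⟨U, hU, U.mem_of_le hη hν⟩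
    rw [h1]
    refine RO.ext_mem fun p => ⟨fun hp r hr => ?_, fun hp => ?_⟩
    · obtain ⟨s, hs, η, ⟨U, hU, hη⟩, hsη⟩ := τ.mem_value_iff_singleton.1 hp r hr
      exact ⟨s, hs, _, hU, τ.value_mono (singleton_subset_iff.2 hη) hsη⟩
    · refine τ.mem_value_iff_singleton.2 fun r hr => ?_
      obtain ⟨s, hs, b, hb, hsb⟩ := hp r hr
      obtain ⟨U, rfl⟩ := ih b hb
      obtain ⟨t, ht, η, hη, htη⟩ := τ.mem_value_iff_singleton.1 hsb s le_rfl
      exact ⟨t, hs.trans ht, η, ⟨U, hb, hη⟩, htη⟩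

theorem Projects.mapsOnto (hτ : τ.Projects) (hH : ∀ i, 0 < H i)
    (hne : ∀ η, (τ.value {η}).1.Nonempty) : MapsOnto (fun η : FinSeq H => η) τ := by
  let f : RO (FinSeq H) ↪o
      {b : RO Q // RO.Generated (range fun η : FinSeq H => τ.value {η}) b} :=
    OrderEmbedding.ofMapLEIff (fun U => ⟨τ.value U.1, value_generated U.1⟩)
      fun U V => Projects.value_subset_iff hne U V
  have hf : Function.Surjective f := by
    rintro ⟨b, hb⟩
    obtain ⟨U, rfl⟩ := hτ.exists_value_eq hH hb
    exact ⟨U, rfl⟩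
  refine ⟨RelIso.ofSurjective f hf, fun η => ?_⟩
  exact (hτ.value_regularize hH fun ν hν ζ hζ => le_trans (a := η) hν hζ).trans (value_cone η)

end StandardName

end names

/-! ## The Cohen forcing -/

theorem cohen_souslinCCC : SouslinCCC cohenCode where
  injective η ν h := Subtype.ext (Encodable.encode_injective (congrFun h 0))
  analytic_conditions := (countable_range _).measurableSet.analyticSet
  analytic_le := by
    refine (Set.Countable.measurableSet ?_).analyticSet
    refine (countable_range fun z : Cohen × Cohen => (cohenCode z.1, cohenCode z.2)).mono ?_
    rintro _ ⟨p, q, -, rfl⟩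
    exact ⟨(p, q), rfl⟩
  analytic_incompat := by
    refine (Set.Countable.measurableSet ?_).analyticSet
    refine (countable_range fun z : Cohen × Cohen => (cohenCode z.1, cohenCode z.2)).mono ?_
    rintro _ ⟨p, q, -, rfl⟩
    exact ⟨(p, q), rfl⟩
  ccc _ _ := Set.to_countable _

theorem cohen_isGenericRealName : IsGenericRealName (fun _ => 2) (fun η : Cohen => η) where
  bot := rfl
  mono _ _ h := h
  succ_incompat η ν ν' _ _ h1 h2 hne := by
    rintro ⟨r, hr, hr'⟩
    exact hne (FinSeq.eq_of_le_of_lh_le (FinSeq.le_total_of_le hr hr' (by omega)) (by omega))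
  succ_maximal η r h := by
    by_cases hl : η.lh < r.lh
    · exact ⟨r.restr (η.lh + 1), FinSeq.le_total_of_le h (FinSeq.restr_le _ _)
        (by rw [FinSeq.lh_restr]; omega), by rw [FinSeq.lh_restr]; omega,
        r, le_rfl, FinSeq.restr_le _ _⟩
    · obtain rfl := FinSeq.eq_of_le_of_lh_le h (not_lt.1 hl)
      exact ⟨η.snoc 0 two_pos, FinSeq.le_snoc _ _ _, FinSeq.lh_snoc _ _ _, _,
        FinSeq.le_snoc _ _ _, le_rfl⟩
  splits p := by
    refine ⟨p.snoc 0 two_pos, p.snoc 1 one_lt_two, by simp, fun h => ?_,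
      ⟨_, FinSeq.le_snoc _ _ _, le_rfl⟩, ⟨_, FinSeq.le_snoc _ _ _, le_rfl⟩⟩
    have := congrArg Subtype.val h
    simp at this
  separates p q h := ⟨p, ⟨p, le_rfl, le_rfl⟩, fun h' => h h'.symm⟩

/-! ## Finite sets of nodes that cannot be hit -/

section combinatorics

theorem mod_two_pow_succ (t a : ℕ) :
    t % 2 ^ (a + 1) = t % 2 ^ a ∨ t % 2 ^ (a + 1) = t % 2 ^ a + 2 ^ a := by
  rw [Nat.mod_pow_succ]
  rcases Nat.mod_two_eq_zero_or_one (t / 2 ^ a) with h | h <;> rw [h] <;> simp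

theorem exists_forall_le_of_bounded {f : ℕ → ℕ} {C : ℕ} (h : ∀ a, f a ≤ C) :
    ∃ a₀, ∀ a, f a ≤ f a₀ := by
  by_contra! hc
  have : ∀ n, ∃ a, n ≤ f a := by
    intro n
    induction n with
    | zero => exact ⟨0, Nat.zero_le _⟩
    | succ n ih =>
      obtain ⟨a, ha⟩ := ih
      obtain ⟨a', ha'⟩ := hc a
      exact ⟨a', by omega⟩
  obtain ⟨a, ha⟩ := this (C + 1)
  have := h a
  omega

open scoped Classical in
/-- The nodes of level `a` with an extension in `U b` for most `b`. -/
noncomputable def limitNodes (U : ℕ → Finset ℕ) (a : ℕ) : Finset ℕ :=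
  (Finset.range (2 ^ a)).filter fun s => ∀ᶠ b in (hyperfilter ℕ : Filter ℕ), ∃ t ∈ U b, t % 2 ^ a = s

theorem mem_limitNodes {U : ℕ → Finset ℕ} {a s : ℕ} : s ∈ limitNodes U a ↔
    s < 2 ^ a ∧ ∀ᶠ b in (hyperfilter ℕ : Filter ℕ), ∃ t ∈ U b, t % 2 ^ a = s := by
  simp [limitNodes]

/-- A level is finite, so a single b witnesses all its limit nodes at once; each of them is then the
restriction of a member of `U b`. -/
theorem card_limitNodes_le {U : ℕ → Finset ℕ} {C : ℕ} (hU : ∀ b, (U b).card ≤ C) (a : ℕ) :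
    (limitNodes U a).card ≤ C := by
  have h : ∀ᶠ b in (hyperfilter ℕ : Filter ℕ), ∀ s ∈ limitNodes U a, ∃ t ∈ U b, t % 2 ^ a = s :=
    (Filter.eventually_all_finset _).2 fun s hs => (mem_limitNodes.1 hs).2
  obtain ⟨b, hb⟩ := h.exists
  have : limitNodes U a ⊆ (U b).image (· % 2 ^ a) := fun s hs => Finset.mem_image.2 (hb s hs)
  exact (Finset.card_le_card this).trans (Finset.card_image_le.trans (hU b))

/-- Here an ultrafilter is needed: if most b see an extension of s, then most b see one through the
same successor of s. -/
theorem exists_limitNodes_succ {U : ℕ → Finset ℕ} {a s : ℕ} (hs : s ∈ limitNodes U a) :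
    s ∈ limitNodes U (a + 1) ∨ s + 2 ^ a ∈ limitNodes U (a + 1) := by
  obtain ⟨h1, h2⟩ := mem_limitNodes.1 hs
  have h3 : ∀ᶠ b in (hyperfilter ℕ : Filter ℕ), (∃ t ∈ U b, t % 2 ^ (a + 1) = s) ∨
      ∃ t ∈ U b, t % 2 ^ (a + 1) = s + 2 ^ a := by
    filter_upwards [h2] with b ⟨t, ht, hts⟩
    rcases mod_two_pow_succ t a with h | h
    · exact Or.inl ⟨t, ht, by rw [h, hts]⟩
    · exact Or.inr ⟨t, ht, by rw [h, hts]⟩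
  rw [Ultrafilter.eventually_or] at h3
  simp only [mem_limitNodes, pow_succ]
  rcases h3 with h | h
  · exact Or.inl ⟨by omega, by simpa only [pow_succ] using h⟩
  · exact Or.inr ⟨by omega, by simpa only [pow_succ] using h⟩

theorem card_limitNodes_mono (U : ℕ → Finset ℕ) (a : ℕ) :
    (limitNodes U a).card ≤ (limitNodes U (a + 1)).card := by
  have : limitNodes U a ⊆ (limitNodes U (a + 1)).image (· % 2 ^ a) := by
    intro s hs
    have h1 := (mem_limitNodes.1 hs).1
    rcases exists_limitNodes_succ hs with h | h
    · exact Finset.mem_image.2 ⟨s, h, Nat.mod_eq_of_lt h1⟩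
    · exact Finset.mem_image.2 ⟨_, h, by simp [Nat.mod_eq_of_lt h1]⟩
  exact (Finset.card_le_card this).trans Finset.card_image_le

/-- Even without one of the two successors of s, the limit nodes of level a + 1 project onto those
of level a. -/
theorem card_limitNodes_lt {U : ℕ → Finset ℕ} {a s : ℕ} (hs : s < 2 ^ a)
    (h0 : s ∈ limitNodes U (a + 1)) (h1 : s + 2 ^ a ∈ limitNodes U (a + 1)) :
    (limitNodes U a).card < (limitNodes U (a + 1)).card := by
  have : limitNodes U a ⊆ ((limitNodes U (a + 1)).erase (s + 2 ^ a)).image (· % 2 ^ a) := by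
    intro r hr
    have hr1 := (mem_limitNodes.1 hr).1
    by_cases hrs : r = s
    · subst hrs
      exact Finset.mem_image.2 ⟨r, Finset.mem_erase.2
        ⟨by have := Nat.two_pow_pos a; omega, h0⟩, Nat.mod_eq_of_lt hr1⟩
    · rcases exists_limitNodes_succ hr with h | h
      · exact Finset.mem_image.2 ⟨r, Finset.mem_erase.2 ⟨by omega, h⟩, Nat.mod_eq_of_lt hr1⟩
      · exact Finset.mem_image.2 ⟨_, Finset.mem_erase.2 ⟨by omega, h⟩,
          by simp [Nat.mod_eq_of_lt hr1]⟩
  exact ((Finset.card_le_card this).trans Finset.card_image_le).trans_lt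
    (Finset.card_erase_lt_of_mem h1)

/-- If the sets `U b` have bounded size then at almost all levels no node has extensions in `U b`
on both sides for almost all `b`. -/
theorem exists_forall_avoided {U : ℕ → Finset ℕ} {C : ℕ} (hU : ∀ b, (U b).card ≤ C) :
    ∃ a₀, ∀ a, a₀ ≤ a → ∀ s < 2 ^ a, ∃ z, (z = s ∨ z = s + 2 ^ a) ∧
      ∃ b, a + 1 ≤ b ∧ ∀ t ∈ U b, t % 2 ^ (a + 1) ≠ z := by
  obtain ⟨a₀, ha₀⟩ := exists_forall_le_of_bounded (card_limitNodes_le hU)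
  have hmono : Monotone fun a => (limitNodes U a).card :=
    monotone_nat_of_le_succ (card_limitNodes_mono U)
  refine ⟨a₀, fun a ha s hs => ?_⟩
  -- Beyond a₀ the number of limit nodes is maximal, so no node has two limit successors.
  have key : ∃ z, (z = s ∨ z = s + 2 ^ a) ∧ z ∉ limitNodes U (a + 1) := by
    by_contra! hc
    have h1 := card_limitNodes_lt hs (hc s (Or.inl rfl)) (hc _ (Or.inr rfl))
    have h2 := ha₀ (a + 1)
    have h3 : (limitNodes U a₀).card ≤ (limitNodes U a).card := hmono ha
    omega
  obtain ⟨z, hz, hzU⟩ := key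
  refine ⟨z, hz, ?_⟩
  have hz' : z < 2 ^ (a + 1) := by
    rw [pow_succ]
    omega
  have h1 : ¬ ∀ᶠ b in (hyperfilter ℕ : Filter ℕ), ∃ t ∈ U b, t % 2 ^ (a + 1) = z :=
    fun h => hzU (mem_limitNodes.2 ⟨hz', h⟩)
  rw [← Ultrafilter.eventually_not] at h1
  -- As the ultrafilter is nonprincipal, the most b for which z has no extension in `U b` include
  -- one with b ≥ a + 1.
  have h2 : ∀ᶠ b in (hyperfilter ℕ : Filter ℕ), a + 1 ≤ b :=
    Nat.hyperfilter_le_atTop (eventually_ge_atTop (a + 1))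
  obtain ⟨b, hb1, hb2⟩ := (h1.and h2).exists
  exact ⟨b, hb2, fun t ht htz => hb1 ⟨t, ht, htz⟩⟩

end combinatorics

/-! ## Reading a Cohen real from the generic sequence -/

section reading

/-- The level of the tree `2^{<ω}` to which the coordinate `i` is devoted. -/
def hitLevel (i : ℕ) : ℕ := i.unpair.1

theorem hitLevel_le (i : ℕ) : hitLevel i ≤ i := Nat.unpair_left_le i

theorem exists_hitLevel_eq (b n : ℕ) : ∃ i, n ≤ i ∧ hitLevel i = b :=
  ⟨Nat.pair b n, Nat.right_le_pair b n, by simp [hitLevel]⟩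

/-- All nodes of some level that extend the node `z` of level `n` have been hit from the coordinate
`a` on. A node of level `b` is represented by a number below `2 ^ b`; its predecessor of level `n`
is its remainder modulo `2 ^ n`. -/
def Kills (M : ℕ → ℕ) (v : List ℕ) (a n z : ℕ) : Prop :=
  ∃ b, n ≤ b ∧ ∀ t < 2 ^ b, t % 2 ^ n = z →
    ∃ j, a ≤ j ∧ hitLevel j = b ∧ ∃ c, v[j]? = some c ∧ c / M j = t

/-- Of any two neighbours of level `a + 1` one has been killed. -/
def Active (M : ℕ → ℕ) (v : List ℕ) (a : ℕ) : Prop :=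
  ∀ s < 2 ^ a, Kills M v a (a + 1) s ∨ Kills M v a (a + 1) (s + 2 ^ a)

/-- The value `c` at the coordinate `i` makes the machine emit a bit. -/
def Declares (M : ℕ → ℕ) (i c : ℕ) : Prop := 2 ^ hitLevel i * M i ≤ c ∧ c % 3 ≠ 0

open scoped Classical in
/-- The emitted bits, with both sequences in reverse order. -/
noncomputable def emitRev (M : ℕ → ℕ) : List ℕ → List ℕ
  | [] => []
  | c :: l => if Declares M l.length c then
      (if c % 3 = 2 ∧ Active M l.reverse (emitRev M l).length then 1 else 0) :: emitRev M l
    else emitRev M l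

/-- The bits emitted when reading the sequence `v`. -/
noncomputable def emit (M : ℕ → ℕ) (v : List ℕ) : List ℕ := (emitRev M v.reverse).reverse

variable {M : ℕ → ℕ}

@[simp] theorem emit_nil : emit M [] = [] := rfl

open scoped Classical in
theorem emit_snoc (v : List ℕ) (c : ℕ) : emit M (v ++ [c]) =
    if Declares M v.length c then
      emit M v ++ [if c % 3 = 2 ∧ Active M v (emit M v).length then 1 else 0]
    else emit M v := by
  simp only [emit, List.reverse_append, List.reverse_singleton, List.singleton_append, emitRev,
    List.length_reverse, List.reverse_reverse]
  split_ifs <;> simp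

theorem emit_snoc_of_not_declares {v : List ℕ} {c : ℕ} (h : ¬ Declares M v.length c) :
    emit M (v ++ [c]) = emit M v := by
  rw [emit_snoc, if_neg h]

theorem emit_prefix_snoc (v : List ℕ) (c : ℕ) : emit M v <+: emit M (v ++ [c]) := by
  classical
  rw [emit_snoc]
  split_ifs <;> simp

theorem emit_mono {v w : List ℕ} (h : v <+: w) : emit M v <+: emit M w := by
  obtain ⟨t, rfl⟩ := h
  induction t using List.reverseRecOn with
  | nil => simp
  | append_singleton t c ih =>
    rw [← List.append_assoc]
    exact ih.trans (emit_prefix_snoc _ _)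

/-- Each coordinate emits at most one bit. So when a bits have been emitted, later hits happen at
coordinates ≥ a and count in `Kills`. -/
theorem length_emit_le (v : List ℕ) : (emit M v).length ≤ v.length := by
  classical
  induction v using List.reverseRecOn with
  | nil => simp
  | append_singleton v c ih =>
    rw [emit_snoc]
    split_ifs <;> simp <;> omega

theorem lt_two_of_mem_emit {v : List ℕ} {a : ℕ} (h : a ∈ emit M v) : a < 2 := by
  classical
  induction v using List.reverseRecOn with
  | nil => simp at h
  | append_singleton v c ih =>
    rw [emit_snoc] at h
    split_ifs at h
    · simp only [List.mem_append, List.mem_singleton] at h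
      rcases h with h | h
      exacts [ih h, by omega]
    · simp only [List.mem_append, List.mem_singleton] at h
      rcases h with h | h
      exacts [ih h, by omega]
    · exact ih h

/-- A bit `1` is emitted at the place `m` only in an active situation. -/
theorem exists_active_of_emit {v : List ℕ} {m : ℕ} (h : (emit M v)[m]? = some 1) :
    ∃ u, u <+: v ∧ Active M u m := by
  classical
  induction v using List.reverseRecOn with
  | nil => simp at h
  | append_singleton v c ih =>
    by_cases hm : (emit M v)[m]? = some 1
    · obtain ⟨u, hu, hu'⟩ := ih hm
      exact ⟨u, hu.trans (List.prefix_append _ _), hu'⟩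
    · rw [emit_snoc] at h
      split_ifs at h with h1 h2
      · rw [List.getElem?_append] at h
        split_ifs at h with h3
        · exact absurd h hm
        · have h4 := (List.getElem?_eq_some_iff.1 h).1
          simp only [List.length_singleton] at h4
          have : m = (emit M v).length := by omega
          rw [this]
          exact ⟨v, List.prefix_append _ _, h2.2⟩
      · rw [List.getElem?_append] at h
        split_ifs at h with h3
        · exact absurd h hm
        · have h4 := (List.getElem?_eq_some_iff.1 h).2
          simp at h4
      · exact absurd h hm

theorem Kills.mono {v w : List ℕ} (h : v <+: w) {a n z : ℕ} (hk : Kills M v a n z) :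
    Kills M w a n z := by
  obtain ⟨b, hb, hb'⟩ := hk
  refine ⟨b, hb, fun t ht htz => ?_⟩
  obtain ⟨j, hj, hjb, c, hc, hct⟩ := hb' t ht htz
  refine ⟨j, hj, hjb, c, ?_, hct⟩
  obtain ⟨l, rfl⟩ := h
  rw [List.getElem?_append_left (List.getElem?_eq_some_iff.1 hc).1, hc]

/-! ### Controlling the emitted bits while avoiding a slalom -/

variable {H : ℕ → ℕ}

/-- The sequence of bits read from a finite sequence. -/
noncomputable def readBits (M : ℕ → ℕ) (v : FinSeq H) : Cohen :=
  ⟨emit M v.1, fun _ _ => lt_two_of_mem_emit (List.getElem_mem _)⟩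

theorem readBits_mono {v w : FinSeq H} (h : v ≤ w) : readBits M v ≤ readBits M w := emit_mono h

/-- From `n` on, there is room outside `E` and the hits for values with any remainder. -/
def Room (H M : ℕ → ℕ) (E : ℕ → Finset ℕ) (n : ℕ) : Prop :=
  ∀ i, n ≤ i → ∀ r < 3, ∃ c < H i, c % 3 = r ∧ 2 ^ hitLevel i * M i ≤ c ∧ c ∉ E i

theorem Room.mono {E : ℕ → Finset ℕ} {n m : ℕ} (h : Room H M E n) (hnm : n ≤ m) : Room H M E m :=
  fun i hi => h i (hnm.trans hi)

/-- There are |E| + 1 candidates L + d + 3j, where d < 3 adjusts the residue; one of them is outside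
E. -/
theorem exists_mod_three_notMem {E : Finset ℕ} {L h r : ℕ} (hr : r < 3)
    (hL : L + 3 * (E.card + 1) ≤ h) : ∃ c < h, c % 3 = r ∧ L ≤ c ∧ c ∉ E := by
  obtain ⟨d, hd, hd'⟩ : ∃ d < 3, (L + d) % 3 = r := by
    refine ⟨(r + 3 - L % 3) % 3, by omega, by omega⟩
  have hinj : Function.Injective fun j : ℕ => L + d + 3 * j := fun i j hij => by
    simp only at hij
    omega
  obtain ⟨c, hc, hcE⟩ := Finset.exists_mem_notMem_of_card_lt_card (s := E)
    (t := (Finset.range (E.card + 1)).image fun j => L + d + 3 * j)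
    (by rw [Finset.card_image_of_injective _ hinj, Finset.card_range]; omega)
  obtain ⟨j, hj, rfl⟩ := Finset.mem_image.1 hc
  rw [Finset.mem_range] at hj
  exact ⟨_, by omega, by omega, by omega, hcE⟩

/-- Arbitrarily far one can hit the node `t` of level `b` avoiding the slalom. -/
def Fillable (H M : ℕ → ℕ) (E : ℕ → Finset ℕ) (b t : ℕ) : Prop :=
  ∀ n, ∃ i, n ≤ i ∧ hitLevel i = b ∧ ∃ c < H i, c ∉ E i ∧ c / M i = t

/-- At level `a` one can get into an active situation avoiding the slalom. -/
def Free (H M : ℕ → ℕ) (E : ℕ → Finset ℕ) (a : ℕ) : Prop :=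
  ∀ s < 2 ^ a, ∃ z, (z = s ∨ z = s + 2 ^ a) ∧ ∃ b, a + 1 ≤ b ∧
    ∀ t < 2 ^ b, t % 2 ^ (a + 1) = z → Fillable H M E b t

/-- A node that is not fillable has its block swallowed by E(i) at all late coordinates of its
level. The blocks are disjoint and have M(i) elements, so at most C nodes per level are lost, and
`exists_forall_avoided` applies. -/
theorem free_of_card_le (hM : ∀ i, 0 < M i) (hMH : ∀ i, 2 ^ hitLevel i * M i ≤ H i)
    {E : ℕ → Finset ℕ} {C N : ℕ} (hE : ∀ i, N ≤ i → (E i).card ≤ C * M i) :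
    ∃ a₀, ∀ a, a₀ ≤ a → Free H M E a := by
  classical
  let U : ℕ → Finset ℕ := fun b => (Finset.range (2 ^ b)).filter fun t => ¬ Fillable H M E b t
  have hU : ∀ b, (U b).card ≤ C := by
    intro b
    have h1 : ∀ t ∈ U b, ∀ᶠ n in atTop, ∀ i, n ≤ i → hitLevel i = b → ∀ c < H i, c / M i = t →
        c ∈ E i := by
      intro t ht
      have := (Finset.mem_filter.1 ht).2
      simp only [Fillable, not_forall, not_exists, not_and] at this
      obtain ⟨n, hn⟩ := this
      filter_upwards [eventually_ge_atTop n] with m hm i hi hib c hc hct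
      by_contra hcE
      exact hn i (hm.trans hi) hib c hc hcE hct
    -- Finitely many nodes are involved, so one coordinate i serves for all of them.
    obtain ⟨n, hn, hnN⟩ := (((Filter.eventually_all_finset _).2 h1).and
      (eventually_ge_atTop N)).exists
    obtain ⟨i, hi, hib⟩ := exists_hitLevel_eq b n
    have h2 : (U b ×ˢ Finset.range (M i)).card ≤ (E i).card := by
      refine Finset.card_le_card_of_injOn (fun x => x.1 * M i + x.2) ?_ ?_
      · rintro ⟨t, r⟩ htr
        simp only [Finset.coe_product, Finset.coe_range, mem_prod, Finset.mem_coe, mem_Iio] at htr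
        have ht := Finset.mem_range.1 (Finset.mem_filter.1 htr.1).1
        have hdiv : (t * M i + r) / M i = t := by
          rw [mul_comm, Nat.mul_add_div (hM i), Nat.div_eq_of_lt htr.2, add_zero]
        refine hn t htr.1 i hi hib _ ?_ hdiv
        refine lt_of_lt_of_le ?_ (hMH i)
        rw [hib]
        calc t * M i + r < t * M i + M i := by omega
          _ = (t + 1) * M i := by ring
          _ ≤ _ := Nat.mul_le_mul_right _ ht
      · rintro ⟨t, r⟩ htr ⟨t', r'⟩ htr' h
        simp only [Finset.coe_product, Finset.coe_range, mem_prod, Finset.mem_coe, mem_Iio]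
          at htr htr' h
        have h3 := congrArg (· / M i) h
        rw [mul_comm, Nat.mul_add_div (hM i), Nat.div_eq_of_lt htr.2, mul_comm t',
          Nat.mul_add_div (hM i), Nat.div_eq_of_lt htr'.2, add_zero, add_zero] at h3
        subst h3
        simpa using h
    rw [Finset.card_product, Finset.card_range] at h2
    exact Nat.le_of_mul_le_mul_right (h2.trans (hE i (hnN.trans hi))) (hM i)
  obtain ⟨a₀, ha₀⟩ := exists_forall_avoided hU
  refine ⟨a₀, fun a ha s hs => ?_⟩
  obtain ⟨z, hz, b, hb, hb'⟩ := ha₀ a ha s hs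
  refine ⟨z, hz, b, hb, fun t ht htz => ?_⟩
  by_contra hc
  exact hb' t (Finset.mem_filter.2 ⟨Finset.mem_range.2 ht, hc⟩) htz

theorem free_empty (hM : ∀ i, 0 < M i) (hMH : ∀ i, 2 ^ hitLevel i * M i ≤ H i) (a : ℕ) :
    Free H M (fun _ => ∅) a := by
  refine fun s _ => ⟨s, Or.inl rfl, a + 1, le_rfl, fun t ht _ n => ?_⟩
  obtain ⟨i, hi, hib⟩ := exists_hitLevel_eq (a + 1) n
  refine ⟨i, hi, hib, t * M i, lt_of_lt_of_le ?_ (hMH i), Finset.notMem_empty _,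
    Nat.mul_div_cancel _ (hM i)⟩
  rw [hib]
  exact Nat.mul_lt_mul_of_pos_right ht (hM i)

/-- Values divisible by 3 emit nothing. -/
theorem exists_wait {E : ℕ → Finset ℕ} (v : FinSeq H) (hR : Room H M E v.lh) {n : ℕ}
    (hn : v.lh ≤ n) : ∃ w, v ≤ w ∧ w.lh = n ∧ w.Avoids E v.lh ∧ emit M w.1 = emit M v.1 := by
  induction n, hn using Nat.le_induction with
  | base => exact ⟨v, le_rfl, rfl, FinSeq.avoids_of_lh_le le_rfl, rfl⟩
  | succ n hn ih =>
    obtain ⟨w, h1, rfl, h3, h4⟩ := ih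
    obtain ⟨c, hc, hc3, -, hcE⟩ := hR w.lh hn 0 (by norm_num)
    refine ⟨w.snoc c hc, h1.trans (FinSeq.le_snoc _ _ _), by simp, h3.snoc hc hcE, ?_⟩
    rw [FinSeq.snoc_val, emit_snoc_of_not_declares (fun h => h.2 hc3), h4]

/-- The hits are made one by one, with waiting in between. A value that hits a node of level b is
below 2^b·M(i) and so emits nothing. -/
theorem exists_fill (hM : ∀ i, 0 < M i) {E : ℕ → Finset ℕ} (v : FinSeq H) (hR : Room H M E v.lh)
    (T : Finset (ℕ × ℕ)) (hT : ∀ x ∈ T, x.2 < 2 ^ x.1 ∧ Fillable H M E x.1 x.2) :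
    ∃ w, v ≤ w ∧ w.Avoids E v.lh ∧ emit M w.1 = emit M v.1 ∧
      ∀ x ∈ T, ∃ j, v.lh ≤ j ∧ hitLevel j = x.1 ∧ ∃ c, w.1[j]? = some c ∧ c / M j = x.2 := by
  classical
  induction T using Finset.induction_on with
  | empty => exact ⟨v, le_rfl, FinSeq.avoids_of_lh_le le_rfl, rfl, by simp⟩
  | insert x T hx ih =>
    obtain ⟨w, h1, h2, h3, h4⟩ := ih fun y hy => hT y (Finset.mem_insert_of_mem hy)
    obtain ⟨hx1, hx2⟩ := hT x (Finset.mem_insert_self x T)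
    obtain ⟨i, hi, hib, c, hc, hcE, hct⟩ := hx2 w.lh
    obtain ⟨u, hu1, rfl, hu3, hu4⟩ := exists_wait w (hR.mono (FinSeq.lh_mono h1)) hi
    have hvu := h1.trans hu1
    refine ⟨u.snoc c hc, hvu.trans (FinSeq.le_snoc _ _ _),
      (h2.trans hu1 hu3).snoc hc hcE, ?_, fun y hy => ?_⟩
    · rw [FinSeq.snoc_val, emit_snoc_of_not_declares (fun h => ?_), hu4, h3]
      have := h.1
      change 2 ^ hitLevel u.lh * M u.lh ≤ c at this
      rw [hib, Nat.mul_comm, ← not_lt, mul_comm, ← Nat.div_lt_iff_lt_mul (hM _), hct] at this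
      exact this hx1
    · rcases Finset.mem_insert.1 hy with rfl | hy
      · refine ⟨u.lh, FinSeq.lh_mono hvu, hib, c, ?_, hct⟩
        simp [FinSeq.lh]
      · obtain ⟨j, hj, hjb, d, hd, hdt⟩ := h4 y hy
        refine ⟨j, hj, hjb, d, ?_, hdt⟩
        rw [FinSeq.getElem?_of_le (hu1.trans (FinSeq.le_snoc u c hc))
          (List.getElem?_eq_some_iff.1 hd).1, hd]

theorem exists_active (hM : ∀ i, 0 < M i) {E : ℕ → Finset ℕ} (v : FinSeq H)
    (hR : Room H M E v.lh) (hF : Free H M E (emit M v.1).length) :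
    ∃ w, v ≤ w ∧ w.Avoids E v.lh ∧ emit M w.1 = emit M v.1 ∧
      Active M w.1 (emit M v.1).length := by
  classical
  set a := (emit M v.1).length
  have hav : a ≤ v.lh := length_emit_le v.1
  choose! z hz b hb hF using hF
  obtain ⟨w, h1, h2, h3, h4⟩ := exists_fill hM v hR
    ((Finset.range (2 ^ a)).biUnion fun s => ((Finset.range (2 ^ b s)).filter
      fun t => t % 2 ^ (a + 1) = z s).image fun t => (b s, t)) (by
    intro x hx
    simp only [Finset.mem_biUnion, Finset.mem_image, Finset.mem_filter, Finset.mem_range] at hx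
    obtain ⟨s, hs, t, ⟨ht, htz⟩, rfl⟩ := hx
    exact ⟨ht, hF s hs t ht htz⟩)
  refine ⟨w, h1, h2, h3, fun s hs => ?_⟩
  have : Kills M w.1 a (a + 1) (z s) := by
    refine ⟨b s, hb s hs, fun t ht htz => ?_⟩
    obtain ⟨j, hj, hjb⟩ := h4 (b s, t) (by
      simp only [Finset.mem_biUnion, Finset.mem_image, Finset.mem_filter, Finset.mem_range]
      exact ⟨s, hs, t, ⟨ht, htz⟩, rfl⟩)
    exact ⟨j, hav.trans hj, hjb⟩
  rcases hz s hs with h | h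
  · exact Or.inl (h ▸ this)
  · exact Or.inr (h ▸ this)

theorem exists_emit_bit (hM : ∀ i, 0 < M i) {E : ℕ → Finset ℕ} (v : FinSeq H)
    (hR : Room H M E v.lh) (hF : Free H M E (emit M v.1).length) {d : ℕ} (hd : d < 2) :
    ∃ w, v ≤ w ∧ w.Avoids E v.lh ∧ emit M w.1 = emit M v.1 ++ [d] := by
  classical
  obtain ⟨w, h1, h2, h3, h4⟩ := exists_active hM v hR hF
  -- Residue 1 emits the bit 0, and residue 2 emits the bit 1 in an active situation.
  obtain ⟨c, hc, hc3, hcM, hcE⟩ := hR w.lh (FinSeq.lh_mono h1) (d + 1) (by omega)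
  refine ⟨w.snoc c hc, h1.trans (FinSeq.le_snoc _ _ _), h2.snoc hc hcE, ?_⟩
  rw [FinSeq.snoc_val, emit_snoc, if_pos ⟨hcM, by omega⟩, h3]
  congr 2
  by_cases hd1 : d = 1
  · rw [if_pos ⟨by omega, h4⟩, hd1]
  · rw [if_neg (fun h => by omega)]
    omega

theorem exists_readBits_eq (hM : ∀ i, 0 < M i) {E : ℕ → Finset ℕ} (v : FinSeq H)
    (hR : Room H M E v.lh) (hF : ∀ a, (emit M v.1).length ≤ a → Free H M E a) {η : Cohen}
    (hη : readBits M v ≤ η) : ∃ w, v ≤ w ∧ w.Avoids E v.lh ∧ readBits M w = η := by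
  obtain ⟨η, hη2⟩ := η
  obtain ⟨t, rfl⟩ := hη
  induction t using List.reverseRecOn with
  | nil => exact ⟨v, le_rfl, FinSeq.avoids_of_lh_le le_rfl, Subtype.ext (by simp [readBits])⟩
  | append_singleton t d ih =>
    have hlt : ∀ e ∈ (readBits M v).1 ++ (t ++ [d]), e < 2 := fun e he => by
      obtain ⟨i, hi, rfl⟩ := List.getElem_of_mem he
      exact hη2 i hi
    obtain ⟨w, h1, h2, h3⟩ := ih fun i hi => hlt _ (by
      rw [← List.append_assoc]
      exact List.mem_append_left _ (List.getElem_mem _))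
    have h3' : emit M w.1 = (readBits M v).1 ++ t := congrArg Subtype.val h3
    obtain ⟨u, hu1, hu2, hu3⟩ := exists_emit_bit hM w (hR.mono (FinSeq.lh_mono h1))
      (hF _ (List.IsPrefix.length_le (emit_mono h1))) (hlt d (by simp))
    refine ⟨u, h1.trans hu1, h2.trans hu1 hu2, Subtype.ext ?_⟩
    change emit M u.1 = _
    rw [hu3, h3', List.append_assoc]

/-- One can always get arbitrarily many bits emitted, by declaring zeros. -/
theorem exists_long_read {E : ℕ → Finset ℕ} (v : FinSeq H) (hR : Room H M E v.lh) (n : ℕ) :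
    ∃ w, v ≤ w ∧ w.Avoids E v.lh ∧ n ≤ (emit M w.1).length := by
  classical
  induction n with
  | zero => exact ⟨v, le_rfl, FinSeq.avoids_of_lh_le le_rfl, Nat.zero_le _⟩
  | succ n ih =>
    obtain ⟨w, h1, h2, h3⟩ := ih
    obtain ⟨c, hc, hc3, hcM, hcE⟩ := hR w.lh (FinSeq.lh_mono h1) 1 (by norm_num)
    refine ⟨w.snoc c hc, h1.trans (FinSeq.le_snoc _ _ _), h2.snoc hc hcE, ?_⟩
    rw [FinSeq.snoc_val, emit_snoc, if_pos ⟨hcM, by omega⟩]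
    simp
    omega

end reading

/-! ## Standard names from readings of the generic sequence -/

section fronts

variable {H : ℕ → ℕ}

theorem FinSeq.exists_eq_snoc {v : FinSeq H} (h : 0 < v.lh) :
    ∃ (u : FinSeq H) (a : ℕ) (ha : a < H u.lh), v = u.snoc a ha := by
  obtain ⟨l, hl⟩ := v
  rcases List.eq_nil_or_concat' l with rfl | ⟨l', a, rfl⟩
  · simp [FinSeq.lh] at h
  · have h1 : ∀ (i : ℕ) (hi : i < l'.length), l'[i] < H i := fun i hi => by
      have := hl i (by simp; omega)
      rwa [List.getElem_append_left hi] at this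
    have h2 : a < H l'.length := by
      have := hl l'.length (by simp)
      simpa using this
    exact ⟨⟨l', h1⟩, a, h2, rfl⟩

/-- `v` belongs to the `n`-th front for the reading `R`: at least `n` bits are read from `v`, and
less than `n` bits from its predecessor unless the last value is `0`. -/
def IsFront (R : FinSeq H → Cohen) (n : ℕ) (v : FinSeq H) : Prop :=
  n ≤ (R v).lh ∧ ∀ (u : FinSeq H) (a : ℕ) (ha : a < H u.lh), v = u.snoc a ha →
    a = 0 ∨ (R u).lh < n

/-- Shorten v as long as its last value is not 0 and its predecessor still yields n bits; no 0 is
removed on the way. -/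
theorem exists_isFront_le {R : FinSeq H → Cohen} {n : ℕ} {v : FinSeq H} (h : n ≤ (R v).lh) :
    ∃ u, u ≤ v ∧ IsFront R n u ∧ v.Avoids (fun _ => {0}) u.lh := by
  induction hl : v.lh generalizing v with
  | zero =>
    exact ⟨v, le_rfl, ⟨h, fun u a ha hv => by rw [hv, FinSeq.lh_snoc] at hl; omega⟩,
      FinSeq.avoids_of_lh_le le_rfl⟩
  | succ m ih =>
    obtain ⟨u, a, ha, rfl⟩ := FinSeq.exists_eq_snoc (by omega : 0 < v.lh)
    by_cases hf : a = 0 ∨ (R u).lh < n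
    · refine ⟨_, le_rfl, ⟨h, fun u' a' ha' he => ?_⟩, FinSeq.avoids_of_lh_le le_rfl⟩
      have he' := congrArg Subtype.val he
      simp only [FinSeq.snoc_val] at he'
      obtain ⟨h1, h2⟩ := List.append_inj' he' rfl
      obtain rfl : u = u' := Subtype.ext h1
      obtain rfl : a = a' := by simpa using h2
      exact hf
    · rw [not_or, not_lt] at hf
      rw [FinSeq.lh_snoc] at hl
      obtain ⟨u', h1, h2, h3⟩ := ih hf.2 (by omega)
      exact ⟨u', h1.trans (FinSeq.le_snoc _ _ _), h2,
        h3.snoc ha (by simpa using hf.1)⟩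

/-- If v were longer, its last value would not be 0, so its predecessor would yield fewer than n
bits, although it extends u. -/
theorem IsFront.eq_of_le {R : FinSeq H → Cohen} (hR : Monotone R) {n : ℕ} {u v : FinSeq H}
    (hu : IsFront R n u) (hv : IsFront R n v) (huv : u ≤ v)
    (hav : v.Avoids (fun _ => {0}) u.lh) : u = v := by
  by_contra hne
  have hl : u.lh < v.lh := by
    by_contra hl
    exact hne (FinSeq.eq_of_le_of_lh_le huv (not_lt.1 hl))
  obtain ⟨v', a, ha, rfl⟩ := FinSeq.exists_eq_snoc (by omega : 0 < v.lh)
  rw [FinSeq.lh_snoc] at hl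
  have h1 : u ≤ v' := FinSeq.le_total_of_le huv (FinSeq.le_snoc _ _ _) (by omega)
  rcases hv.2 v' a ha rfl with h | h
  · exact hav v'.lh a (by omega) (by simp [FinSeq.lh]) (by simp [h])
  · have := hu.1.trans (FinSeq.lh_mono (hR h1))
    omega

/-- The stems deciding that `η` is an initial segment of the bits read. -/
def frontStems (R : FinSeq H → Cohen) (η : Cohen) : Set (FinSeq H) :=
  {v | IsFront R η.lh v ∧ η ≤ R v}

/-- A stem ending in 0 belongs to the front as soon as enough bits are read. Infinity allows an
enumeration by all of ℕ. -/
theorem infinite_frontStems (hH : ∀ i, 0 < H i) {R : FinSeq H → Cohen} (hR : Monotone R)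
    {η : Cohen} (hη : ∃ v, η ≤ R v) : (frontStems R η).Infinite := by
  obtain ⟨v, hv⟩ := hη
  refine Set.Infinite.of_image FinSeq.lh (Set.infinite_of_forall_exists_gt fun n => ?_)
  obtain ⟨w, h1, h2, -⟩ := FinSeq.exists_le_avoids (E := fun _ => ∅) v
    (fun i _ => ⟨0, hH i, Finset.notMem_empty 0⟩) n
  have h3 : η ≤ R (w.snoc 0 (hH _)) := hv.trans (hR (h1.trans (FinSeq.le_snoc _ _ _)))
  refine ⟨_, ⟨w.snoc 0 (hH _), ⟨⟨FinSeq.lh_mono h3, fun u a ha he => Or.inl ?_⟩, h3⟩, rfl⟩, ?_⟩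
  · have he' := congrArg Subtype.val he
    simp only [FinSeq.snoc_val] at he'
    have := (List.append_inj' he' rfl).2
    simpa using this.symm
  · rw [FinSeq.lh_snoc]
    omega

theorem exists_enum_frontStems (hH : ∀ i, 0 < H i) {R : FinSeq H → Cohen} (hR : Monotone R)
    {η : Cohen} (hη : ∃ v, η ≤ R v) :
    ∃ e : ℕ → FinSeq H, Function.Injective e ∧ range e = frontStems R η := by
  have := (infinite_frontStems hH hR hη).to_subtype
  obtain ⟨e⟩ : Nonempty (ℕ ≃ frontStems R η) := nonempty_equiv_of_countable
  refine ⟨fun n => (e n).1, Subtype.val_injective.comp e.injective, ?_⟩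
  ext v
  exact ⟨fun ⟨n, hn⟩ => hn ▸ (e n).2, fun hv => ⟨e.symm ⟨v, hv⟩, by simp⟩⟩

end fronts

/-! ### From a reading to a name for a Cohen real -/

section readingNames

variable {H : ℕ → ℕ} {F : Set (ℕ → ℕ)} {B : ℕ → ℕ → ℕ}

/-- A way of reading a Cohen real from the generic sequence of `Q*_F(K, Σ)`. -/
structure IsReading (F : Set (ℕ → ℕ)) (R : FinSeq H → Cohen) : Prop where
  mono : Monotone R
  exists_le : ∀ η, ∃ v, η ≤ R v
  free : ∀ p : Condition (edK H) (edSigma H) F, ∃ η, ∀ ν, η ≤ ν →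
    ∃ v, p.1.w ≤ v ∧ v.Avoids p.1.slalom p.1.w.lh ∧ ν ≤ R v

/-- The bound allows nonempty sets. -/
def AllowsUnit (H : ℕ → ℕ) (B : ℕ → ℕ → ℕ) : Prop :=
  (∀ i, 2 ≤ H i) ∧ ∃ k, ∀ᶠ i in atTop, 1 ≤ B k i

/-- The condition with stem `v` that excludes the value `0` everywhere. -/
noncomputable def unitCondition (hb : SlalomBound H F B) (hu : AllowsUnit H B) (v : FinSeq H) :
    Condition (edK H) (edSigma H) F :=
  Condition.mk' hb v (fun _ => {0})
    (fun i _ => ⟨by simpa using hb.pos i, by simp, hu.1 i⟩) (by simpa using hu.2)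

theorem unitCondition_slalom (hb : SlalomBound H F B) (hu : AllowsUnit H B) (v : FinSeq H) {i : ℕ}
    (hi : v.lh ≤ i) : (unitCondition hb hu v).1.slalom i = {0} :=
  Condition.mk'_slalom hb v (fun _ => {0}) _ _ hi

theorem avoids_unitCondition_iff (hb : SlalomBound H F B) (hu : AllowsUnit H B) {v w : FinSeq H} :
    w.Avoids (unitCondition hb hu v).1.slalom v.lh ↔ w.Avoids (fun _ => {0}) v.lh :=
  ⟨fun h => h.anti fun _ hi => (unitCondition_slalom hb hu v hi).ge,
    fun h => h.anti fun _ hi => (unitCondition_slalom hb hu v hi).le⟩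

/-- Any condition extends to one from whose stem on there is room for a set of slalom `G`. -/
theorem Condition.exists_extend_room (hb : SlalomBound H F B)
    (p : Condition (edK H) (edSigma H) F) {G : ℕ → Finset ℕ}
    (hG : ∃ k, ∀ᶠ i in atTop, (G i).card ≤ B k i) (n : ℕ) :
    ∃ q, p ≤ q ∧ n ≤ q.1.w.lh ∧ ∀ i, q.1.w.lh ≤ i → ∃ a < H i, a ∉ G i ∧ a ∉ q.1.slalom i := by
  obtain ⟨k, hk⟩ := hG
  obtain ⟨l, hl⟩ := p.exists_bound hb
  obtain ⟨m, hm⟩ := hb.add k l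
  obtain ⟨N, hN⟩ := eventually_atTop.1 (hk.and (hl.and (hm.and (hb.small m))))
  obtain ⟨v, h1, h2, h3⟩ := p.1.w.exists_le_avoids (fun i hi => p.1.exists_notMem hi) (max n N)
  obtain ⟨q, hq, rfl, hqE⟩ := p.exists_extend hb h1 h3
  refine ⟨q, hq, (le_max_left _ _).trans h2, fun i hi => ?_⟩
  obtain ⟨i1, i2, i3, i4⟩ := hN i ((le_max_right n N).trans (h2.trans hi))
  obtain ⟨a, ha, haE⟩ := exists_lt_notMem (n := H i) (E := G i ∪ p.1.slalom i)
    ((Finset.card_union_le _ _).trans_lt (by omega))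
  rw [hqE i hi]
  exact ⟨a, ha, by simpa using haE⟩

/-- Slaloms consist of nonempty sets, so a bare stem is not a condition; forbidding the value 0 is
the substitute. Once `p` is extended to leave room besides 0, the stem can be cut back to a member
of the front past which it avoids 0. -/
theorem exists_unitCondition_le (hb : SlalomBound H F B) (hu : AllowsUnit H B)
    {R : FinSeq H → Cohen} (hR : Monotone R) {η : Cohen} (p : Condition (edK H) (edSigma H) F)
    (hη : η ≤ R p.1.w) : ∃ s, p ≤ s ∧ ∃ v ∈ frontStems R η, unitCondition hb hu v ≤ s := by
  obtain ⟨q, hq, -, hroom⟩ := p.exists_extend_room hb (G := fun _ => {0}) (by simpa using hu.2) 0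
  have hη' : η ≤ R q.1.w := hη.trans (hR ((Condition.le_iff hb.pos).1 hq).1)
  obtain ⟨u, hu1, hu2, hu3⟩ := exists_isFront_le (FinSeq.lh_mono hη')
  have hj : (unitCondition hb hu u).1.Joins q.1 := by
    refine ⟨hu1, (avoids_unitCondition_iff hb hu).2 hu3, fun i hi => ?_⟩
    rw [unitCondition_slalom hb hu u ((FinSeq.lh_mono hu1).trans hi)]
    exact hroom i hi
  obtain ⟨s, hs1, hs2, -⟩ := hj.exists_union hb
  exact ⟨s, hq.trans hs2, u, ⟨hu2, FinSeq.le_total_of_le hη' (hR hu1) hu2.1⟩, hs1⟩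

theorem unitCondition_eq_of_compat (hb : SlalomBound H F B) (hu : AllowsUnit H B)
    {R : FinSeq H → Cohen} (hR : Monotone R) {n : ℕ} {u v : FinSeq H} (h1 : IsFront R n u)
    (h2 : IsFront R n v) (h : Compat (unitCondition hb hu u) (unitCondition hb hu v)) : u = v := by
  rcases (Condition.compat_iff hb).1 h with h | h
  · exact h1.eq_of_le hR h2 h.1 ((avoids_unitCondition_iff hb hu).1 h.2.1)
  · exact (h2.eq_of_le hR h1 h.1 ((avoids_unitCondition_iff hb hu).1 h.2.1)).symm

theorem QStar.coe_of_coe_le {p : Condition (edK H) (edSigma H) F} {r : QStar (edK H) (edSigma H) F}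
    (h : (p : QStar (edK H) (edSigma H) F) ≤ r) :
    ∃ q : Condition (edK H) (edSigma H) F, r = q ∧ p ≤ q := by
  induction r using WithBot.recBotCoe with
  | bot => exact absurd h (WithBot.not_coe_le_bot p)
  | coe q => exact ⟨q, rfl, WithBot.coe_le_coe.1 h⟩

/-- An enumeration of the stems that decide initial segments. -/
noncomputable def IsReading.enum {R : FinSeq H → Cohen} (hR : IsReading F R) (hH : ∀ i, 0 < H i)
    (η : Cohen) : ℕ → FinSeq H :=
  (exists_enum_frontStems hH hR.mono (hR.exists_le η)).choose

theorem IsReading.enum_injective {R : FinSeq H → Cohen} (hR : IsReading F R) (hH : ∀ i, 0 < H i)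
    (η : Cohen) : Function.Injective (hR.enum hH η) :=
  (exists_enum_frontStems hH hR.mono (hR.exists_le η)).choose_spec.1

theorem IsReading.range_enum {R : FinSeq H → Cohen} (hR : IsReading F R) (hH : ∀ i, 0 < H i)
    (η : Cohen) : range (hR.enum hH η) = frontStems R η :=
  (exists_enum_frontStems hH hR.mono (hR.exists_le η)).choose_spec.2

theorem IsReading.enum_mem {R : FinSeq H → Cohen} (hR : IsReading F R) (hH : ∀ i, 0 < H i)
    (η : Cohen) (k : ℕ) : hR.enum hH η k ∈ frontStems R η :=
  hR.range_enum hH η ▸ mem_range_self k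

theorem IsReading.exists_extend {R : FinSeq H → Cohen} (hR : IsReading F R)
    (hb : SlalomBound H F B) (p : Condition (edK H) (edSigma H) F) :
    ∃ η, ∀ ν, η ≤ ν → ∃ q, p ≤ q ∧ ν ≤ R q.1.w := by
  obtain ⟨η, hη⟩ := hR.free p
  refine ⟨η, fun ν hν => ?_⟩
  obtain ⟨v, h1, h2, h3⟩ := hη ν hν
  obtain ⟨q, hq, rfl, -⟩ := p.exists_extend hb h1 h2
  exact ⟨q, hq, h3⟩

theorem IsReading.exists_long {R : FinSeq H → Cohen} (hR : IsReading F R)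
    (hb : SlalomBound H F B) (p : Condition (edK H) (edSigma H) F) (n : ℕ) :
    ∃ q, p ≤ q ∧ n ≤ (R q.1.w).lh := by
  obtain ⟨η, hη⟩ := hR.exists_extend hb p
  obtain ⟨ν, h1, h2, -⟩ := FinSeq.exists_le_avoids (E := fun _ => ∅) η
    (fun i _ => ⟨0, two_pos, Finset.notMem_empty 0⟩) n
  obtain ⟨q, hq, hν⟩ := hη ν h1
  exact ⟨q, hq, h2.trans (FinSeq.lh_mono hν)⟩

/-- The name of the real read from the generic sequence. -/
noncomputable def IsReading.name {R : FinSeq H → Cohen} (hR : IsReading F R)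
    (hb : SlalomBound H F B) (hu : AllowsUnit H B) :
    StandardName (fun _ => 2) (QStar (edK H) (edSigma H) F) where
  N _ := ⊤
  q η k := (unitCondition hb hu (hR.enum hb.pos η k) : Condition (edK H) (edSigma H) F)
  antichain η ν k m hl _ _ hne hc := by
    obtain ⟨h1, h2⟩ := hR.enum_mem hb.pos η k
    obtain ⟨h3, h4⟩ := hR.enum_mem hb.pos ν m
    have he := unitCondition_eq_of_compat hb hu hR.mono h1 (hl ▸ h3) (QStar.compat_coe.1 hc)
    rw [← he] at h4
    obtain rfl := FinSeq.eq_of_le_of_lh_le (FinSeq.le_total_of_le h2 h4 hl.le) hl.ge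
    exact hne (by rw [hR.enum_injective hb.pos η he])
  maximal n p := by
    have key : ∀ p : Condition (edK H) (edSigma H) F, ∃ (η : Cohen) (k : ℕ), η.lh = n ∧
        (k : ℕ∞) < ⊤ ∧ Compat (p : QStar (edK H) (edSigma H) F)
          (unitCondition hb hu (hR.enum hb.pos η k) : Condition (edK H) (edSigma H) F) := by
      intro p
      obtain ⟨q, hq, hn⟩ := hR.exists_long hb p n
      obtain ⟨s, hs, v, hv, hvs⟩ := exists_unitCondition_le hb hu hR.mono q
        (FinSeq.restr_le (R q.1.w) n)
      rw [← hR.range_enum hb.pos] at hv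
      obtain ⟨k, rfl⟩ := hv
      exact ⟨_, k, by rw [FinSeq.lh_restr, min_eq_left hn], ENat.natCast_lt_top k,
        QStar.compat_coe.2 ⟨s, hq.trans hs, hvs⟩⟩
    induction p using WithBot.recBotCoe with
    | bot =>
      obtain ⟨η, k, h1, h2, -⟩ := key (unitCondition hb hu ⊥)
      exact ⟨η, k, h1, h2, (QStar.compat_bot _).symm⟩
    | coe p => exact key p
  refine_below ν η hνη k _ := by
    obtain ⟨h1, h2⟩ := hR.enum_mem hb.pos η k
    have h3 := hνη.le.trans h2
    obtain ⟨u, hu1, hu2, hu3⟩ := exists_isFront_le (FinSeq.lh_mono h3)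
    have hmem : u ∈ frontStems R ν := ⟨hu2, FinSeq.le_total_of_le h3 (hR.mono hu1) hu2.1⟩
    rw [← hR.range_enum hb.pos] at hmem
    obtain ⟨m, rfl⟩ := hmem
    refine ⟨m, ENat.natCast_lt_top m, WithBot.coe_le_coe.2 ((Condition.le_iff hb.pos).2
      ⟨hu1, (avoids_unitCondition_iff hb hu).2 hu3, fun i hi => ?_⟩)⟩
    change (hR.enum hb.pos η k).lh ≤ i at hi
    rw [unitCondition_slalom hb hu _ hi,
      unitCondition_slalom hb hu _ ((FinSeq.lh_mono hu1).trans hi)]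

theorem IsReading.mem_value {R : FinSeq H → Cohen} (hR : IsReading F R)
    (hb : SlalomBound H F B) (hu : AllowsUnit H B) {p : Condition (edK H) (edSigma H) F} {η : Cohen}
    (hη : η ≤ R p.1.w) :
    (p : QStar (edK H) (edSigma H) F) ∈ ((hR.name hb hu).value {η}).1 := by
  intro r hr
  obtain ⟨q, rfl, hq⟩ := QStar.coe_of_coe_le hr
  obtain ⟨s, hs, v, hv, hvs⟩ := exists_unitCondition_le hb hu hR.mono q
    (hη.trans (hR.mono ((Condition.le_iff hb.pos).1 hq).1))
  rw [← hR.range_enum hb.pos] at hv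
  obtain ⟨k, rfl⟩ := hv
  exact ⟨s, WithBot.coe_le_coe.2 hs, η, rfl, k, ENat.natCast_lt_top k, WithBot.coe_le_coe.2 hvs⟩

theorem IsReading.projects {R : FinSeq H → Cohen} (hR : IsReading F R)
    (hb : SlalomBound H F B) (hu : AllowsUnit H B) : (hR.name hb hu).Projects := by
  intro p
  induction p using WithBot.recBotCoe with
  | bot =>
    obtain ⟨η, hη⟩ := hR.exists_extend hb (unitCondition hb hu ⊥)
    refine ⟨η, fun ν hν => ?_⟩
    obtain ⟨q, -, hq⟩ := hη ν hν
    exact ⟨q, bot_le, hR.mem_value hb hu hq⟩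
  | coe p =>
    obtain ⟨η, hη⟩ := hR.exists_extend hb p
    refine ⟨η, fun ν hν => ?_⟩
    obtain ⟨q, hq, hq'⟩ := hη ν hν
    exact ⟨q, WithBot.coe_le_coe.2 hq, hR.mem_value hb hu hq'⟩

theorem IsReading.mapsOnto {R : FinSeq H → Cohen} (hR : IsReading F R)
    (hb : SlalomBound H F B) (hu : AllowsUnit H B) :
    MapsOnto (fun η : Cohen => η) (hR.name hb hu) := by
  refine (hR.projects hb hu).mapsOnto (fun _ => two_pos) fun η => ?_
  obtain ⟨v, hv⟩ := hR.exists_le η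
  exact ⟨_, hR.mem_value hb hu (p := unitCondition hb hu v) hv⟩

/-- Conditions whose stem already yields n bits are dense, so it is enough to inspect their stems.
-/
theorem IsReading.forces {R : FinSeq H → Cohen} (hR : IsReading F R)
    (hb : SlalomBound H F B) (hu : AllowsUnit H B) {p : Condition (edK H) (edSigma H) F} {n : ℕ}
    {A : Set Cohen} (hA : ∀ q, p ≤ q → n ≤ (R q.1.w).lh → (R q.1.w).restr n ∈ A) :
    (hR.name hb hu).Forces (p : QStar (edK H) (edSigma H) F) A := by
  refine (hR.name hb hu).forces_of_restr_mem (n := n) fun r hr => ?_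
  obtain ⟨q, rfl, hq⟩ := QStar.coe_of_coe_le hr
  obtain ⟨s, hs, hn⟩ := hR.exists_long hb q n
  exact ⟨s, WithBot.coe_le_coe.2 hs, R s.1.w, hn, hA s (hq.trans hs) hn,
    hR.mem_value hb hu le_rfl⟩

end readingNames

/-! ## The two readings -/

section flip

/-- Interchange of `0` and `1`. -/
def Cohen.flip (η : Cohen) : Cohen :=
  ⟨η.1.map fun d => 1 - d, fun i hi => by
    rw [List.getElem_map]
    exact (Nat.sub_le 1 _).trans_lt one_lt_two⟩

theorem Cohen.lh_flip (η : Cohen) : η.flip.lh = η.lh := List.length_map _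

theorem Cohen.flip_mono : Monotone Cohen.flip := fun _ _ h => List.IsPrefix.map _ h

theorem Cohen.flip_flip (η : Cohen) : η.flip.flip = η := by
  refine Subtype.ext ?_
  simp only [flip, List.map_map]
  refine List.ext_getElem (by simp) fun i h1 h2 => ?_
  have : η.1[i] < 2 := η.2 i h2
  simp only [List.getElem_map, Function.comp]
  omega

theorem Cohen.le_flip_iff {η ν : Cohen} : η ≤ ν.flip ↔ η.flip ≤ ν :=
  ⟨fun h => ν.flip_flip ▸ Cohen.flip_mono h, fun h => η.flip_flip ▸ Cohen.flip_mono h⟩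

theorem IsReading.flip {H : ℕ → ℕ} {F : Set (ℕ → ℕ)} {R : FinSeq H → Cohen} (hR : IsReading F R) :
    IsReading F fun v => (R v).flip where
  mono _ _ h := Cohen.flip_mono (hR.mono h)
  exists_le η := by
    obtain ⟨v, hv⟩ := hR.exists_le η.flip
    exact ⟨v, Cohen.le_flip_iff.2 hv⟩
  free p := by
    obtain ⟨η, hη⟩ := hR.free p
    refine ⟨η.flip, fun ν hν => ?_⟩
    obtain ⟨v, h1, h2, h3⟩ := hη ν.flip (Cohen.le_flip_iff.2 hν)
    exact ⟨v, h1, h2, Cohen.le_flip_iff.2 h3⟩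

end flip

/-! ## Sourness -/

section sour

variable {H : ℕ → ℕ} {F : Set (ℕ → ℕ)} {B : ℕ → ℕ → ℕ} {M : ℕ → ℕ}

/-- The slaloms of the conditions have, up to constant factors, sets of sizes `M i`. -/
structure IsScale (H : ℕ → ℕ) (B : ℕ → ℕ → ℕ) (M : ℕ → ℕ) : Prop where
  pos : ∀ i, 0 < M i
  le_two_pow : ∀ i, M i ≤ 2 ^ i
  le_bound : ∃ k, ∀ i, M i ≤ B k i
  bound_le : ∀ k, ∃ C, ∀ i, B k i ≤ C * M i

/-! ### Estimates for slaloms on a fixed scale -/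

theorem four_pow_succ_le (hH : ∀ i, 2 ^ 2 ^ (i + 1) ≤ H i) (i : ℕ) : 4 ^ (i + 1) ≤ H i := by
  refine le_trans ?_ (hH i)
  rw [show (4 : ℕ) = 2 ^ 2 by norm_num, ← pow_mul]
  refine Nat.pow_le_pow_right (by norm_num) ?_
  have : i < 2 ^ i := Nat.lt_two_pow_self
  rw [pow_succ]
  omega

theorem IsScale.hit_le (hs : IsScale H B M) (i : ℕ) : 2 ^ hitLevel i * M i ≤ 4 ^ i := by
  calc 2 ^ hitLevel i * M i ≤ 2 ^ i * 2 ^ i :=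
        Nat.mul_le_mul (Nat.pow_le_pow_right (by norm_num) (hitLevel_le i)) (hs.le_two_pow i)
    _ = (2 * 2) ^ i := (mul_pow 2 2 i).symm

theorem IsScale.hit_le_bound (hs : IsScale H B M) (hH : ∀ i, 2 ^ 2 ^ (i + 1) ≤ H i) (i : ℕ) :
    2 ^ hitLevel i * M i ≤ H i :=
  (hs.hit_le i).trans ((Nat.pow_le_pow_right (by norm_num) (Nat.le_succ i)).trans
    (four_pow_succ_le hH i))

theorem IsScale.room_empty (hs : IsScale H B M) (hH : ∀ i, 2 ^ 2 ^ (i + 1) ≤ H i) :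
    Room H M (fun _ => ∅) 0 := by
  intro i _ r hr
  refine exists_mod_three_notMem hr ?_
  have h1 := hs.hit_le i
  have h2 := four_pow_succ_le hH i
  have h3 : 1 ≤ 4 ^ i := Nat.one_le_pow _ _ (by norm_num)
  rw [pow_succ] at h2
  rw [Finset.card_empty]
  omega

theorem IsScale.exists_room (hs : IsScale H B M) (hH : ∀ i, 2 ^ 2 ^ (i + 1) ≤ H i)
    {E : ℕ → Finset ℕ} {C : ℕ} (hE : ∀ᶠ i in atTop, (E i).card ≤ C * M i) :
    ∃ n, Room H M E n := by
  obtain ⟨n, hn⟩ := eventually_atTop.1 (hE.and ((eventually_mul_add_two_lt_two_pow (C + 5)).and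
    (eventually_ge_atTop 1)))
  refine ⟨n, fun i hi r hr => exists_mod_three_notMem hr ?_⟩
  obtain ⟨h1, h2, h3⟩ := hn i hi
  have h4 := hs.hit_le i
  -- The constant C + 5 arises from (3C + 4)·4^i ≤ 2^(C+3+2i) ≤ 2^((C+5)i) for i ≥ 1.
  have h5 : 2 ^ ((C + 5) * i) ≤ H i :=
    (Nat.pow_le_pow_right (by norm_num) (by omega)).trans (hH i)
  have h6 : M i ≤ 4 ^ i := (hs.le_two_pow i).trans (Nat.pow_le_pow_left (by norm_num) i)
  have h7 : 1 ≤ 4 ^ i := Nat.one_le_pow _ _ (by norm_num)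
  have h8 : 3 * C + 4 ≤ 2 ^ (C + 3) := by
    have : C < 2 ^ C := Nat.lt_two_pow_self
    rw [pow_add]
    omega
  calc 2 ^ hitLevel i * M i + 3 * ((E i).card + 1) ≤ 4 ^ i + 3 * (C * 4 ^ i + 4 ^ i) := by
        have : C * M i ≤ C * 4 ^ i := Nat.mul_le_mul_left _ h6
        omega
    _ = (3 * C + 4) * 4 ^ i := by ring
    _ ≤ 2 ^ (C + 3) * 4 ^ i := Nat.mul_le_mul_right _ h8
    _ = 2 ^ (C + 3 + 2 * i) := by rw [pow_add _ (C + 3), pow_mul]; norm_num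
    _ ≤ 2 ^ ((C + 5) * i) := Nat.pow_le_pow_right (by norm_num) (by nlinarith)
    _ ≤ H i := h5

theorem IsScale.allowsUnit (hs : IsScale H B M) (hH : ∀ i, 2 ^ 2 ^ (i + 1) ≤ H i) :
    AllowsUnit H B := by
  refine ⟨fun i => ?_, ?_⟩
  · have h1 := four_pow_succ_le hH i
    have h2 : 1 ≤ 4 ^ i := Nat.one_le_pow _ _ (by norm_num)
    rw [pow_succ] at h1
    omega
  · obtain ⟨k, hk⟩ := hs.le_bound
    exact ⟨k, Eventually.of_forall fun i => (hs.pos i).trans_le (hk i)⟩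

theorem IsScale.isReading (hs : IsScale H B M) (hH : ∀ i, 2 ^ 2 ^ (i + 1) ≤ H i)
    (hb : SlalomBound H F B) : IsReading F (readBits M : FinSeq H → Cohen) where
  mono _ _ h := readBits_mono h
  exists_le η := by
    obtain ⟨w, -, -, hw⟩ := exists_readBits_eq hs.pos (⊥ : FinSeq H) (hs.room_empty hH)
      (fun a _ => free_empty hs.pos (hs.hit_le_bound hH) a) (η := η) (List.nil_prefix)
    exact ⟨w, hw.ge⟩
  free p := by
    obtain ⟨k, hk⟩ := p.exists_bound hb
    obtain ⟨C, hC⟩ := hs.bound_le k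
    have hE : ∀ᶠ i in atTop, (p.1.slalom i).card ≤ C * M i := by
      filter_upwards [hk] with i hi
      exact hi.trans (hC i)
    obtain ⟨n, hn⟩ := hs.exists_room hH hE
    obtain ⟨N, hN⟩ := eventually_atTop.1 hE
    obtain ⟨a₀, ha₀⟩ := free_of_card_le hs.pos (hs.hit_le_bound hH) hN
    obtain ⟨v, h1, h2, h3⟩ := p.1.w.exists_le_avoids (fun i hi => p.1.exists_notMem hi) n
    -- Zeros cost nothing, so they are emitted until the levels from a₀ on are reached, at which any
    -- bit can be produced.
    obtain ⟨w, h4, h5, h6⟩ := exists_long_read v (hn.mono h2) a₀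
    refine ⟨readBits M w, fun ν hν => ?_⟩
    obtain ⟨u, h7, h8, h9⟩ := exists_readBits_eq hs.pos w
      (hn.mono (h2.trans (FinSeq.lh_mono h4))) (fun a ha => ha₀ a (h6.trans ha)) hν
    exact ⟨u, h1.trans (h4.trans h7), (h3.trans h4 h5).trans h7 h8, h9.ge⟩

/-! ### The conditions attached to a real -/

/-- The restriction of `x` to `b`, as a number below `2 ^ b`. -/
def branch (x : ℕ → Fin 2) (b : ℕ) : ℕ := ∑ i ∈ Finset.range b, (x i : ℕ) * 2 ^ i

theorem branch_succ (x : ℕ → Fin 2) (b : ℕ) : branch x (b + 1) = branch x b + x b * 2 ^ b :=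
  Finset.sum_range_succ _ _

theorem branch_lt (x : ℕ → Fin 2) (b : ℕ) : branch x b < 2 ^ b := by
  induction b with
  | zero => simp [branch]
  | succ b ih =>
    have h1 : (x b : ℕ) * 2 ^ b ≤ 1 * 2 ^ b := Nat.mul_le_mul_right _ (by omega)
    rw [branch_succ, pow_succ]
    omega

theorem branch_mod (x : ℕ → Fin 2) {a b : ℕ} (h : a ≤ b) : branch x b % 2 ^ a = branch x a := by
  induction b, h using Nat.le_induction with
  | base => exact Nat.mod_eq_of_lt (branch_lt x a)
  | succ b hab ih =>
    have h1 : 2 ^ a ∣ (x b : ℕ) * 2 ^ b := Dvd.dvd.mul_left (pow_dvd_pow 2 hab) _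
    rw [branch_succ, Nat.add_mod, Nat.mod_eq_zero_of_dvd h1, add_zero, Nat.mod_mod, ih]

theorem branch_congr {x y : ℕ → Fin 2} {b : ℕ} (h : ∀ i < b, x i = y i) :
    branch x b = branch y b :=
  Finset.sum_congr rfl fun i hi => by rw [h i (Finset.mem_range.1 hi)]

theorem measurable_branch (b : ℕ) : Measurable fun x : ℕ → Fin 2 => branch x b :=
  Finset.measurable_sum _ fun i _ =>
    (measurable_of_countable fun d : Fin 2 => (d : ℕ) * 2 ^ i).comp (measurable_pi_apply i)

/-- The values at the coordinate `i` that hit the node `t`. -/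
def hitSet (H M : ℕ → ℕ) (i t : ℕ) : Finset ℕ := (Finset.range (H i)).filter fun c => c / M i = t

theorem card_hitSet_le (hM : ∀ i, 0 < M i) (i t : ℕ) : (hitSet H M i t).card ≤ M i := by
  have : hitSet H M i t ⊆ (Finset.range (M i)).image fun r => M i * t + r := by
    intro c hc
    obtain ⟨-, rfl⟩ := Finset.mem_filter.1 hc
    exact Finset.mem_image.2 ⟨c % M i, Finset.mem_range.2 (Nat.mod_lt _ (hM i)),
      Nat.div_add_mod c (M i)⟩
  exact (Finset.card_le_card this).trans (Finset.card_image_le.trans (Finset.card_range _).le)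

theorem IsScale.proper_hitSet (hs : IsScale H B M) (hH : ∀ i, 2 ^ 2 ^ (i + 1) ≤ H i) {i t : ℕ}
    (ht : t < 2 ^ hitLevel i) : Proper H i (hitSet H M i t) := by
  refine ⟨Finset.filter_subset _ _, Finset.card_pos.2 ⟨t * M i, Finset.mem_filter.2
    ⟨Finset.mem_range.2 ?_, Nat.mul_div_cancel _ (hs.pos i)⟩⟩,
    (card_hitSet_le hs.pos i t).trans_lt ?_⟩
  · exact (Nat.mul_lt_mul_of_pos_right ht (hs.pos i)).trans_le (hs.hit_le_bound hH i)
  · have h1 := four_pow_succ_le hH i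
    have h2 : M i ≤ 4 ^ i := (hs.le_two_pow i).trans (Nat.pow_le_pow_left (by norm_num) i)
    have h3 : 1 ≤ 4 ^ i := Nat.one_le_pow _ _ (by norm_num)
    rw [pow_succ] at h1
    omega

/-- The slalom of the initial segments of `x`. -/
def branchSlalom (H M : ℕ → ℕ) (x : ℕ → Fin 2) (i : ℕ) : Finset ℕ :=
  hitSet H M i (branch x (hitLevel i))

theorem IsScale.branchSlalom_bound (hs : IsScale H B M) (x : ℕ → Fin 2) :
    ∃ k, ∀ᶠ i in atTop, (branchSlalom H M x i).card ≤ B k i := by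
  obtain ⟨k, hk⟩ := hs.le_bound
  exact ⟨k, Eventually.of_forall fun i => (card_hitSet_le hs.pos i _).trans (hk i)⟩

/-- The length restriction makes the slalom of the k-th condition effective from coordinate k on,
hence for all hits counted at levels n ≥ k. -/
theorem exists_stemEnum (H : ℕ → ℕ) :
    ∃ e : ℕ → FinSeq H, (∀ k, (e k).lh ≤ k) ∧ Function.Surjective e := by
  obtain ⟨f, hf⟩ := exists_surjective_nat (FinSeq H)
  refine ⟨fun k => if (f k.unpair.1).lh ≤ k then f k.unpair.1 else ⊥, fun k => ?_, fun w => ?_⟩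
  · dsimp only
    split_ifs with h
    · exact h
    · exact Nat.zero_le _
  · obtain ⟨a, rfl⟩ := hf w
    refine ⟨Nat.pair a (f a).lh, ?_⟩
    simp only [Nat.unpair_pair]
    rw [if_pos (Nat.right_le_pair _ _)]

/-- An enumeration of all stems, the `k`-th being of length at most `k`. -/
noncomputable def stemEnum (H : ℕ → ℕ) : ℕ → FinSeq H := (exists_stemEnum H).choose

theorem lh_stemEnum_le (k : ℕ) : (stemEnum H k).lh ≤ k := (exists_stemEnum H).choose_spec.1 k

theorem stemEnum_surjective : Function.Surjective (stemEnum H) := (exists_stemEnum H).choose_spec.2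

/-- The condition with the `k`-th stem that excludes the initial segments of `x`. -/
noncomputable def branchCondition (hs : IsScale H B M) (hH : ∀ i, 2 ^ 2 ^ (i + 1) ≤ H i)
    (hb : SlalomBound H F B) (x : ℕ → Fin 2) (k : ℕ) : Condition (edK H) (edSigma H) F :=
  Condition.mk' hb (stemEnum H k) (branchSlalom H M x)
    (fun _ _ => hs.proper_hitSet hH (branch_lt x _)) (hs.branchSlalom_bound x)

theorem branchCondition_slalom (hs : IsScale H B M) (hH : ∀ i, 2 ^ 2 ^ (i + 1) ≤ H i)
    (hb : SlalomBound H F B) (x : ℕ → Fin 2) (k : ℕ) {i : ℕ} (hi : (stemEnum H k).lh ≤ i) :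
    (branchCondition hs hH hb x k).1.slalom i = branchSlalom H M x i :=
  Condition.mk'_slalom hb (stemEnum H k) (branchSlalom H M x) _ _ hi

theorem measurable_code_branchCondition (hs : IsScale H B M) (hH : ∀ i, 2 ^ 2 ^ (i + 1) ≤ H i)
    (hb : SlalomBound H F B) : Measurable fun z : (ℕ → Fin 2) × ℕ =>
      QStar.code (branchCondition hs hH hb z.1 z.2 : QStar (edK H) (edSigma H) F) := by
  refine measurable_pi_iff.2 fun n => measurable_from_prod_countable_left fun k => ?_
  cases n with
  | zero =>
    change Measurable fun _ : ℕ → Fin 2 => Encodable.encode (stemEnum H k).1 + 1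
    exact measurable_const
  | succ n =>
    have : (fun x : ℕ → Fin 2 => QStar.code
        (branchCondition hs hH hb x k : QStar (edK H) (edSigma H) F) (n + 1)) =
        fun x => Encodable.encode ((stemEnum H k).lh + n,
          hitSet H M ((stemEnum H k).lh + n) (branch x (hitLevel ((stemEnum H k).lh + n)))) := by
      funext x
      rw [QStar.code_coe_succ]
      exact congrArg (fun e => Encodable.encode ((stemEnum H k).lh + n, e))
        (branchCondition_slalom hs hH hb x k (Nat.le_add_right _ _))
    change Measurable (fun x : ℕ → Fin 2 => QStar.code
        (branchCondition hs hH hb x k : QStar (edK H) (edSigma H) F) (n + 1))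
    rw [this]
    exact (measurable_of_countable fun t : ℕ => Encodable.encode ((stemEnum H k).lh + n,
      hitSet H M ((stemEnum H k).lh + n) t)).comp (measurable_branch _)

/-- Extend the given condition until its slalom and the one of x leave room together; the index of
its stem then gives a compatible member. -/
theorem predense_branchCondition (hs : IsScale H B M) (hH : ∀ i, 2 ^ 2 ^ (i + 1) ≤ H i)
    (hb : SlalomBound H F B) (x : ℕ → Fin 2) : Predense (range fun k : ℕ =>
      (branchCondition hs hH hb x k : QStar (edK H) (edSigma H) F)) := by
  intro p
  induction p using WithBot.recBotCoe with
  | bot => exact ⟨_, ⟨0, rfl⟩, (QStar.compat_bot _).symm⟩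
  | coe p =>
    obtain ⟨q, hq, -, hroom⟩ := p.exists_extend_room hb (hs.branchSlalom_bound x) 0
    obtain ⟨k, hk⟩ := stemEnum_surjective q.1.w
    have hj : (branchCondition hs hH hb x k).1.Joins q.1 := by
      refine ⟨hk.le, FinSeq.avoids_of_lh_le (congrArg FinSeq.lh hk).ge, fun i hi => ?_⟩
      rw [branchCondition_slalom hs hH hb x k (hk ▸ hi)]
      exact hroom i hi
    obtain ⟨r, hr1, hr2, -⟩ := hj.exists_union hb
    exact ⟨_, ⟨k, rfl⟩, QStar.compat_coe.2 ⟨r, hq.trans hr2, hr1⟩⟩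

/-- If `q` excludes the initial segments of `x` then no initial segment of `x` is killed. -/
theorem not_kills_branch (hs : IsScale H B M) (hH : ∀ i, 2 ^ 2 ^ (i + 1) ≤ H i)
    (hb : SlalomBound H F B) {x : ℕ → Fin 2} {k a n : ℕ} (hk : k ≤ a)
    {q : Condition (edK H) (edSigma H) F} (hq : branchCondition hs hH hb x k ≤ q) :
    ¬ Kills M q.1.w.1 a n (branch x n) := by
  rintro ⟨b, hb', hkill⟩
  obtain ⟨j, hj, rfl, c, hc, hct⟩ := hkill (branch x b) (branch_lt x b) (branch_mod x hb')
  have hjk : (stemEnum H k).lh ≤ j := (lh_stemEnum_le k).trans (hk.trans hj)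
  have h1 := ((Condition.le_iff hb.pos).1 hq).2.1 j c hjk hc
  rw [branchCondition_slalom hs hH hb x k hjk] at h1
  obtain ⟨hjl, rfl⟩ := List.getElem?_eq_some_iff.1 hc
  exact h1 (Finset.mem_filter.2 ⟨Finset.mem_range.2 (q.1.w.2 j hjl), hct⟩)

/-! ### Two branches block the level at which they split -/

theorem exists_first_difference {x y : ℕ → Fin 2} (hne : x ≠ y) {m : ℕ}
    (h : ∀ i < m, x i = y i) : ∃ n, m ≤ n ∧ (∀ i < n, x i = y i) ∧ x n ≠ y n := by
  classical
  have hex : ∃ n, x n ≠ y n := Function.ne_iff.1 hne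
  refine ⟨Nat.find hex, ?_, fun i hi => not_not.1 (Nat.find_min hex hi), Nat.find_spec hex⟩
  by_contra hlt
  exact Nat.find_spec hex (h _ (not_le.1 hlt))

/-- If s is the common restriction to n, then s and s + 2^n are the restrictions of the two reals to
n + 1. An active situation would kill one of them, which `not_kills_branch` forbids. -/
theorem not_active_of_branchCondition_le (hs : IsScale H B M) (hH : ∀ i, 2 ^ 2 ^ (i + 1) ≤ H i)
    (hb : SlalomBound H F B) {x y : ℕ → Fin 2} {k n : ℕ} (hk : k ≤ n) (h : ∀ i < n, x i = y i)
    (hn : x n ≠ y n) {q : Condition (edK H) (edSigma H) F}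
    (hx : branchCondition hs hH hb x k ≤ q) (hy : branchCondition hs hH hb y k ≤ q) :
    ¬ Active M q.1.w.1 n := by
  intro hact
  have h1 := branch_succ x n
  have h2 := branch_succ y n
  rw [← branch_congr h] at h2
  have nx := not_kills_branch (n := n + 1) hs hH hb hk hx
  have ny := not_kills_branch (n := n + 1) hs hH hb hk hy
  rw [h1] at nx
  rw [h2] at ny
  have hxy : ((x n : ℕ) = 0 ∧ (y n : ℕ) = 1) ∨ ((x n : ℕ) = 1 ∧ (y n : ℕ) = 0) := by
    have : (x n : ℕ) ≠ y n := fun h => hn (Fin.ext h)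
    omega
  rcases hxy with ⟨e1, e2⟩ | ⟨e1, e2⟩ <;> rw [e1] at nx <;> rw [e2] at ny <;>
    simp only [zero_mul, one_mul, add_zero] at nx ny <;>
    rcases hact _ (branch_lt x n) with h | h
  exacts [nx h, ny h, ny h, nx h]

theorem getElem?_readBits_eq_zero {v : FinSeq H} {n : ℕ} (hn : n < (readBits M v).lh)
    (h : ∀ u, u <+: v.1 → ¬ Active M u n) : (readBits M v).1[n]? = some 0 := by
  have h1 : (readBits M v).1[n]? = some (readBits M v).1[n] := List.getElem?_eq_getElem hn
  have h2 : (readBits M v).1[n] < 2 := (readBits M v).2 n hn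
  have h3 : (readBits M v).1[n] ≠ 1 := fun h3 => by
    rw [h3] at h1
    obtain ⟨u, hu, hu'⟩ := exists_active_of_emit h1
    exact h u hu hu'
  rw [h1]
  congr 1
  omega

theorem Active.mono {u v : List ℕ} {a : ℕ} (h : Active M u a) (huv : u <+: v) : Active M v a :=
  fun s hs => (h s hs).imp (Kills.mono huv) (Kills.mono huv)

theorem veryExplicitlySourTo_readings (hs : IsScale H B M) (hH : ∀ i, 2 ^ 2 ^ (i + 1) ≤ H i)
    (hb : SlalomBound H F B) :
    VeryExplicitlySourTo QStar.code ((hs.isReading hH hb).name hb (hs.allowsUnit hH))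
      QStar.code ((hs.isReading hH hb).flip.name hb (hs.allowsUnit hH)) := by
  let g : (ℕ → Fin 2) × ℕ → QStar (edK H) (edSigma H) F :=
    fun z => (branchCondition hs hH hb z.1 z.2 : Condition (edK H) (edSigma H) F)
  have hg : Measurable fun z => QStar.code (g z) := measurable_code_branchCondition hs hH hb
  have hpre : ∀ x, Predense (range fun n : ℕ => g (x, n)) := predense_branchCondition hs hH hb
  -- The same conditions serve both names; only the reading is complemented.
  refine ⟨g, g, hg, hg, hpre, hpre, fun x₀ x₁ m k₀ k₁ hne hag hk₀ hk₁ => ?_⟩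
  obtain ⟨n, hmn, hn, hn'⟩ := exists_first_difference hne hag
  have key : ∀ k < m, ∀ q : Condition (edK H) (edSigma H) F,
      branchCondition hs hH hb x₀ k ≤ q → branchCondition hs hH hb x₁ k ≤ q →
      n < (readBits M q.1.w).lh → (readBits M q.1.w).1[n]? = some 0 :=
    fun k hk q h0 h1 hl => getElem?_readBits_eq_zero hl fun u hu hact =>
      not_active_of_branchCondition_le hs hH hb (hk.le.trans hmn) hn hn' h0 h1 (hact.mono hu)
  -- Length n + 1 is needed to see the bit at place n. This n is the first difference, so n ≥ m
  -- exceeds both k₀ and k₁.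
  refine ⟨n + 1, {η | η.lh = n + 1 ∧ η.1[n]? = some 0}, {η | η.lh = n + 1 ∧ η.1[n]? = some 1},
    fun η h => h.1, fun η h => h.1, ?_, fun q h0 h1 => ?_, fun q h0 h1 => ?_⟩
  · refine Set.disjoint_left.2 fun η h h' => ?_
    have := h.2.symm.trans h'.2
    simp at this
  · obtain ⟨q, rfl, hq0⟩ := QStar.coe_of_coe_le h0
    have hq1 := WithBot.coe_le_coe.1 h1
    refine (hs.isReading hH hb).forces hb _ (n := n + 1) fun r hr hl => ⟨?_, ?_⟩
    · rw [FinSeq.lh_restr, min_eq_left hl]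
    · rw [← key k₀ hk₀ r (hq0.trans hr) (hq1.trans hr) hl]
      exact List.getElem?_take_of_lt (Nat.lt_succ_self n)
  · obtain ⟨q, rfl, hq0⟩ := QStar.coe_of_coe_le h0
    have hq1 := WithBot.coe_le_coe.1 h1
    refine (hs.isReading hH hb).flip.forces hb _ (n := n + 1) fun r hr hl => ⟨?_, ?_⟩
    · rw [FinSeq.lh_restr, min_eq_left hl]
    · rw [Cohen.lh_flip] at hl
      have h2 := key k₁ hk₁ r (hq0.trans hr) (hq1.trans hr) hl
      refine (List.getElem?_take_of_lt (Nat.lt_succ_self n)).trans ?_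
      simp only [Cohen.flip]
      rw [List.getElem?_map, h2]
      rfl

theorem veryExplicitlySourOverCohen_of_isScale (hs : IsScale H B M)
    (hH : ∀ i, 2 ^ 2 ^ (i + 1) ≤ H i) (hb : SlalomBound H F B) :
    VeryExplicitlySourOverCohen (QStar.code : QStar (edK H) (edSigma H) F → ℕ → ℕ) :=
  ⟨fun _ => le_rfl, cohen_souslinCCC, cohen_isGenericRealName, QStar.souslinCCC hb, _, _,
    (hs.isReading hH hb).mapsOnto hb (hs.allowsUnit hH),
    (hs.isReading hH hb).flip.mapsOnto hb (hs.allowsUnit hH),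
    veryExplicitlySourTo_readings hs hH hb⟩

/-! ### The scales and bounds for F₁ and F₂ -/

theorem isScale_famF1 : IsScale H (fun k _ => 2 ^ k) fun _ => 1 where
  pos _ := one_pos
  le_two_pow _ := Nat.one_le_two_pow
  le_bound := ⟨0, fun _ => le_rfl⟩
  bound_le k := ⟨2 ^ k, fun _ => (mul_one _).ge⟩

theorem isScale_famF2 : IsScale H (fun k i => k * 2 ^ i) fun i => 2 ^ i where
  pos _ := Nat.two_pow_pos _
  le_two_pow _ := le_rfl
  le_bound := ⟨1, fun _ => (one_mul _).ge⟩
  bound_le k := ⟨k, fun _ => le_rfl⟩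

theorem eventually_four_mul_lt (hH : ∀ i, 2 ^ 2 ^ (i + 1) ≤ H i) {b : ℕ → ℕ} (k : ℕ)
    (hb : ∀ᶠ i in atTop, b i ≤ 2 ^ (k * i)) : ∀ᶠ i in atTop, 4 * b i < H i := by
  filter_upwards [hb, eventually_mul_add_two_lt_two_pow k] with i h1 h2
  calc 4 * b i ≤ 2 ^ (k * i + 2) := by rw [pow_add]; omega
    _ < 2 ^ 2 ^ (i + 1) := Nat.pow_lt_pow_right (by norm_num) h2
    _ ≤ H i := hH i

theorem slalomBound_famF1 (hH : ∀ i, 2 ^ 2 ^ (i + 1) ≤ H i) :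
    SlalomBound H (famF1 H) fun k _ => 2 ^ k := by
  refine slalomBound_range (fun i => (Nat.two_pow_pos _).trans_le (hH i))
    (fun k => eventually_four_mul_lt hH k ?_) fun k l => ⟨max k l + 1, Eventually.of_forall ?_⟩
  · filter_upwards [eventually_ge_atTop 1] with i hi
    exact Nat.pow_le_pow_right (by norm_num) (Nat.le_mul_of_pos_right k hi)
  · intro i
    have h1 : 2 ^ k ≤ 2 ^ max k l := Nat.pow_le_pow_right (by norm_num) (le_max_left _ _)
    have h2 : 2 ^ l ≤ 2 ^ max k l := Nat.pow_le_pow_right (by norm_num) (le_max_right _ _)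
    rw [pow_succ]
    omega

theorem slalomBound_famF2 (hH : ∀ i, 2 ^ 2 ^ (i + 1) ≤ H i) :
    SlalomBound H (famF2 H) fun k i => k * 2 ^ i := by
  refine slalomBound_range (fun i => (Nat.two_pow_pos _).trans_le (hH i))
    (fun k => eventually_four_mul_lt hH (k + 1) ?_)
    fun k l => ⟨k + l, Eventually.of_forall fun i => (add_mul _ _ _).ge⟩
  filter_upwards [eventually_ge_atTop 1] with i hi
  have h1 : k ≤ 2 ^ (k * i) :=
    (Nat.le_mul_of_pos_right k hi).trans Nat.lt_two_pow_self.le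
  rw [add_mul, one_mul, pow_add]
  exact Nat.mul_le_mul_right _ h1

end sour

theorem mainTheorem9 (H : ℕ → ℕ) (hH : ∀ i, 2 ^ 2 ^ (i + 1) ≤ H i) :
    TopologicallySweet (QStar (edK H) (edSigma H) (famF0 H)) ∧
    VeryExplicitlySourOverCohen
      (QStar.code : QStar (edK H) (edSigma H) (famF1 H) → ℕ → ℕ) ∧
    VeryExplicitlySourOverCohen
      (QStar.code : QStar (edK H) (edSigma H) (famF2 H) → ℕ → ℕ) :=
  ⟨topologicallySweet_famF0 hH,
    veryExplicitlySourOverCohen_of_isScale isScale_famF1 hH (slalomBound_famF1 hH),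
    veryExplicitlySourOverCohen_of_isScale isScale_famF2 hH (slalomBound_famF2 hH)⟩
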